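/- Let $\Pi^2=\{0,1,x,x^2,\dots,y,y^2,\dots\}$ be the commutative pointed monoid with base point $0$ and $xy=0$. Its cyclic bar construction is the pointed cyclic set $N^{\mathrm{cy}}(\Pi^2)[n]=\Pi^2\wedge\dots\wedge\Pi^2$ ($n+1$ factors) with the structure maps $d_i(\pi_0\wedge\dots\wedge\pi_n)=\pi_0\wedge\dots\wedge\pi_i\pi_{i+1}\wedge\dots\wedge\pi_n$ for $0\le i<n$, $d_n(\pi_0\wedge\dots\wedge\pi_n)=\pi_n\pi_0\wedge\pi_1\wedge\dots\wedge\pi_{n-1}$, $s_i(\pi_0\wedge\dots\wedge\pi_n)=\pi_0\wedge\dots\wedge\pi_i\wedge1\wedge\pi_{i+1}\wedge\dots\wedge\pi_n$ and $t_n(\pi_0\wedge\dots\wedge\pi_n)=\pi_n\wedge\pi_0\wedge\dots\wedge\pi_{n-1}$. A cyclical word $\bar\omega$ of length $m$ in the letters $x,y$ is an orbit of words of length $m$ under cyclic permutation; its period is the number of words in the orbit. To $x^j$ (resp. $y^j$) assign the word of $j$ letters $x$ (resp. $y$), and to a tuple of non-zero elements the concatenation of the words of its entries. Let $N^{\mathrm{cy}}(\Pi^2,\bar\omega)$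 be the geometric realization of the cyclic subset of $N^{\mathrm{cy}}(\Pi^2)[-]$ that consists of the base point and the simplices $\pi_0\wedge\dots\wedge\pi_n$, with all $\pi_k\neq0$, whose word lies in $\bar\omega$. It is a pointed space with the action of the circle group $\mathbb T$ that the realization of every cyclic set carries. For $m\ge1$ let $\mathbb R[C_m]-1$ be the reduced regular representation of the cyclic group $C_m$, and let $S^{\mathbb R[C_m]-1}$ be its one-point compactification, with base point $\infty$. For $m=2i$ let $C_i\subset C_m$ be the subgroup of order $i$, and regard $C_m$ as the group of $m$-th roots of unity in $\mathbb T$. Then $S^{\mathbb R[C_m]-1}\wedge_{C_i}\mathbb T_+$ is the quotient of $S^{\mathbb R[C_m]-1}\times\mathbb T$ by the identifications $(ga,z)\sim(a,gz)$ for $g\in C_i$ and by collapsing $\{\infty\}\times\mathbb T$ to a point; $\mathbb T$ acts by multiplication on the second factor. Let $\bar\omega$ be a cyclical word in $x$ and $y$ of period $s\ge2$. (i) If $s=2$ and $\bar\omega$ has length $m=2i$, then for every representative word $\omega=\ell_1\ell_2\cdots\ell_m\in\bar\omega$ there is a base-point preserving $\mathbb T$-equivariant homeomorphism $$S^{\mathbb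 R[C_m]-1}\wedge_{C_i}\mathbb T_+\xrightarrow{\ \sim\ }N^{\mathrm{cy}}(\Pi^2,\bar\omega)$$ which is adapted to $\omega$ in the sense that it carries the class of $(0,1)$ to the barycentre of the $(m-1)$-simplex $\ell_1\wedge\ell_2\wedge\dots\wedge\ell_m$. (ii) If $s>2$, then $N^{\mathrm{cy}}(\Pi^2,\bar\omega)$ is $\mathbb T$-equivariantly contractible: there is a $\mathbb T$-equivariant homotopy, fixing the base point, from the identity map to the constant map at the base point. -/

import Mathlib

/-- The two letters. -/
inductive Letter : Type
  | x : Letter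
  | y : Letter
  deriving DecidableEq

/-- The pointed monoid `{0, 1, x, x², …, y, y², …}` with `xy = 0`; here `pow l n` is the
element `l ^ (n + 1)`. -/
inductive PiTwo : Type
  | zero : PiTwo
  | one : PiTwo
  | pow (l : Letter) (n : ℕ) : PiTwo

namespace PiTwo

/-- The multiplication of `PiTwo`. -/
def mul : PiTwo → PiTwo → PiTwo
  | zero, _ => zero
  | one, b => b
  | pow _ _, zero => zero
  | pow l m, one => pow l m
  | pow l m, pow k n => if l = k then pow l (m + n + 1) else zero

instance : CommMonoidWithZero PiTwo where
  mul := mul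
  one := one
  zero := zero
  mul_assoc a b c := by
    change mul (mul a b) c = mul a (mul b c)
    rcases a with _ | _ | ⟨l, m⟩ <;> rcases b with _ | _ | ⟨k, n⟩ <;>
      rcases c with _ | _ | ⟨j, p⟩ <;> try rfl
    · simp only [mul]; split_ifs <;> rfl
    · simp only [mul]; split_ifs <;> rfl
    · simp only [mul]
      by_cases h : l = k <;> by_cases h' : k = j <;> simp_all
      omega
  one_mul _ := rfl
  mul_one a := by rcases a with _ | _ | ⟨l, m⟩ <;> rfl
  mul_comm a b := by
    change mul a b = mul b a
    rcases a with _ | _ | ⟨l, m⟩ <;> rcases b with _ | _ | ⟨k, n⟩ <;> try rfl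
    simp only [mul, eq_comm (a := l)]
    split_ifs with h
    · subst h; rw [Nat.add_comm m]
    · rfl
  zero_mul _ := rfl
  mul_zero a := by rcases a with _ | _ | ⟨l, m⟩ <;> rfl

/-- The word of a non-zero element: `xⁿ` gives the word of `n` letters `x`, and `yⁿ` the word of
`n` letters `y` (the value at `0` is junk and not used). -/
def word : PiTwo → List Letter
  | zero => []
  | one => []
  | pow l n => List.replicate (n + 1) l

lemma word_mul {a b : PiTwo} (h : a * b ≠ 0) : (a * b).word = a.word ++ b.word := by
  rcases a with _ | _ | ⟨l, m⟩ <;> rcases b with _ | _ | ⟨k, n⟩ <;> try rfl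
  · exact absurd rfl h
  · exact absurd rfl h
  · exact (List.append_nil (word (pow l m))).symm
  · change (mul _ _).word = _
    have h' : mul (pow l m) (pow k n) ≠ zero := h
    simp only [mul] at h' ⊢
    split_ifs at h' ⊢ with e
    · subst e
      simp only [word, List.replicate_append_replicate]
      congr 1; omega
    · exact absurd rfl h'

lemma word_list_prod (L : List PiTwo) (h : L.prod ≠ 0) : L.prod.word = L.flatMap word := by
  induction L with
  | nil => rfl
  | cons a L ih =>
    rw [List.prod_cons] at h ⊢
    rw [word_mul h, ih (right_ne_zero_of_mul h), List.flatMap_cons]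

end PiTwo

/-- The period of a cyclical word `c` (an orbit of words under cyclic permutation, that is, an
element of `Cycle Letter`): the number of words in the orbit. -/
noncomputable def wordPeriod (c : Cycle Letter) : ℕ :=
  {ω : List Letter | (ω : Cycle Letter) = c}.ncard

section CyclicSpaces

open CategoryTheory Simplicial

/-- A cyclic set: a simplicial set together with cyclic operators `t` that satisfy the usual
relations. -/
structure CyclicSet where
  /-- the underlying simplicial set -/
  sset : SSet.{0}
  /-- the cyclic operator on `n`-simplices -/
  t : ∀ n : ℕ, sset _⦋n⦌ → sset _⦋n⦌
  t_iterate : ∀ (n : ℕ) (x : sset _⦋n⦌), (t n)^[n + 1] x = x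
  δ_zero_t : ∀ (n : ℕ) (x : sset _⦋n + 1⦌),
    sset.δ 0 (t (n + 1) x) = sset.δ (Fin.last (n + 1)) x
  δ_succ_t : ∀ (n : ℕ) (i : Fin (n + 1)) (x : sset _⦋n + 1⦌),
    sset.δ i.succ (t (n + 1) x) = t n (sset.δ i.castSucc x)
  σ_zero_t : ∀ (n : ℕ) (x : sset _⦋n⦌),
    sset.σ 0 (t n x) = t (n + 1) (t (n + 1) (sset.σ (Fin.last n) x))
  σ_succ_t : ∀ (n : ℕ) (i : Fin n) (x : sset _⦋n⦌),
    sset.σ i.succ (t n x) = t (n + 1) (sset.σ i.castSucc x)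

namespace CyclicSet

variable (X : CyclicSet)

lemma t_δ {n : ℕ} (a i : ℕ) (h : i + a < n + 2) (x : X.sset _⦋n + 1⦌) :
    (X.t n)^[a] (X.sset.δ ⟨i, by omega⟩ x) = X.sset.δ ⟨i + a, h⟩ ((X.t (n + 1))^[a] x) := by
  induction a with
  | zero => rfl
  | succ a ih =>
    rw [Function.iterate_succ_apply', ih (by omega), Function.iterate_succ_apply']
    exact (X.δ_succ_t n ⟨i + a, by omega⟩ _).symm

lemma t_δ_last {n : ℕ} (b : ℕ) (h : b < n + 2) (x : X.sset _⦋n + 1⦌) :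
    (X.t n)^[b] (X.sset.δ (Fin.last (n + 1)) x) = X.sset.δ ⟨b, h⟩ ((X.t (n + 1))^[b + 1] x) := by
  rw [← X.δ_zero_t, show (0 : Fin (n + 2)) = ⟨0, by omega⟩ from rfl, X.t_δ b 0 (by omega),
    ← Function.iterate_succ_apply]
  simp only [Nat.zero_add]

lemma t_σ {n : ℕ} (a i : ℕ) (h : i + a < n + 1) (x : X.sset _⦋n⦌) :
    (X.t (n + 1))^[a] (X.sset.σ ⟨i, by omega⟩ x) = X.sset.σ ⟨i + a, h⟩ ((X.t n)^[a] x) := by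
  induction a with
  | zero => rfl
  | succ a ih =>
    rw [Function.iterate_succ_apply', ih (by omega), Function.iterate_succ_apply']
    exact (X.σ_succ_t n ⟨i + a, by omega⟩ _).symm

lemma t_σ_last {n : ℕ} (b : ℕ) (h : b < n + 1) (x : X.sset _⦋n⦌) :
    (X.t (n + 1))^[b + 2] (X.sset.σ (Fin.last n) x) = X.sset.σ ⟨b, h⟩ ((X.t n)^[b + 1] x) := by
  rw [Function.iterate_add_apply, show (X.t (n + 1))^[2] (X.sset.σ (Fin.last n) x) =
    X.t (n + 1) (X.t (n + 1) (X.sset.σ (Fin.last n) x)) from rfl, ← X.σ_zero_t,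
    show (0 : Fin (n + 1)) = ⟨0, by omega⟩ from rfl, X.t_σ b 0 (by omega),
    ← Function.iterate_succ_apply]
  simp only [Nat.zero_add]

/-- The disjoint union of the spaces `X[n] × Δⁿ`, where `X[n]` is discrete. -/
abbrev Cells : Type :=
  Σ p : (Σ n : ℕ, X.sset _⦋n⦌), stdSimplex ℝ (Fin (p.1 + 1))

/-- The gluing relation `(f^* x, u) ∼ (x, f_* u)`, for `f` a morphism of the simplex category. -/
def GlueRel (p q : X.Cells) : Prop :=
  ∃ (m n : ℕ) (f : ⦋m⦌ ⟶ ⦋n⦌) (x : X.sset _⦋n⦌) (u : stdSimplex ℝ (Fin (m + 1))),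
    p = ⟨⟨m, X.sset.map f.op x⟩, u⟩ ∧ q = ⟨⟨n, x⟩, stdSimplex.map f.toOrderHom u⟩

/-- The geometric realization of (the underlying simplicial set of) a cyclic set: the quotient
of the disjoint union of the `X[n] × Δⁿ` by the gluing relation. -/
def Realization : Type := Quot X.GlueRel

instance : TopologicalSpace X.Realization := inferInstanceAs (TopologicalSpace (Quot X.GlueRel))

variable {X}

/-- The point of the realization with coordinates `u` in the simplex `x`. -/
def pt {n : ℕ} (x : X.sset _⦋n⦌) (u : stdSimplex ℝ (Fin (n + 1))) : X.Realization :=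
  Quot.mk _ ⟨⟨n, x⟩, u⟩

lemma pt_map {m n : ℕ} (f : ⦋m⦌ ⟶ ⦋n⦌) (x : X.sset _⦋n⦌) (u : stdSimplex ℝ (Fin (m + 1))) :
   pt (X.sset.map f.op x) u = pt x (stdSimplex.map f.toOrderHom u) :=
  Quot.sound ⟨m, n, f, x, u, rfl, rfl⟩

end CyclicSet

/-- The sum of the barycentric coordinates `u l` with `l < k`. -/
noncomputable def partialSum {n : ℕ} (u : stdSimplex ℝ (Fin (n + 1))) (k : ℕ) : ℝ :=
  ∑ l : Fin (n + 1), if l.val < k then u l else 0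

lemma partialSum_zero {n : ℕ} (u : stdSimplex ℝ (Fin (n + 1))) : partialSum u 0 = 0 := by
  simp [partialSum]

lemma partialSum_succ {n : ℕ} (u : stdSimplex ℝ (Fin (n + 1))) (j : Fin (n + 1)) :
    partialSum u (j + 1) = partialSum u j + u j := by
  have : u j = ∑ l : Fin (n + 1), if l = j then u l else 0 := by simp
  rw [partialSum, partialSum, this, ← Finset.sum_add_distrib]
  refine Finset.sum_congr rfl fun l _ => ?_
  rcases lt_trichotomy l j with h | h | h
  · have := h.ne; have : l.val < j.val := h
    simp [*]; omega
  · subst h; simp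
  · have := h.ne'; have : j.val < l.val := h
    rw [if_neg (by omega), if_neg (by omega), if_neg (by assumption)]; simp

lemma partialSum_mono {n : ℕ} (u : stdSimplex ℝ (Fin (n + 1))) {k l : ℕ} (h : k ≤ l) :
    partialSum u k ≤ partialSum u l := by
  refine Finset.sum_le_sum fun i _ => ?_
  have := stdSimplex.zero_le u i
  split_ifs <;> first | omega | simp [*]

lemma partialSum_last {n : ℕ} (u : stdSimplex ℝ (Fin (n + 1))) : partialSum u (n + 1) = 1 := by
  rw [← stdSimplex.sum_eq_one u]
  exact Finset.sum_congr rfl fun i _ => if_pos i.2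

/-- `CutsAt u θ j`: the point `θ ∈ [0, 1)` lies in the `j`-th of the consecutive half-open
intervals of lengths `u 0, …, u n` into which `[0, 1)` is subdivided. -/
def CutsAt {n : ℕ} (u : stdSimplex ℝ (Fin (n + 1))) (θ : ℝ) (j : Fin (n + 1)) : Prop :=
  partialSum u j ≤ θ ∧ θ < partialSum u (j + 1)

lemma CutsAt.unique {n : ℕ} {u : stdSimplex ℝ (Fin (n + 1))} {θ : ℝ} {j k : Fin (n + 1)}
    (hj : CutsAt u θ j) (hk : CutsAt u θ k) : j = k := by
  by_contra hne
  rcases lt_or_gt_of_ne hne with h | h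
  · exact absurd (hj.2.trans_le ((partialSum_mono u (Nat.succ_le_of_lt h)).trans hk.1)) (lt_irrefl _)
  · exact absurd (hk.2.trans_le ((partialSum_mono u (Nat.succ_le_of_lt h)).trans hj.1)) (lt_irrefl _)

lemma exists_cutsAt {n : ℕ} (u : stdSimplex ℝ (Fin (n + 1))) {θ : ℝ} (h0 : 0 ≤ θ) (h1 : θ < 1) :
    ∃ j, CutsAt u θ j := by
  classical
  have hex : ∃ k, θ < partialSum u (k + 1) := ⟨n, by rwa [partialSum_last]⟩
  have hle : Nat.find hex ≤ n := Nat.find_min' hex (by rwa [partialSum_last])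
  refine ⟨⟨Nat.find hex, by omega⟩, ?_, Nat.find_spec hex⟩
  by_cases hz : Nat.find hex = 0
  · simpa [hz, partialSum_zero] using h0
  · obtain ⟨k, hk⟩ := Nat.exists_eq_succ_of_ne_zero hz
    have := Nat.find_min hex (m := k) (by omega)
    simp only [hk]
    exact not_lt.mp this

/-- The index of the interval containing `θ` (for `θ ∈ [0, 1)`; junk otherwise). -/
noncomputable def cutIndex {n : ℕ} (u : stdSimplex ℝ (Fin (n + 1))) (θ : ℝ) : Fin (n + 1) :=
  open Classical in if h : ∃ j, CutsAt u θ j then h.choose else 0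

lemma cutsAt_cutIndex {n : ℕ} (u : stdSimplex ℝ (Fin (n + 1))) {θ : ℝ} (h0 : 0 ≤ θ)
    (h1 : θ < 1) : CutsAt u θ (cutIndex u θ) := by
  have h := exists_cutsAt u h0 h1
  rw [cutIndex, dif_pos h]
  exact h.choose_spec

/-- If `θ` lies in the `j`-th interval, then cutting that interval at `θ` and starting again from
there gives intervals of lengths
`S (j+1) - θ, u (j+1), …, u n, u 0, …, u (j-1), θ - S j`, where `S k = u 0 + … + u (k-1)`. -/
noncomputable def cutFun {n : ℕ} (u : stdSimplex ℝ (Fin (n + 1))) (θ : ℝ) (j : Fin (n + 1)) :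
    Fin (n + 2) → ℝ :=
  Fin.snoc (α := fun _ => ℝ)
    (fun l : Fin (n + 1) => if l = 0 then partialSum u (j + 1) - θ else u (j + l))
    (θ - partialSum u j)

lemma sum_cutFun {n : ℕ} (u : stdSimplex ℝ (Fin (n + 1))) (θ : ℝ) (j : Fin (n + 1))
    (c : Fin (n + 2) → ℝ) :
    ∑ l, c l * cutFun u θ j l =
      ∑ k, u k * (c (k - j).castSucc - if k < j then c (Fin.last _) - c 0 else 0)
        + (c (Fin.last _) - c 0) * θ := by
  rw [Fin.sum_univ_castSucc]
  simp only [cutFun, Fin.snoc_castSucc, Fin.snoc_last]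
  have h1 : ∀ l : Fin (n + 1), c l.castSucc * (if l = 0 then partialSum u (j + 1) - θ
      else u (j + l)) = c l.castSucc * u (j + l) +
        if l = 0 then c 0 * (partialSum u j - θ) else 0 := by
    intro l
    split_ifs with h
    · subst h; rw [partialSum_succ]; simp; ring
    · simp
  simp only [h1, Finset.sum_add_distrib, Finset.sum_ite_eq', Finset.mem_univ, if_true]
  have h2 : ∑ l : Fin (n + 1), c l.castSucc * u (j + l) =
      ∑ k, u k * c (k - j).castSucc := by
    rw [← Equiv.sum_comp (Equiv.addLeft j) (fun k => u k * c (k - j).castSucc)]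
    refine Finset.sum_congr rfl fun l _ => ?_
    simp [mul_comm]
  have h3 : ∑ k, u k * (if k < j then c (Fin.last _) - c 0 else 0) =
      (c (Fin.last _) - c 0) * partialSum u j := by
    rw [partialSum, Finset.mul_sum]
    refine Finset.sum_congr rfl fun l _ => ?_
    simp only [Fin.lt_def]
    split_ifs <;> ring
  simp only [mul_sub, Finset.sum_sub_distrib, h2, h3]
  ring

/-- The point of `Δⁿ⁺¹` obtained from `u` by cutting at `θ` and starting again from there. -/
noncomputable def cut {n : ℕ} (u : stdSimplex ℝ (Fin (n + 1))) {θ : ℝ} (h0 : 0 ≤ θ)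
    (h1 : θ < 1) : stdSimplex ℝ (Fin (n + 2)) :=
  ⟨cutFun u θ (cutIndex u θ), by
    have h := cutsAt_cutIndex u h0 h1
    constructor
    · intro l
      refine Fin.lastCases ?_ (fun l => ?_) l
      · simpa [cutFun] using h.1
      · simp only [cutFun, Fin.snoc_castSucc]
        split_ifs
        · linarith [h.2]
        · exact stdSimplex.zero_le u _
    · simpa using sum_cutFun u θ (cutIndex u θ) 1⟩

lemma sum_map {m n : ℕ} (f : Fin m → Fin n) (u : stdSimplex ℝ (Fin m)) (c : Fin n → ℝ) :
    ∑ k, stdSimplex.map f u k * c k = ∑ l, u l * c (f l) := by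
  simp only [stdSimplex.map_coe, FunOnFinite.linearMap_apply_apply, Finset.sum_mul]
  rw [← Finset.sum_fiberwise Finset.univ f (fun l => u l * c (f l))]
  refine Finset.sum_congr rfl fun k _ => Finset.sum_congr rfl fun l hl => ?_
  simp only [Finset.mem_filter, Finset.mem_univ, true_and] at hl
  rw [hl]

lemma simplex_ext {n : ℕ} {u v : stdSimplex ℝ (Fin n)}
    (h : ∀ c : Fin n → ℝ, ∑ k, u k * c k = ∑ k, v k * c k) : u = v := by
  refine stdSimplex.ext (funext fun k => ?_)
  simpa [Pi.single_apply] using h (Pi.single k 1)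

lemma partialSum_map {m n : ℕ} (f : Fin (m + 1) → Fin (n + 1)) (u : stdSimplex ℝ (Fin (m + 1)))
    (k : ℕ) : partialSum (stdSimplex.map f u) k = ∑ l, if (f l).val < k then u l else 0 := by
  have := sum_map f u (fun i => if i.val < k then 1 else 0)
  simpa [partialSum] using this

lemma cutIndex_map {m n : ℕ} {f : Fin (m + 1) → Fin (n + 1)} (hf : Monotone f)
    (u : stdSimplex ℝ (Fin (m + 1))) {θ : ℝ} (h0 : 0 ≤ θ) (h1 : θ < 1) :
    cutIndex (stdSimplex.map f u) θ = f (cutIndex u θ) := by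
  refine (cutsAt_cutIndex _ h0 h1).unique ?_
  obtain ⟨h2, h3⟩ := cutsAt_cutIndex u h0 h1
  set j := cutIndex u θ
  constructor
  · refine le_trans ?_ h2
    rw [partialSum_map, partialSum]
    refine Finset.sum_le_sum fun l _ => ?_
    have h := stdSimplex.zero_le u l
    split_ifs with ha hb hb
    · exact le_rfl
    · exact absurd (hf (show j ≤ l by rw [Fin.le_def]; omega)) (by rw [Fin.le_def]; omega)
    · exact h
    · exact le_rfl
  · refine lt_of_lt_of_le h3 ?_
    rw [partialSum_map, partialSum]
    refine Finset.sum_le_sum fun l _ => ?_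
    have h := stdSimplex.zero_le u l
    split_ifs with ha hb hb
    · exact le_rfl
    · exact absurd (hf (show l ≤ j by rw [Fin.le_def]; omega)) (by rw [Fin.le_def]; omega)
    · exact h
    · exact le_rfl

lemma map_cut {m n : ℕ} {f : Fin (m + 1) → Fin (n + 1)} (hf : Monotone f)
    (u : stdSimplex ℝ (Fin (m + 1))) {θ : ℝ} (h0 : 0 ≤ θ) (h1 : θ < 1)
    (φ : Fin (m + 2) → Fin (n + 2)) (hφ0 : φ 0 = 0) (hφl : φ (Fin.last _) = Fin.last _)
    (hφ : ∀ l j, j = cutIndex u θ → φ (l - j).castSucc =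
      if l < j ∧ f l = f j then Fin.last _ else (f l - f j).castSucc) :
    stdSimplex.map φ (cut u h0 h1) = cut (stdSimplex.map f u) h0 h1 := by
  refine simplex_ext fun c => ?_
  rw [sum_map]
  have e1 := sum_cutFun u θ (cutIndex u θ) (fun l => c (φ l))
  have e2 := sum_cutFun (stdSimplex.map f u) θ (cutIndex (stdSimplex.map f u) θ) c
  rw [cutIndex_map hf u h0 h1] at e2
  have e3 : ∀ l, (cut u h0 h1) l = cutFun u θ (cutIndex u θ) l := fun l => rfl
  have e4 : ∀ l, (cut (stdSimplex.map f u) h0 h1) l =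
    cutFun (stdSimplex.map f u) θ (f (cutIndex u θ)) l := fun l => by
      rw [← cutIndex_map hf u h0 h1]; rfl
  simp only [e3, e4, mul_comm _ (c _)]
  rw [e1, e2, hφ0, hφl, sum_map]
  congr 1
  refine Finset.sum_congr rfl fun l _ => ?_
  rw [hφ l _ rfl]
  set j := cutIndex u θ
  congr 1
  by_cases hlj : l < j
  · by_cases hfl : f l = f j
    · simp [hlj, hfl]
    · have : f l < f j := lt_of_le_of_ne (hf hlj.le) hfl
      simp [hlj, hfl, this]
  · have : ¬ f l < f j := not_lt.mpr (hf (not_lt.mp hlj))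
    simp [hlj, this]

namespace CyclicSet
variable {X : CyclicSet}

/-- Rotation by the angle `2πθ` on representatives. For the cyclic bar construction it sends
`π₀ ∧ … ∧ πₙ` with coordinates `u`, viewed as the circle of length `1` with `π₀, …, πₙ` placed at
the starting points of consecutive arcs of lengths `u 0, …, u n`, to `1 ∧ πⱼ₊₁ ∧ … ∧ πₙ ∧ π₀ ∧ … ∧ πⱼ`: the
unit is inserted at `θ`, which becomes the new starting point. -/
noncomputable def rotPt {n : ℕ} (x : X.sset _⦋n⦌) (u : stdSimplex ℝ (Fin (n + 1)))
    {θ : ℝ} (h0 : 0 ≤ θ) (h1 : θ < 1) : X.Realization :=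
  pt ((X.t (n + 1))^[n + 1 - cutIndex u θ] (X.sset.σ (cutIndex u θ) x)) (cut u h0 h1)

lemma rotPt_map_of {m n : ℕ} (f : ⦋m⦌ ⟶ ⦋n⦌) (x : X.sset _⦋n⦌)
    (u : stdSimplex ℝ (Fin (m + 1))) {θ : ℝ} (h0 : 0 ≤ θ) (h1 : θ < 1)
    (φ : ⦋m + 1⦌ ⟶ ⦋n + 1⦌) (hφ0 : φ.toOrderHom 0 = 0)
    (hφl : φ.toOrderHom (Fin.last _) = Fin.last _)
    (hφ : ∀ l j, j = cutIndex u θ → φ.toOrderHom (l - j).castSucc =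
      if l < j ∧ f.toOrderHom l = f.toOrderHom j then Fin.last _
        else (f.toOrderHom l - f.toOrderHom j).castSucc)
    (hs : ∀ j, j = cutIndex u θ →
      (X.t (m + 1))^[m + 1 - j] (X.sset.σ j (X.sset.map f.op x)) =
        X.sset.map φ.op ((X.t (n + 1))^[n + 1 - f.toOrderHom j] (X.sset.σ (f.toOrderHom j) x))) :
    rotPt (X.sset.map f.op x) u h0 h1 = rotPt x (stdSimplex.map f.toOrderHom u) h0 h1 := by
  rw [rotPt, rotPt, hs _ rfl, pt_map, map_cut f.toOrderHom.monotone u h0 h1 _ hφ0 hφl hφ,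
    cutIndex_map f.toOrderHom.monotone u h0 h1]

end CyclicSet

lemma fin_sub_val {n : ℕ} (l j : Fin (n + 1)) :
    (l - j).val = if j.val ≤ l.val then l.val - j.val else n + 1 + l.val - j.val := by
  have := l.2
  have := j.2
  rw [Fin.sub_def]
  simp only
  split_ifs with h
  · rw [show n + 1 - j.val + l.val = (l.val - j.val) + (n + 1) by omega, Nat.add_mod_right,
      Nat.mod_eq_of_lt (by omega)]
  · rw [Nat.mod_eq_of_lt (by omega)]; omega

lemma δ_val {N : ℕ} (a : Fin (N + 2)) (l : Fin (N + 1)) :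
    ((SimplexCategory.δ a).toOrderHom l).val = if l.val < a.val then l.val else l.val + 1 := by
  change (a.succAbove l).val = _
  rw [Fin.succAbove]
  simp only [Fin.lt_def, Fin.val_castSucc]
  split_ifs <;> simp

lemma σ_val {N : ℕ} (a : Fin (N + 1)) (l : Fin (N + 2)) :
    ((SimplexCategory.σ a).toOrderHom l).val = if l.val ≤ a.val then l.val else l.val - 1 := by
  change (a.predAbove l).val = _
  rw [Fin.predAbove]
  simp only [Fin.lt_def, Fin.val_castSucc]
  split_ifs <;> simp <;> omega

namespace CyclicSet
variable {X : CyclicSet}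

lemma rotPt_δ {n : ℕ} (i : Fin (n + 2)) (x : X.sset _⦋n + 1⦌)
    (u : stdSimplex ℝ (Fin (n + 1))) {θ : ℝ} (h0 : 0 ≤ θ) (h1 : θ < 1) :
    rotPt (X.sset.δ i x) u h0 h1 =
      rotPt x (stdSimplex.map (SimplexCategory.δ i).toOrderHom u) h0 h1 := by
  obtain ⟨j, hj⟩ : ∃ j, j = cutIndex u θ := ⟨_, rfl⟩
  have hi := i.2
  have hj2 := j.2
  by_cases hij : i.val ≤ j.val
  · refine rotPt_map_of (SimplexCategory.δ i) x u h0 h1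
      (SimplexCategory.δ ⟨i.val + (n + 1 - j), by omega⟩) ?_ ?_ ?_ ?_
    · ext; rw [δ_val]; simp; omega
    · ext; rw [δ_val]; simp; omega
    · intro l j' hj'
      obtain rfl : j' = j := hj'.trans hj.symm
      ext
      have := l.2
      rw [δ_val]
      simp only [Fin.lt_def, Fin.ext_iff, δ_val, fin_sub_val, Fin.val_castSucc, apply_ite Fin.val,
        Fin.val_last]
      split_ifs <;> omega
    · intro j' hj'
      obtain rfl : j' = j := hj'.trans hj.symm
      have e : (SimplexCategory.δ i).toOrderHom j' = j'.succ := by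
        ext; rw [δ_val, if_neg (by omega)]; rfl
      rw [e]
      have := X.sset.δ_comp_σ_of_le_apply (i := i) (j := j') hij x
      refine (congrArg _ this.symm).trans ?_
      refine (X.t_δ (n + 1 - j') i (by omega) _).trans ?_
      congr 2
      simp
  · refine rotPt_map_of (SimplexCategory.δ i) x u h0 h1
      (SimplexCategory.δ ⟨i.val - j, by omega⟩) ?_ ?_ ?_ ?_
    · ext; rw [δ_val]; simp; omega
    · ext; rw [δ_val]; simp; omega
    · intro l j' hj'
      obtain rfl : j' = j := hj'.trans hj.symm
      ext
      have := l.2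
      rw [δ_val]
      simp only [Fin.lt_def, Fin.ext_iff, δ_val, fin_sub_val, Fin.val_castSucc, apply_ite Fin.val,
        Fin.val_last]
      split_ifs <;> omega
    · intro j' hj'
      obtain rfl : j' = j := hj'.trans hj.symm
      have e : (SimplexCategory.δ i).toOrderHom j' = j'.castSucc := by
        ext; rw [δ_val, if_pos (by omega)]; rfl
      rw [e]
      have := X.sset.δ_comp_σ_of_gt_apply (i := i) (j := j') (by rw [Fin.lt_def]; simp; omega) x
      refine (congrArg _ this.symm).trans ?_
      rw [show n + 1 - j'.val = (i.val - j'.val) + (n + 1 - i.val) by omega, Function.iterate_add_apply,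
        show i.succ = ⟨i.val + 1, by omega⟩ from rfl, X.t_δ (n + 1 - i) (i + 1) (by omega)]
      have e2 : (⟨i.val + 1 + (n + 1 - i.val), by omega⟩ : Fin (n + 3)) = Fin.last (n + 2) := by
        ext; simp; omega
      rw [e2, X.t_δ_last (i - j') (by omega), ← Function.iterate_add_apply]
      simp only [Fin.val_castSucc]
      rw [show i.val - j'.val + 1 + (n + 1 - i.val) = n + 1 + 1 - j'.val by omega]
      rfl

lemma rotPt_σ {n : ℕ} (i : Fin (n + 1)) (x : X.sset _⦋n⦌)
    (u : stdSimplex ℝ (Fin (n + 2))) {θ : ℝ} (h0 : 0 ≤ θ) (h1 : θ < 1) :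
    rotPt (X.sset.σ i x) u h0 h1 =
      rotPt x (stdSimplex.map (SimplexCategory.σ i).toOrderHom u) h0 h1 := by
  obtain ⟨j, hj⟩ : ∃ j, j = cutIndex u θ := ⟨_, rfl⟩
  have hi := i.2
  have hj2 := j.2
  by_cases hij : j.val ≤ i.val
  · refine rotPt_map_of (SimplexCategory.σ i) x u h0 h1
      (SimplexCategory.σ ⟨i.val - j, by omega⟩) ?_ ?_ ?_ ?_
    · ext; rw [σ_val]; simp
    · ext; rw [σ_val]; simp; omega
    · intro l j' hj'
      obtain rfl : j' = j := hj'.trans hj.symm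
      ext
      have := l.2
      rw [σ_val]
      simp only [Fin.lt_def, Fin.ext_iff, σ_val, fin_sub_val, Fin.val_castSucc, apply_ite Fin.val,
        Fin.val_last]
      split_ifs <;> omega
    · intro j' hj'
      obtain rfl : j' = j := hj'.trans hj.symm
      obtain ⟨k, rfl⟩ : ∃ k : Fin (n + 1), j' = k.castSucc := ⟨⟨j', by omega⟩, rfl⟩
      have e : (SimplexCategory.σ i).toOrderHom k.castSucc = k := by
        ext; rw [σ_val, if_pos hij]; rfl
      rw [e]
      have := X.sset.σ_comp_σ_apply (i := k) (j := i) hij x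
      refine (congrArg _ this).trans ?_
      have hk : (k.castSucc).val = k.val := rfl
      have hij := hij
      rw [hk] at hij
      have hex : n + 1 + 1 - k.castSucc.val = (i.val - k.val + 2) + (n - i.val) := by omega
      rw [hex, Function.iterate_add_apply,
        show i.succ = ⟨i.val + 1, by omega⟩ from rfl, X.t_σ (n - i) (i + 1) (by omega)]
      have e2 : (⟨i.val + 1 + (n - i.val), by omega⟩ : Fin (n + 2)) = Fin.last (n + 1) := by
        ext; simp; omega
      rw [e2, X.t_σ_last (i - k) (by omega), ← Function.iterate_add_apply]
      rw [show i.val - k.val + 1 + (n - i.val) = n + 1 - k.val by omega]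
      rfl
  · refine rotPt_map_of (SimplexCategory.σ i) x u h0 h1
      (SimplexCategory.σ ⟨i.val + (n + 2 - j), by omega⟩) ?_ ?_ ?_ ?_
    · ext; rw [σ_val]; simp
    · ext; rw [σ_val]; simp; omega
    · intro l j' hj'
      obtain rfl : j' = j := hj'.trans hj.symm
      ext
      have := l.2
      rw [σ_val]
      simp only [Fin.lt_def, Fin.ext_iff, σ_val, fin_sub_val, Fin.val_castSucc, apply_ite Fin.val,
        Fin.val_last]
      split_ifs <;> omega
    · intro j' hj'
      obtain rfl : j' = j := hj'.trans hj.symm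
      obtain ⟨k, rfl⟩ : ∃ k : Fin (n + 1), j' = k.succ := ⟨⟨j' - 1, by omega⟩, by ext; simp; omega⟩
      have e : (SimplexCategory.σ i).toOrderHom k.succ = k := by
        ext; rw [σ_val, if_neg hij]; rfl
      rw [e]
      have hk : (k.succ).val = k.val + 1 := rfl
      rw [hk] at hij hj2
      have := X.sset.σ_comp_σ_apply (i := i) (j := k) (by rw [Fin.le_def]; omega) x
      refine (congrArg _ this.symm).trans ?_
      refine (X.t_σ (n + 1 + 1 - (k + 1)) i (by omega) _).trans ?_
      change X.sset.σ _ _ = X.sset.σ _ _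
      congr 2
      simp

lemma rotPt_map {m n : ℕ} (f : ⦋m⦌ ⟶ ⦋n⦌) (x : X.sset _⦋n⦌)
    (u : stdSimplex ℝ (Fin (m + 1))) {θ : ℝ} (h0 : 0 ≤ θ) (h1 : θ < 1) :
    rotPt (X.sset.map f.op x) u h0 h1 = rotPt x (stdSimplex.map f.toOrderHom u) h0 h1 := by
  let W : MorphismProperty SimplexCategory := fun a b f =>
    ∀ (x : X.sset.obj (Opposite.op b)) (u : stdSimplex ℝ (Fin (a.len + 1))),
      rotPt (n := a.len) (X.sset.map f.op x) u h0 h1 =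
        rotPt (n := b.len) x (stdSimplex.map f.toOrderHom u) h0 h1
  have : W.IsMultiplicative :=
    { id_mem := fun a x u => by
        rw [op_id, X.sset.map_id]
        congr 1
        exact (stdSimplex.map_id_apply u).symm
      comp_mem := fun {a b c} f g hf hg x u => by
        rw [op_comp, X.sset.map_comp]
        refine (hf _ u).trans ((hg x _).trans ?_)
        rw [stdSimplex.map_comp_apply]
        rfl }
  have hW : W = ⊤ := SimplexCategory.morphismProperty_eq_top W
    (fun i x u => rotPt_δ i x u h0 h1) (fun i x u => rotPt_σ i x u h0 h1)
  have h : W f := by rw [hW]; trivial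
  exact h x u

/-- Rotation of the realization by the angle `2πθ`, `0 ≤ θ < 1`. -/
noncomputable def rot {θ : ℝ} (h0 : 0 ≤ θ) (h1 : θ < 1) : X.Realization → X.Realization :=
  Quot.lift (fun p => rotPt p.1.2 p.2 h0 h1) (by
    rintro _ _ ⟨m, n, f, x, u, rfl, rfl⟩
    exact rotPt_map f x u h0 h1)

/-- The number `θ` in `[0, 1)` with `z = exp (2πiθ)`. -/
noncomputable def turn (z : Circle) : ℝ := Int.fract (Complex.arg z / (2 * Real.pi))

/-- The action of the circle group on the realization of a cyclic set. -/
noncomputable instance : SMul Circle X.Realization :=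
  ⟨fun z => rot (Int.fract_nonneg _ : 0 ≤ turn z) (Int.fract_lt_one _)⟩

end CyclicSet

lemma sum_cut {n : ℕ} (u : stdSimplex ℝ (Fin (n + 1))) {θ : ℝ} (h0 : 0 ≤ θ) (h1 : θ < 1)
    (c : Fin (n + 2) → ℝ) :
    ∑ l, cut u h0 h1 l * c l =
      ∑ k, u k * (c (k - cutIndex u θ).castSucc -
        if k < cutIndex u θ then c (Fin.last _) - c 0 else 0) + (c (Fin.last _) - c 0) * θ := by
  rw [← sum_cutFun]
  exact Finset.sum_congr rfl fun l _ => mul_comm _ _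

lemma partialSum_cut {n : ℕ} (u : stdSimplex ℝ (Fin (n + 1))) {θ : ℝ} (h0 : 0 ≤ θ) (h1 : θ < 1)
    {l : ℕ} (hl0 : 0 < l) (hl : l ≤ n + 1) :
    partialSum (cut u h0 h1) l = ∑ k, u k * ((if (k - cutIndex u θ).val < l then 1 else 0) +
      if k < cutIndex u θ then 1 else 0) - θ := by
  have := sum_cut u h0 h1 (fun i => if i.val < l then 1 else 0)
  have e : ¬ (n + 1 < l) := by omega
  simp [hl0, e] at this
  rw [partialSum, this, sub_eq_add_neg]
  refine congrArg (· + -θ) (Finset.sum_congr rfl fun k _ => ?_)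
  congr 1
  split_ifs <;> norm_num

lemma sum_indicator {n : ℕ} (u : stdSimplex ℝ (Fin (n + 1))) (k : ℕ) (e : ℝ) :
    ∑ q, u q * ((if q.val < k then (1 : ℝ) else 0) + e) = partialSum u k + e := by
  simp only [mul_add, Finset.sum_add_distrib, ← Finset.sum_mul, stdSimplex.sum_eq_one]
  simp [partialSum]

/-- The index of the interval containing `θ + φ` modulo one. -/
lemma cutIndex_add {n : ℕ} (u : stdSimplex ℝ (Fin (n + 1))) {θ φ ψ : ℝ} (h0 : 0 ≤ θ) (h1 : θ < 1)
    (g0 : 0 ≤ φ) (g1 : φ < 1) (k0 : 0 ≤ ψ) (k1 : ψ < 1)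
    (hψ : ψ = θ + φ ∨ ψ = θ + φ - 1) :
    ((cutIndex u θ).val + (cutIndex (cut u h0 h1) φ).val < n + 1 →
      ψ = θ + φ ∧ (cutIndex u ψ).val = (cutIndex u θ).val + (cutIndex (cut u h0 h1) φ).val) ∧
    (n + 1 ≤ (cutIndex u θ).val + (cutIndex (cut u h0 h1) φ).val →
      ψ = θ + φ - 1 ∧
      (cutIndex u ψ).val + (n + 1) = (cutIndex u θ).val + (cutIndex (cut u h0 h1) φ).val) := by
  obtain ⟨a1, a2⟩ := cutsAt_cutIndex u h0 h1
  obtain ⟨b1, b2⟩ := cutsAt_cutIndex (cut u h0 h1) g0 g1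
  have lo := @partialSum_cut n u θ h0 h1
  set j := cutIndex u θ with hj
  set i := cutIndex (cut u h0 h1) φ with hi
  have hj2 := j.2
  have hi2 := i.2
  -- partial sums of the cut simplex
  have lo1 : ∀ l, 0 < l → j.val + l ≤ n + 1 →
      partialSum (cut u h0 h1) l = partialSum u (j + l) - θ := by
    intro l hl hl'
    rw [@lo l hl (by omega), ← add_zero (partialSum u _), ← sum_indicator]
    congr 1
    refine Finset.sum_congr rfl fun q _ => ?_
    congr 1
    have := q.2
    simp only [fin_sub_val, Fin.lt_def]
    split_ifs <;> first | omega | norm_num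
  have lo2 : ∀ l, l ≤ n + 1 → n + 1 ≤ j.val + l →
      partialSum (cut u h0 h1) l = partialSum u (j + l - (n + 1)) + 1 - θ := by
    intro l hl hl'
    rw [@lo l (by omega) (by omega), ← sum_indicator]
    congr 1
    refine Finset.sum_congr rfl fun q _ => ?_
    congr 1
    have := q.2
    simp only [fin_sub_val, Fin.lt_def]
    split_ifs <;> first | omega | norm_num
  have pos : ∀ k, 0 ≤ partialSum u k := fun k => by
    rw [← partialSum_zero u]; exact partialSum_mono u (Nat.zero_le _)
  constructor
  · intro hlt
    rw [lo1 (i + 1) (by omega) (by omega)] at b2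
    have : partialSum u (j + (i + 1)) ≤ 1 := by
      rw [← partialSum_last u]; exact partialSum_mono u (by omega)
    have e : ψ = θ + φ := by
      rcases hψ with h | h
      · exact h
      · linarith
    refine ⟨e, ?_⟩
    have : CutsAt u ψ ⟨j + i, hlt⟩ := by
      refine ⟨?_, by simp only [add_assoc]; linarith⟩
      simp only
      by_cases hz : i.val = 0
      · rw [hz, add_zero]; linarith
      · rw [lo1 i (by omega) (by omega)] at b1
        linarith
    rw [(cutsAt_cutIndex u k0 k1).unique this]
  · intro hge
    rw [lo2 i (by omega) hge] at b1
    have := pos (j + i - (n + 1))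
    have e : ψ = θ + φ - 1 := by
      rcases hψ with h | h
      · linarith
      · exact h
    refine ⟨e, ?_⟩
    have : CutsAt u ψ ⟨j + i - (n + 1), by omega⟩ := by
      refine ⟨by simp only; linarith, ?_⟩
      simp only
      by_cases hz : i.val = n + 1
      · rw [show j.val + i.val - (n + 1) + 1 = j + 1 by omega]; linarith
      · rw [lo2 (i + 1) (by omega) (by omega)] at b2
        rw [show j.val + i.val - (n + 1) + 1 = j + (i + 1) - (n + 1) by omega]
        linarith
    rw [(cutsAt_cutIndex u k0 k1).unique this]
    simp only
    omega

lemma map_cut_cut {n : ℕ} (u : stdSimplex ℝ (Fin (n + 1))) {θ φ ψ : ℝ} (h0 : 0 ≤ θ) (h1 : θ < 1)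
    (g0 : 0 ≤ φ) (g1 : φ < 1) (k0 : 0 ≤ ψ) (k1 : ψ < 1)
    (hψ : ψ = θ + φ ∨ ψ = θ + φ - 1) (k : Fin (n + 2))
    (hk : k.val = n + 1 - (cutIndex (cut u h0 h1) φ).val) (s : Fin (n + 3) → Fin (n + 2))
    (hs : ∀ l, (s l).val = if l.val ≤ k.val then l.val else l.val - 1) :
    stdSimplex.map s (cut (cut u h0 h1) g0 g1) =
      cut u k0 k1 := by
  have hadd := cutIndex_add u h0 h1 g0 g1 k0 k1 hψ
  refine simplex_ext fun c => ?_
  rw [sum_map, sum_cut, sum_cut, sum_cut]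
  set j := cutIndex u θ with hj
  set i := cutIndex (cut u h0 h1) φ with hi
  set m := cutIndex u ψ with hm
  have hj2 := j.2
  have hi2 := i.2
  have hm2 := m.2
  have s0 : s 0 = 0 := by
    ext; rw [hs]; simp
  have sl : s (Fin.last _) = Fin.last _ := by
    ext; rw [hs]; simp
  rw [s0, sl]
  have hd : (c (s (Fin.last (n + 1) - i).castSucc) -
      if Fin.last (n + 1) < i then c (Fin.last _) - c 0 else 0) -
      (c (s (0 - i).castSucc) -
      if 0 < i then c (Fin.last _) - c 0 else 0) = c (Fin.last _) - c 0 := by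
    rw [if_neg (by simp only [Fin.lt_def, Fin.val_last]; omega)]
    by_cases hz : i.val = 0
    · rw [if_neg (by simp only [Fin.lt_def, Fin.val_zero]; omega)]
      have e1 : s (Fin.last (n + 1) - i).castSucc = Fin.last _ := by
        ext; rw [hs, Fin.val_castSucc, fin_sub_val]; simp [hz, hk]
      have e2 : s (0 - i).castSucc = 0 := by
        ext; rw [hs, Fin.val_castSucc, fin_sub_val]; simp [hz, hk]
      rw [e1, e2]; ring
    · rw [if_pos (by simp only [Fin.lt_def, Fin.val_zero]; omega)]
      have e1 : s (Fin.last (n + 1) - i).castSucc =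
          s (0 - i).castSucc := by
        ext; rw [hs, hs, Fin.val_castSucc, Fin.val_castSucc, fin_sub_val, fin_sub_val]
        have z0 : (0 : Fin (n + 1 + 1)).val = 0 := rfl
        have z1 : (Fin.last (n + 1)).val = n + 1 := rfl
        split_ifs <;> omega
      rw [e1]; ring
  rw [hd]
  obtain ⟨ε, hε, hε'⟩ : ∃ ε : ℝ, ψ = θ + φ - ε ∧
      ((ε = 0 ∧ m.val = j + i) ∨ (ε = 1 ∧ m.val + (n + 1) = j + i)) := by
    by_cases h : j.val + i.val < n + 1
    · exact ⟨0, by rw [(hadd.1 h).1, sub_zero], .inl ⟨rfl, (hadd.1 h).2⟩⟩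
    · exact ⟨1, by rw [(hadd.2 (not_lt.mp h)).1], .inr ⟨rfl, (hadd.2 (not_lt.mp h)).2⟩⟩
  have key : ∀ q : Fin (n + 1),
      (c (s ((q - j).castSucc - i).castSucc) -
      if (q - j).castSucc < i then c (Fin.last _) - c 0 else 0) -
      (if q < j then c (Fin.last _) - c 0 else 0) =
      c (q - m).castSucc - (if q < m then c (Fin.last _) - c 0 else 0) -
        ε * (c (Fin.last _) - c 0) := by
    intro q
    have hq := q.2
    have e1 : s ((q - j).castSucc - i).castSucc = (q - m).castSucc := by
      ext
      rw [hs]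
      simp only [Fin.val_castSucc, fin_sub_val, hk]
      split_ifs <;> omega
    rw [e1]
    simp only [Fin.lt_def, fin_sub_val, Fin.val_castSucc]
    rcases hε' with ⟨rfl, h⟩ | ⟨rfl, h⟩ <;> split_ifs <;> first | omega | ring
  simp only [key]
  rw [hε]
  have e : ∑ q, u q * (c (q - m).castSucc - (if q < m then c (Fin.last _) - c 0 else 0) -
        ε * (c (Fin.last _) - c 0)) =
      ∑ q, u q * (c (q - m).castSucc - (if q < m then c (Fin.last _) - c 0 else 0)) -
        ε * (c (Fin.last _) - c 0) := by
    simp only [mul_sub _ _ (ε * _), Finset.sum_sub_distrib, ← Finset.sum_mul,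
      stdSimplex.sum_eq_one, one_mul]
  rw [e]
  ring

namespace CyclicSet
variable {X : CyclicSet}

lemma extra_eq {n : ℕ} (x : X.sset _⦋n⦌) (j : Fin (n + 1)) :
    (X.t (n + 1))^[n + 1 - j] (X.sset.σ j x) =
      X.t (n + 1) (X.sset.σ (Fin.last n) ((X.t n)^[n - j] x)) := by
  have hj := j.2
  rw [show n + 1 - j.val = n - j + 1 by omega, Function.iterate_succ_apply']
  have := X.t_σ (n - j) j (by omega) x
  refine congrArg _ (this.trans ?_)
  rw [show (⟨j.val + (n - j.val), by omega⟩ : Fin (n + 1)) = Fin.last n by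
    ext; simp only [Fin.val_last]; omega]

lemma σ_extra {n : ℕ} (k : Fin (n + 1)) (x : X.sset _⦋n⦌) :
    X.sset.σ k.succ (X.t (n + 1) (X.sset.σ (Fin.last n) x)) =
      X.t (n + 2) (X.sset.σ (Fin.last (n + 1)) (X.sset.σ k x)) := by
  rw [X.σ_succ_t (n + 1) k]
  exact congrArg _ (X.sset.σ_comp_σ_apply (Fin.le_last k) x)

lemma rot_rot_aux {n : ℕ} (x : X.sset _⦋n⦌) (j m : Fin (n + 1)) (i k : Fin (n + 2))
    (hk : k.val = n + 1 - i.val) (h : m.val = j + i ∨ m.val + (n + 1) = j + i) :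
    (X.t (n + 2))^[n + 2 - i] (X.sset.σ i ((X.t (n + 1))^[n + 1 - j] (X.sset.σ j x))) =
      X.sset.σ k ((X.t (n + 1))^[n + 1 - m] (X.sset.σ m x)) := by
  have hi := i.2
  have hj := j.2
  have hm := m.2
  rw [extra_eq, extra_eq, extra_eq]
  by_cases hi' : i.val = n + 1
  · obtain rfl : m = j := by ext; omega
    obtain rfl : k = 0 := by ext; rw [hk, hi']; simp
    rw [show n + 1 - i.val = 0 by omega, X.σ_zero_t, Function.iterate_zero, id,
      ← Fin.succ_last, X.σ_succ_t (n + 1) (Fin.last n)]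
    exact congrArg _ (congrArg _ (X.sset.σ_comp_σ_apply le_rfl _))
  · obtain ⟨k, rfl⟩ : ∃ k' : Fin (n + 1), k = k'.succ :=
      ⟨⟨n - i, by omega⟩, by ext; simp; omega⟩
    rw [σ_extra, ← Function.iterate_succ_apply]
    congr 2
    have e := X.t_σ_last (n - i) (by omega) ((X.t n)^[n - j] x)
    rw [show n - i.val + 2 = n + 1 - i + 1 by omega] at e
    refine e.trans ?_
    have e2 : (⟨n - i.val, by omega⟩ : Fin (n + 1)) = k := by
      ext; simp at hk ⊢; omega
    rw [e2, ← Function.iterate_add_apply]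
    rcases h with h | h
    · rw [show n - i.val + 1 + (n - j) = (n - m) + (n + 1) by omega, Function.iterate_add_apply,
        X.t_iterate]
    · rw [show n - i.val + 1 + (n - j) = n - m by omega]

lemma rot_rot {θ φ ψ : ℝ} (h0 : 0 ≤ θ) (h1 : θ < 1)
    (g0 : 0 ≤ φ) (g1 : φ < 1) (k0 : 0 ≤ ψ) (k1 : ψ < 1)
    (hψ : ψ = θ + φ ∨ ψ = θ + φ - 1) (p : X.Realization) :
    rot g0 g1 (rot h0 h1 p) = rot k0 k1 p := by
  induction p using Quot.ind with | _ p =>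
  obtain ⟨⟨n, x⟩, u⟩ := p
  change rotPt _ _ g0 g1 = rotPt x u k0 k1
  have hadd := cutIndex_add u h0 h1 g0 g1 k0 k1 hψ
  set k : Fin (n + 2) := ⟨n + 1 - (cutIndex (cut u h0 h1) φ).val, by omega⟩ with hk
  rw [rotPt, rotPt, rot_rot_aux x _ (cutIndex u ψ) _ k rfl
    (by by_cases h : (cutIndex u θ).val + (cutIndex (cut u h0 h1) φ).val < n + 1
        · exact .inl (hadd.1 h).2
        · exact .inr (hadd.2 (not_lt.mp h)).2)]
  refine (pt_map (SimplexCategory.σ k) _ _).trans ?_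
  rw [map_cut_cut u h0 h1 g0 g1 k0 k1 hψ k rfl _ (fun l => σ_val k l)]

lemma exists_pos_rep (p : X.Realization) :
    ∃ (n : ℕ) (x : X.sset _⦋n⦌) (u : stdSimplex ℝ (Fin (n + 1))), 0 < u 0 ∧ p = pt x u := by
  induction p using Quot.ind with | _ p =>
  obtain ⟨⟨n, x⟩, u⟩ := p
  change ∃ (m : ℕ) (y : X.sset _⦋m⦌) (v : stdSimplex ℝ (Fin (m + 1))), 0 < v 0 ∧ pt x u = pt y v
  induction n with
  | zero =>
    exact ⟨0, x, u, by
      have := stdSimplex.sum_eq_one u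
      simp at this
      simp, rfl⟩
  | succ n ih =>
    by_cases h : 0 < u 0
    · exact ⟨_, x, u, h, rfl⟩
    · have h0 : u 0 = 0 := le_antisymm (not_lt.mp h) (stdSimplex.zero_le u 0)
      let v : stdSimplex ℝ (Fin (n + 1)) := ⟨fun l => u l.succ, fun l => stdSimplex.zero_le u _, by
        have := stdSimplex.sum_eq_one u
        rwa [Fin.sum_univ_succ, h0, zero_add] at this⟩
      obtain ⟨m, y, w, hw, e⟩ := ih (X.sset.δ 0 x) v
      refine ⟨m, y, w, hw, ?_⟩
      rw [← e]
      refine Eq.trans ?_ (pt_map (SimplexCategory.δ 0) x v).symm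
      congr 1
      refine simplex_ext fun c => ?_
      refine Eq.trans ?_ (sum_map (n := n + 2) _ v c).symm
      rw [Fin.sum_univ_succ, h0, zero_mul, zero_add]
      rfl

lemma rot_zero (h0 : (0 : ℝ) ≤ 0) (h1 : (0 : ℝ) < 1) (p : X.Realization) : rot h0 h1 p = p := by
  obtain ⟨n, x, u, hu, rfl⟩ := exists_pos_rep p
  change rotPt x u h0 h1 = _
  have hz : cutIndex u 0 = 0 := by
    refine (cutsAt_cutIndex u h0 h1).unique ⟨?_, ?_⟩
    · simp [partialSum_zero]
    · have := partialSum_succ u 0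
      rw [Fin.val_zero, partialSum_zero, zero_add, zero_add] at this
      rw [Fin.val_zero, zero_add, this]; exact hu
  have hc : cut u h0 h1 = stdSimplex.map (SimplexCategory.δ (Fin.last (n + 1))).toOrderHom u := by
    refine simplex_ext fun c => ?_
    rw [sum_cut, hz]
    refine Eq.trans ?_ (sum_map (n := n + 2) _ u c).symm
    simp
    refine Finset.sum_congr rfl fun k _ => ?_
    congr 2
    ext
    have := δ_val (Fin.last (n + 1)) k
    rw [if_pos (by simpa using k.is_le)] at this
    exact this.symm
  rw [rotPt, hc, hz]
  refine (pt_map (SimplexCategory.δ (Fin.last (n + 1))) _ u).symm.trans ?_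
  congr 1
  have := X.t_δ (n + 1) 0 (by omega) (X.sset.σ 0 x)
  have e2 : (⟨0 + (n + 1), by omega⟩ : Fin (n + 2)) = Fin.last (n + 1) := by ext; simp
  rw [e2] at this
  refine this.symm.trans ?_
  rw [X.t_iterate]
  exact X.sset.δ_comp_σ_self_apply 0 x

lemma turn_one : turn 1 = 0 := by simp [turn]

lemma turn_mul (z w : Circle) :
    turn (z * w) = turn w + turn z ∨ turn (z * w) = turn w + turn z - 1 := by
  have h : ∃ k : ℤ, turn (z * w) - (turn w + turn z) = k := by
    have : ((Complex.arg ((z * w : Circle) : ℂ) : ℝ) : Real.Angle) =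
        ((Complex.arg (z : ℂ) + Complex.arg (w : ℂ) : ℝ) : Real.Angle) := by
      rw [Circle.coe_mul, Complex.arg_mul_coe_angle (Circle.coe_ne_zero _) (Circle.coe_ne_zero _)]
      rfl
    obtain ⟨k, hk⟩ := Real.Angle.angle_eq_iff_two_pi_dvd_sub.mp this
    refine ⟨k - ⌊Complex.arg ((z * w : Circle) : ℂ) / (2 * Real.pi)⌋ + ⌊Complex.arg (w : ℂ) / (2 * Real.pi)⌋ +
      ⌊Complex.arg (z : ℂ) / (2 * Real.pi)⌋, ?_⟩
    simp only [turn, Int.fract, Int.cast_add, Int.cast_sub]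
    have : Complex.arg ((z * w : Circle) : ℂ) / (2 * Real.pi) =
      Complex.arg (z : ℂ) / (2 * Real.pi) + Complex.arg (w : ℂ) / (2 * Real.pi) + k := by
      field_simp; linarith
    linarith
  obtain ⟨k, hk⟩ := h
  have a0 : 0 ≤ turn z := Int.fract_nonneg _
  have a1 : turn z < 1 := Int.fract_lt_one _
  have b0 : 0 ≤ turn w := Int.fract_nonneg _
  have b1 : turn w < 1 := Int.fract_lt_one _
  have c0 : 0 ≤ turn (z * w) := Int.fract_nonneg _
  have c1 : turn (z * w) < 1 := Int.fract_lt_one _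
  have k1 : (-2 : ℝ) < k := by linarith
  have k2 : (k : ℝ) < 1 := by linarith
  norm_cast at k1 k2
  have : k = 0 ∨ k = -1 := by omega
  rcases this with rfl | rfl
  · left; push_cast at hk; linarith
  · right; push_cast at hk; linarith

noncomputable instance : MulAction Circle X.Realization where
  one_smul p := by
    change rot _ _ p = p
    have : ∀ (θ : ℝ) (h0 : 0 ≤ θ) (h1 : θ < 1), θ = 0 → rot h0 h1 p = p := by
      rintro _ h0 h1 rfl
      exact rot_zero h0 h1 p
    exact this _ _ _ turn_one
  mul_smul z w p := (rot_rot _ _ _ _ _ _ (turn_mul z w) p).symm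

end CyclicSet

namespace CyclicSet
variable (X : CyclicSet)

/-- The characteristic map of a simplex into Mathlib's geometric realization. -/
noncomputable def charMap {n : ℕ} (x : X.sset _⦋n⦌) :
    C(stdSimplex ℝ (Fin (n + 1)), SSet.toTop.obj X.sset) :=
  TopCat.toSSetObjEquiv _ (Opposite.op ⦋n⦌)
    ((sSetTopAdj.unit.app X.sset).app (Opposite.op ⦋n⦌) x)

lemma charMap_map {m n : ℕ} (f : ⦋m⦌ ⟶ ⦋n⦌) (x : X.sset _⦋n⦌) (u : stdSimplex ℝ (Fin (m + 1))) :
    X.charMap (X.sset.map f.op x) u = X.charMap x (stdSimplex.map f.toOrderHom u) := by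
  have h := NatTrans.naturality_apply (sSetTopAdj.unit.app X.sset) f.op x
  exact congrArg (fun y => TopCat.toSSetObjEquiv _ (Opposite.op ⦋m⦌) y u) h

/-- The comparison map to Mathlib's geometric realization. -/
noncomputable def toMathlib : C(X.Realization, SSet.toTop.obj X.sset) where
  toFun := Quot.lift (fun p => X.charMap p.1.2 p.2) (by
    rintro _ _ ⟨m, n, f, x, u, rfl, rfl⟩
    exact X.charMap_map f x u)
  continuous_toFun := continuous_quot_lift _
    (continuous_sigma fun p => (X.charMap p.2).continuous)

lemma continuous_pt {n : ℕ} (x : X.sset _⦋n⦌) : Continuous (pt (X := X) x) :=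
  continuous_quot_mk.comp (continuous_sigmaMk (σ := fun p : (Σ n : ℕ, X.sset _⦋n⦌) =>
    stdSimplex ℝ (Fin (p.1 + 1))) (i := ⟨n, x⟩))

/-- The simplicial map adjoint to `ofMathlib`. -/
noncomputable def toSing : X.sset ⟶ TopCat.toSSet.obj (TopCat.of X.Realization) where
  app n := TypeCat.ofHom fun x => (TopCat.toSSetObjEquiv _ n).symm
    ⟨fun u => pt (n := n.unop.len) x u, X.continuous_pt (n := n.unop.len) x⟩
  naturality {n m} f := by
    ext x
    apply (TopCat.toSSetObjEquiv _ _).injective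
    ext u
    exact pt_map (X := X) f.unop x u

/-- The comparison map from Mathlib's geometric realization. -/
noncomputable def ofMathlib : SSet.toTop.obj X.sset ⟶ TopCat.of X.Realization :=
  (sSetTopAdj.homEquiv X.sset (TopCat.of X.Realization)).symm X.toSing

lemma ofMathlib_charMap {n : ℕ} (x : X.sset _⦋n⦌) (u : stdSimplex ℝ (Fin (n + 1))) :
    X.ofMathlib (X.charMap x u) = pt x u := by
  have h : sSetTopAdj.unit.app X.sset ≫ TopCat.toSSet.map X.ofMathlib = X.toSing :=
    (Adjunction.homEquiv_unit sSetTopAdj _ _ _).symm.trans (Equiv.apply_symm_apply _ _)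
  exact congrArg (fun φ : X.sset ⟶ TopCat.toSSet.obj (TopCat.of X.Realization) =>
    TopCat.toSSetObjEquiv _ (Opposite.op ⦋n⦌) (φ.app (Opposite.op ⦋n⦌) x) u) h

lemma toMathlib_ofMathlib : X.ofMathlib ≫ TopCat.ofHom X.toMathlib = 𝟙 _ := by
  apply (sSetTopAdj.homEquiv _ _).injective
  rw [Adjunction.homEquiv_naturality_right, ofMathlib, Equiv.apply_symm_apply,
    Adjunction.homEquiv_unit, CategoryTheory.Functor.map_id]
  refine Eq.trans ?_ (Category.comp_id _).symm
  ext n x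
  apply (TopCat.toSSetObjEquiv _ _).injective
  ext u
  rfl

/-- The space `X.Realization` is Mathlib's geometric realization of the underlying simplicial
set: the homeomorphism sends the point with coordinates `u` in `x` to its image under the
characteristic map of `x`. -/
noncomputable def realizationHomeomorph : X.Realization ≃ₜ SSet.toTop.obj X.sset where
  toFun := X.toMathlib
  invFun := X.ofMathlib
  left_inv p := by
    induction p using Quot.ind with | _ p =>
    exact X.ofMathlib_charMap p.1.2 p.2
  right_inv p := congrArg (fun φ => φ p) X.toMathlib_ofMathlib
  continuous_toFun := X.toMathlib.continuous
  continuous_invFun := X.ofMathlib.hom.continuous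

end CyclicSet

section CyclicBar

variable (M : Type) [CommMonoidWithZero M]

/-- Two tuples agree in the smash power iff they are equal or both have a zero entry. -/
def smashSetoid (k : ℕ) : Setoid (Fin k → M) where
  r a b := a = b ∨ ((∃ i, a i = 0) ∧ ∃ i, b i = 0)
  iseqv := by
    refine ⟨fun _ => .inl rfl, ?_, ?_⟩
    · rintro a b (rfl | ⟨h, h'⟩)
      · exact .inl rfl
      · exact .inr ⟨h', h⟩
    · rintro a b c (rfl | ⟨h, h'⟩) (rfl | ⟨g, g'⟩)
      · exact .inl rfl
      · exact .inr ⟨g, g'⟩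
      · exact .inr ⟨h, h'⟩
      · exact .inr ⟨h, g'⟩

/-- The `k`-fold smash power `M ∧ … ∧ M` of the pointed set `M` (with base point `0`). -/
def SmashPower (k : ℕ) : Type := Quotient (smashSetoid M k)

variable {M}

/-- The element `π₀ ∧ … ∧ πₖ₋₁` of the smash power. -/
def smash {k : ℕ} (π : Fin k → M) : SmashPower M k := Quotient.mk (smashSetoid M k) π

lemma smash_eq_of_zero {k : ℕ} {π ρ : Fin k → M} (h : ∃ i, π i = 0) (h' : ∃ i, ρ i = 0) :
    smash π = smash ρ := Quotient.sound (.inr ⟨h, h'⟩)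

/-- The tuple whose `i`-th entry is the product of the `π j` with `φ j = i`. -/
def pushTuple {k l : ℕ} (φ : Fin k → Fin l) (π : Fin k → M) (i : Fin l) : M :=
  ∏ j with φ j = i, π j

lemma pushTuple_zero {k l : ℕ} (φ : Fin k → Fin l) {π : Fin k → M} (h : ∃ i, π i = 0) :
    ∃ i, pushTuple φ π i = 0 := by
  obtain ⟨i, hi⟩ := h
  exact ⟨φ i, Finset.prod_eq_zero (i := i) (by simp) hi⟩

lemma pushTuple_comp {k l m : ℕ} (φ : Fin k → Fin l) (ψ : Fin l → Fin m) (π : Fin k → M) :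
    pushTuple ψ (pushTuple φ π) = pushTuple (ψ ∘ φ) π := by
  funext i
  simp only [pushTuple]
  rw [← Finset.prod_fiberwise_of_maps_to (s := Finset.univ.filter fun j => (ψ ∘ φ) j = i)
    (t := Finset.univ.filter fun j => ψ j = i) (g := φ) (by simp)]
  refine Finset.prod_congr rfl fun j hj => Finset.prod_congr ?_ fun _ _ => rfl
  ext a
  simp only [Finset.mem_filter, Finset.mem_univ, true_and, Function.comp] at hj ⊢
  constructor
  · rintro rfl; exact ⟨hj, rfl⟩
  · exact fun h => h.2

lemma pushTuple_id {k : ℕ} (π : Fin k → M) : pushTuple id π = π := by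
  funext i
  simp [pushTuple, Finset.filter_eq']

/-- The map of smash powers induced by `pushTuple`. -/
def push {k l : ℕ} (φ : Fin k → Fin l) : SmashPower M k → SmashPower M l :=
  Quotient.lift (fun π => smash (pushTuple φ π)) (by
    rintro π ρ (rfl | ⟨h, h'⟩)
    · rfl
    · exact smash_eq_of_zero (pushTuple_zero φ h) (pushTuple_zero φ h'))

lemma push_smash {k l : ℕ} (φ : Fin k → Fin l) (π : Fin k → M) :
    push φ (smash π) = smash (pushTuple φ π) := rfl

lemma push_push {k l m : ℕ} (φ : Fin k → Fin l) (ψ : Fin l → Fin m) (a : SmashPower M k) :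
    push ψ (push φ a) = push (ψ ∘ φ) a := by
  induction a using Quotient.ind with | _ π =>
  change smash _ = smash _
  rw [pushTuple_comp]

lemma push_id {k : ℕ} (a : SmashPower M k) : push id a = a := by
  induction a using Quotient.ind with | _ π =>
  change smash _ = smash _
  rw [pushTuple_id]

/-- The number of `l` with `f l < k`. -/
def belowCount {m n : ℕ} (f : Fin (m + 1) → Fin (n + 1)) (k : ℕ) : ℕ :=
  (Finset.univ.filter fun l => (f l).val < k).card

lemma belowCount_le {m n : ℕ} (f : Fin (m + 1) → Fin (n + 1)) (k : ℕ) :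
    belowCount f k ≤ m + 1 :=
  (Finset.card_filter_le (Finset.univ : Finset (Fin (m + 1))) fun l => (f l).val < k).trans_eq
    (by simp)

lemma lt_belowCount_iff {m n : ℕ} {f : Fin (m + 1) → Fin (n + 1)} (hf : Monotone f) (k : ℕ)
    (l : Fin (m + 1)) : l.val < belowCount f k ↔ (f l).val < k := by
  constructor
  · intro h
    by_contra h'
    have : (Finset.univ.filter fun l => (f l).val < k) ⊆ Finset.Iio l := by
      intro a ha
      simp only [Finset.mem_filter, Finset.mem_univ, true_and, Finset.mem_Iio] at ha ⊢
      by_contra hal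
      have := hf (not_lt.mp hal)
      rw [Fin.le_def] at this
      omega
    have := Finset.card_le_card this
    rw [Fin.card_Iio] at this
    exact absurd h (not_lt.mpr this)
  · intro h
    have : Finset.Iic l ⊆ (Finset.univ.filter fun l => (f l).val < k) := by
      intro a ha
      simp only [Finset.mem_filter, Finset.mem_univ, true_and, Finset.mem_Iic] at ha ⊢
      have := hf ha
      rw [Fin.le_def] at this
      omega
    have := Finset.card_le_card this
    rw [Fin.card_Iic] at this
    exact this

lemma belowCount_unique {m n : ℕ} {f : Fin (m + 1) → Fin (n + 1)} (hf : Monotone f) {k c : ℕ}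
    (hc : c ≤ m + 1) (h : ∀ l : Fin (m + 1), l.val < c ↔ (f l).val < k) : belowCount f k = c := by
  have hle := belowCount_le f k
  have h' := lt_belowCount_iff hf k
  rcases lt_trichotomy (belowCount f k) c with hlt | he | hlt
  · have := (h' ⟨belowCount f k, by omega⟩).mpr ((h _).mp hlt)
    exact absurd this (lt_irrefl _)
  · exact he
  · have := (h ⟨c, by omega⟩).mpr ((h' _).mp hlt)
    exact absurd this (lt_irrefl _)

/-- The map of labels dual to `f`: the label `k` goes to the least `l` with `k ≤ f l`, or to `0` if
there is none. -/
def dualMap {m n : ℕ} (f : Fin (m + 1) → Fin (n + 1)) (k : Fin (n + 1)) : Fin (m + 1) :=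
  ⟨belowCount f k % (m + 1), Nat.mod_lt _ (Nat.succ_pos m)⟩

lemma dualMap_id (n : ℕ) : dualMap (id : Fin (n + 1) → Fin (n + 1)) = id := by
  funext k
  ext
  have := k.2
  simp only [dualMap, id]
  rw [belowCount_unique (c := k) monotone_id (by omega) (fun l => Iff.rfl), Nat.mod_eq_of_lt k.2]

lemma dualMap_comp {m n p : ℕ} {f : Fin (m + 1) → Fin (n + 1)} {g : Fin (n + 1) → Fin (p + 1)}
    (hf : Monotone f) (hg : Monotone g) : dualMap (g ∘ f) = dualMap f ∘ dualMap g := by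
  funext k
  ext
  simp only [dualMap, Function.comp_apply]
  have e : belowCount (g ∘ f) k = belowCount f (belowCount g k) :=
    belowCount_unique (hg.comp hf) (belowCount_le _ _) fun l => by
      rw [lt_belowCount_iff hf, lt_belowCount_iff hg]; rfl
  rw [e]
  rcases (belowCount_le g k).lt_or_eq with h | h
  · rw [Nat.mod_eq_of_lt h]
  · rw [h, Nat.mod_self]
    have e1 : belowCount f (n + 1) = m + 1 :=
      belowCount_unique hf le_rfl fun l => ⟨fun _ => (f l).2, fun _ => l.2⟩
    have e2 : belowCount f 0 = 0 :=
      belowCount_unique hf (Nat.zero_le _) fun l => by omega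
    rw [e1, e2, Nat.mod_self, Nat.zero_mod]

variable (M) in
/-- The underlying simplicial set of the cyclic bar construction, with `n`-simplices the
`(n + 1)`-fold smash power; a morphism `f` of the simplex category acts by multiplying together
the entries along the map of labels dual to `f`. The resulting faces and degeneracies are computed
in `cyclicBar_δ_castSucc`, `cyclicBar_δ_last` and `cyclicBar_σ` below. -/
def cyclicBarSSet : SSet.{0} where
  obj n := SmashPower M (n.unop.len + 1)
  map f := TypeCat.ofHom (push (dualMap f.unop.toOrderHom))
  map_id n := by
    ext a
    exact (congrArg (fun φ => push φ a) (dualMap_id _)).trans (push_id a)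
  map_comp f g := by
    ext a
    exact (congrArg (fun φ => push φ a)
      (dualMap_comp g.unop.toOrderHom.monotone f.unop.toOrderHom.monotone)).trans
      (push_push _ _ a).symm

/-- The map of labels of a face map. -/
def dualδ {n : ℕ} (i : Fin (n + 2)) : Fin (n + 2) → Fin (n + 1) :=
  dualMap (m := n) (n := n + 1) (SimplexCategory.δ i).toOrderHom

/-- The map of labels of a degeneracy map. -/
def dualσ {n : ℕ} (i : Fin (n + 1)) : Fin (n + 1) → Fin (n + 2) :=
  dualMap (m := n + 1) (n := n) (SimplexCategory.σ i).toOrderHom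

lemma dualδ_val {n : ℕ} (i : Fin (n + 2)) (k : Fin (n + 2)) :
    (dualδ i k).val =
      if k.val ≤ i.val then (if k.val = n + 1 then 0 else k.val) else k.val - 1 := by
  have := k.2
  have := i.2
  change belowCount _ _ % (n + 1) = _
  rw [belowCount_unique (c := if k.val ≤ i.val then k.val else k.val - 1)
    (SimplexCategory.δ i).toOrderHom.monotone]
  · split_ifs with h h'
    · rw [h', Nat.mod_self]
    · exact Nat.mod_eq_of_lt (by omega)
    · exact Nat.mod_eq_of_lt (by omega)
  · change _ ≤ n + 1
    split_ifs <;> omega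
  · intro l
    have := δ_val i l
    rw [this]
    split_ifs <;> omega

lemma dualσ_val {n : ℕ} (i : Fin (n + 1)) (k : Fin (n + 1)) :
    (dualσ i k).val =
      if k.val ≤ i.val then k.val else k.val + 1 := by
  have := k.2
  have := i.2
  change belowCount _ _ % (n + 2) = _
  rw [belowCount_unique (c := if k.val ≤ i.val then k.val else k.val + 1)
    (SimplexCategory.σ i).toOrderHom.monotone]
  · split_ifs with h
    · exact Nat.mod_eq_of_lt (by omega)
    · exact Nat.mod_eq_of_lt (by omega)
  · change _ ≤ n + 2
    split_ifs <;> omega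
  · intro l
    have := σ_val i l
    rw [this]
    split_ifs <;> omega

lemma push_congr {k l : ℕ} {φ ψ : Fin k → Fin l} (h : ∀ j, (φ j).val = (ψ j).val)
    (a : SmashPower M k) : push φ a = push ψ a := by
  rw [show φ = ψ from funext fun j => Fin.ext (h j)]

lemma finRotate_val {n : ℕ} (k : Fin (n + 1)) :
    (finRotate (n + 1) k).val = if k.val = n then 0 else k.val + 1 := by
  have := k.2
  rw [finRotate_apply, Fin.val_add_one]
  simp [Fin.ext_iff]

lemma push_finRotate_iterate {n : ℕ} (a : SmashPower M (n + 1)) (r : ℕ) :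
    (push (finRotate (n + 1)))^[r] a =
      push (fun k => ⟨(k.val + r) % (n + 1), Nat.mod_lt _ (Nat.succ_pos n)⟩) a := by
  induction r with
  | zero =>
    refine Eq.trans (push_id a).symm (push_congr (fun k => ?_) a)
    simp [Nat.mod_eq_of_lt k.2]
  | succ r ih =>
    rw [Function.iterate_succ_apply', ih, push_push]
    refine push_congr (fun k => ?_) a
    simp only [Function.comp_apply, finRotate_val]
    have : (k.val + r) % (n + 1) < n + 1 := Nat.mod_lt (k.val + r) (Nat.succ_pos n)
    rw [← Nat.add_assoc, Nat.add_mod (k.val + r) 1]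
    rcases n with _ | n
    · simp [Nat.mod_one]
    · rw [Nat.mod_eq_of_lt (show 1 < n + 1 + 1 by omega)]
      split_ifs with e
      · rw [e, Nat.mod_self]
      · rw [Nat.mod_eq_of_lt (a := _ + 1) (by omega)]

lemma push_δ_zero_t {n : ℕ} (a : SmashPower M (n + 2)) :
    push (dualδ 0) (push (finRotate (n + 2)) a) = push (dualδ (Fin.last (n + 1))) a := by
  refine (push_push _ _ a).trans (push_congr (fun k => ?_) a)
  have := k.2
  rw [Function.comp_apply, dualδ_val, dualδ_val, finRotate_val, Fin.val_zero, Fin.val_last]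
  split_ifs <;> omega

lemma push_δ_succ_t {n : ℕ} (i : Fin (n + 1)) (a : SmashPower M (n + 2)) :
    push (dualδ i.succ) (push (finRotate (n + 2)) a) =
      push (finRotate (n + 1)) (push (dualδ i.castSucc) a) := by
  rw [push_push, push_push]
  refine push_congr (fun k => ?_) a
  have := k.2
  have := i.2
  rw [Function.comp_apply, Function.comp_apply, dualδ_val, finRotate_val, finRotate_val, dualδ_val,
    Fin.val_succ, Fin.val_castSucc]
  split_ifs <;> omega

lemma push_σ_zero_t {n : ℕ} (a : SmashPower M (n + 1)) :
    push (dualσ 0) (push (finRotate (n + 1)) a) =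
      push (finRotate (n + 2)) (push (finRotate (n + 2)) (push (dualσ (Fin.last n)) a)) := by
  rw [push_push, push_push, push_push]
  refine push_congr (fun k => ?_) a
  have := k.2
  simp only [Function.comp_apply]
  rw [dualσ_val, finRotate_val, finRotate_val, finRotate_val, dualσ_val, Fin.val_zero,
    Fin.val_last]
  split_ifs <;> omega

lemma push_σ_succ_t {n : ℕ} (i : Fin n) (a : SmashPower M (n + 1)) :
    push (dualσ i.succ) (push (finRotate (n + 1)) a) =
      push (finRotate (n + 2)) (push (dualσ i.castSucc) a) := by
  rw [push_push, push_push]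
  refine push_congr (fun k => ?_) a
  have := k.2
  have := i.2
  rw [Function.comp_apply, Function.comp_apply, dualσ_val, finRotate_val, finRotate_val, dualσ_val,
    Fin.val_succ, Fin.val_castSucc]
  split_ifs <;> omega

variable (M) in
/-- The cyclic bar construction of the commutative pointed monoid `M`. -/
def cyclicBar : CyclicSet where
  sset := cyclicBarSSet M
  t n := push (finRotate (n + 1))
  t_iterate n a := by
    refine (push_finRotate_iterate a (n + 1)).trans
      (Eq.trans (push_congr (fun k => ?_) a) (push_id a))
    simp [Nat.mod_eq_of_lt k.2]
  δ_zero_t _ a := push_δ_zero_t a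
  δ_succ_t _ i a := push_δ_succ_t i a
  σ_zero_t _ a := push_σ_zero_t a
  σ_succ_t _ i a := push_σ_succ_t i a

/-- `t (π₀ ∧ … ∧ πₙ) = πₙ ∧ π₀ ∧ … ∧ πₙ₋₁`. -/
lemma cyclicBar_t {n : ℕ} (π : Fin (n + 1) → M) :
    (cyclicBar M).t n (smash π) = smash (fun k => π ((finRotate (n + 1)).symm k)) := by
  refine (push_smash _ π).trans (congrArg smash (funext fun k => ?_))
  rw [pushTuple, Finset.prod_eq_single_of_mem ((finRotate (n + 1)).symm k) (by simp)]
  intro j hj hne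
  simp only [Finset.mem_filter, Finset.mem_univ, true_and] at hj
  exact absurd (by rw [← hj]; simp) hne

/-- `sᵢ (π₀ ∧ … ∧ πₙ) = π₀ ∧ … ∧ πᵢ ∧ 1 ∧ πᵢ₊₁ ∧ … ∧ πₙ`. -/
lemma cyclicBar_σ {n : ℕ} (i : Fin (n + 1)) (π : Fin (n + 1) → M) :
    (cyclicBar M).sset.σ i (smash π) = smash (i.succ.insertNth (α := fun _ => M) 1 π) := by
  refine (push_smash (dualσ i) π).trans (congrArg smash (funext fun k => ?_))
  have e : dualσ i = i.succ.succAbove := by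
    funext j
    ext
    rw [dualσ_val, Fin.succAbove]
    simp only [Fin.lt_def, Fin.val_castSucc, Fin.val_succ]
    split_ifs <;> simp <;> omega
  rw [e, pushTuple]
  rcases Fin.eq_self_or_eq_succAbove i.succ k with rfl | ⟨j, rfl⟩
  · rw [Fin.insertNth_apply_same]
    exact Finset.prod_eq_one fun j hj => absurd (by simp at hj) (Fin.succAbove_ne i.succ j)
  · rw [Fin.insertNth_apply_succAbove, Finset.prod_eq_single_of_mem j (by simp)]
    intro l hl hne
    simp only [Finset.mem_filter, Finset.mem_univ, true_and] at hl
    exact absurd (Fin.succAbove_right_injective hl) hne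

/-- `dᵢ (π₀ ∧ … ∧ πₙ₊₁) = π₀ ∧ … ∧ πᵢπᵢ₊₁ ∧ … ∧ πₙ₊₁` for `i ≤ n`. -/
lemma cyclicBar_δ_castSucc {n : ℕ} (i : Fin (n + 1)) (π : Fin (n + 2) → M) :
    (cyclicBar M).sset.δ i.castSucc (smash π) =
      smash (i.castSucc.contractNth (fun a b => a * b) π) := by
  refine (push_smash (dualδ i.castSucc) π).trans (congrArg smash (funext fun k => ?_))
  have := i.2
  have := k.2
  have hd : ∀ j, dualδ i.castSucc j = k ↔
      j = (if k.val ≤ i.val then k.castSucc else k.succ) ∨ (k = i ∧ j = k.succ) := by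
    intro j
    have := j.2
    rw [Fin.ext_iff, dualδ_val, Fin.ext_iff, Fin.ext_iff, Fin.ext_iff, Fin.val_castSucc,
      Fin.val_succ, apply_ite Fin.val, Fin.val_castSucc, Fin.val_succ]
    split_ifs <;> omega
  rw [pushTuple, Fin.contractNth, Fin.val_castSucc]
  have hf : (Finset.univ.filter fun j => dualδ i.castSucc j = k) =
      Finset.univ.filter fun j => j = (if k.val ≤ i.val then k.castSucc else k.succ) ∨
        (k = i ∧ j = k.succ) := by
    ext j; simp [hd]
  rw [hf]
  split_ifs with h1 h2 h3 h4
  · have : ∀ j, (j = k.castSucc ∨ (k = i ∧ j = k.succ)) ↔ j = k.castSucc := fun j => by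
      rw [Fin.ext_iff (a := k)]; exact ⟨fun h => h.elim id fun h => by omega, .inl⟩
    simp [this, Finset.filter_eq']
  · obtain rfl : k = i := Fin.ext h3
    have : (Finset.univ.filter fun j => j = k.castSucc ∨ (k = k ∧ j = k.succ)) =
      {k.castSucc, k.succ} := by ext j; simp
    rw [this, Finset.prod_pair (by simp [Fin.ext_iff])]
  · omega
  · omega
  · omega
  · have : ∀ j, (j = k.succ ∨ (k = i ∧ j = k.succ)) ↔ j = k.succ := fun j => by tauto
    simp [this, Finset.filter_eq']

/-- `dₙ₊₁ (π₀ ∧ … ∧ πₙ₊₁) = πₙ₊₁π₀ ∧ π₁ ∧ … ∧ πₙ`. -/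
lemma cyclicBar_δ_last {n : ℕ} (π : Fin (n + 2) → M) :
    (cyclicBar M).sset.δ (Fin.last (n + 1)) (smash π) =
      smash (Function.update (fun k : Fin (n + 1) => π k.castSucc) 0
        (π (Fin.last (n + 1)) * π 0)) := by
  refine (push_smash (dualδ (Fin.last (n + 1))) π).trans (congrArg smash (funext fun k => ?_))
  have := k.2
  have hd : ∀ j, dualδ (Fin.last (n + 1)) j = k ↔
      j = k.castSucc ∨ (k = 0 ∧ j = Fin.last (n + 1)) := by
    intro j
    have := j.2
    rw [Fin.ext_iff, dualδ_val, Fin.ext_iff, Fin.ext_iff, Fin.ext_iff, Fin.val_castSucc,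
      Fin.val_last, Fin.val_zero]
    split_ifs <;> omega
  have hf : (Finset.univ.filter fun j => dualδ (Fin.last (n + 1)) j = k) =
      Finset.univ.filter fun j => j = k.castSucc ∨ (k = 0 ∧ j = Fin.last (n + 1)) := by
    ext j; simp [hd]
  rw [pushTuple, hf]
  by_cases h : k = 0
  · subst h
    have : (Finset.univ.filter fun j => j = (0 : Fin (n + 1)).castSucc ∨
        ((0 : Fin (n + 1)) = 0 ∧ j = Fin.last (n + 1))) = {Fin.last (n + 1), 0} := by
      ext j; simp [or_comm]
    rw [this, Finset.prod_pair (by simp [Fin.ext_iff]), Function.update_self]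
  · simp [h, Finset.filter_eq']

end CyclicBar

section Words

/-- The word `ω(π₀) * … * ω(πₙ)`. -/
def tupleWord {k : ℕ} (π : Fin k → PiTwo) : List Letter :=
  (List.ofFn π).flatMap PiTwo.word

lemma tupleWord_eq {k : ℕ} (π : Fin k → PiTwo) :
    tupleWord π = (List.finRange k).flatMap fun i => (π i).word := by
  rw [tupleWord, List.ofFn_eq_map, List.flatMap_map]

lemma filter_lt_append_filter_eq {α : Type} (φ : α → ℕ) (L : List α)
    (hL : L.Pairwise fun a b => φ a ≤ φ b) (m : ℕ) :
    L.filter (fun a => φ a < m) ++ L.filter (fun a => φ a = m) =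
      L.filter (fun a => φ a < m + 1) := by
  induction L with
  | nil => rfl
  | cons a L ih =>
    rw [List.pairwise_cons] at hL
    have ih := ih hL.2
    rcases lt_trichotomy (φ a) m with h | h | h
    · rw [List.filter_cons_of_pos (by simpa using h), List.filter_cons_of_neg (by simp; omega),
        List.filter_cons_of_pos (by simp; omega), List.cons_append, ih]
    · have h0 : L.filter (fun a => φ a < m) = [] := by
        rw [List.filter_eq_nil_iff]
        intro b hb
        have := hL.1 b hb
        simp; omega
      rw [h0] at ih
      rw [List.filter_cons_of_neg (by simp; omega), List.filter_cons_of_pos (by simpa using h),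
        List.filter_cons_of_pos (by simp; omega), h0, ← ih]
      rfl
    · rw [List.filter_cons_of_neg (by simp; omega), List.filter_cons_of_neg (by simp; omega),
        List.filter_cons_of_neg (by simp; omega), ih]

lemma flatMap_filter {α : Type} (φ : α → ℕ) (L : List α)
    (hL : L.Pairwise fun a b => φ a ≤ φ b) (m : ℕ) :
    (List.range m).flatMap (fun i => L.filter (fun a => φ a = i)) =
      L.filter (fun a => φ a < m) := by
  induction m with
  | zero => simp
  | succ m ih =>
    rw [List.range_succ, List.flatMap_append, ih, ← filter_lt_append_filter_eq φ L hL]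
    simp

/-- Multiplying together along a label map that is monotone for some listing of the labels does
not change the word spelled in that order. -/
lemma tupleWord_pushTuple {k m : ℕ} (φ : Fin k → Fin m) (π : Fin k → PiTwo) (L : List (Fin k))
    (hnd : L.Nodup) (hmem : ∀ j, j ∈ L) (hL : L.Pairwise fun a b => φ a ≤ φ b)
    (h : ∀ i, pushTuple φ π i ≠ 0) :
    tupleWord (pushTuple φ π) = L.flatMap fun j => (π j).word := by
  have h1 : ∀ i, (pushTuple φ π i).word =
      (L.filter (fun j => (φ j).val = i.val)).flatMap fun j => (π j).word := by
    intro i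
    have e : pushTuple φ π i = ((L.filter (fun j => (φ j).val = i.val)).map π).prod := by
      rw [pushTuple, ← List.prod_toFinset _ (hnd.filter _)]
      refine Finset.prod_congr ?_ fun _ _ => rfl
      ext j
      simp [hmem, Fin.ext_iff]
    rw [e, PiTwo.word_list_prod _ (e ▸ h i), List.flatMap_map]
  rw [tupleWord_eq]
  simp only [h1]
  have h2 : (List.finRange m).flatMap (fun i => (L.filter (fun j => (φ j).val = i.val)).flatMap
      fun j => (π j).word) = ((List.range m).flatMap (fun i => L.filter (fun j => (φ j).val = i))).flatMap
      fun j => (π j).word := by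
    rw [← List.map_coe_finRange_eq_range, List.flatMap_map, List.flatMap_assoc]
  rw [h2, flatMap_filter (fun j => (φ j).val) L hL, List.filter_eq_self.mpr]
  intro a _
  simp

lemma tupleWord_dualMap {m n : ℕ} (f : Fin (m + 1) → Fin (n + 1))
    (π : Fin (n + 1) → PiTwo) (h : ∀ i, pushTuple (dualMap f) π i ≠ 0) :
    (tupleWord (pushTuple (dualMap f) π) : Cycle Letter) = tupleWord π := by
  have mono : ∀ {a b : ℕ}, a ≤ b → belowCount f a ≤ belowCount f b := fun {a b} hab =>
    Finset.card_le_card fun l => by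
      simp only [Finset.mem_filter, Finset.mem_univ, true_and]
      omega
  let L1 : List (Fin (n + 1)) := (List.finRange (n + 1)).filter fun k : Fin (n + 1) => belowCount f k < m + 1
  let L2 : List (Fin (n + 1)) := (List.finRange (n + 1)).filter fun k : Fin (n + 1) => belowCount f k = m + 1
  have hsort : (List.finRange (n + 1)).Pairwise fun a b : Fin (n + 1) => belowCount f a ≤ belowCount f b :=
    (List.pairwise_le_finRange (n + 1)).imp fun {a b} hab => mono hab
  have h12 : L1 ++ L2 = List.finRange (n + 1) := by
    refine (filter_lt_append_filter_eq (fun k : Fin (n + 1) => belowCount f k) _ hsort (m + 1)).trans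
      (List.filter_eq_self.mpr fun a _ => ?_)
    have := belowCount_le f a
    simp; omega
  have hv1 : ∀ k ∈ L1, (dualMap f k).val = belowCount f k := fun k hk =>
    Nat.mod_eq_of_lt (by simpa [L1] using hk)
  have hv2 : ∀ k ∈ L2, (dualMap f k).val = 0 := fun k hk => by
    have : belowCount f k = m + 1 := by simpa [L2] using hk
    simp [dualMap, this]
  have hrot : (L2 ++ L1).Perm (List.finRange (n + 1)) := h12 ▸ List.perm_append_comm
  rw [tupleWord_pushTuple (dualMap f) π (L2 ++ L1) (hrot.nodup_iff.mpr (List.nodup_finRange _))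
    (fun j => hrot.mem_iff.mpr (List.mem_finRange j)) ?_ h, tupleWord_eq, ← h12, List.flatMap_append,
    List.flatMap_append]
  · exact Cycle.coe_eq_coe.mpr List.isRotated_append
  · rw [List.pairwise_append]
    refine ⟨?_, ?_, ?_⟩
    · exact List.Pairwise.imp_of_mem (fun {a b} ha hb _ => by
        rw [Fin.le_def, hv2 a ha, hv2 b hb]) (hsort.filter _)
    · exact List.Pairwise.imp_of_mem (fun {a b} ha hb hab => by
        rw [Fin.le_def, hv1 a ha, hv1 b hb]; exact hab) (hsort.filter _)
    · intro a ha b _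
      rw [Fin.le_def, hv2 a ha]
      exact Nat.zero_le _

lemma tupleWord_rotate {n : ℕ} (π : Fin (n + 1) → PiTwo) :
    (tupleWord (fun k => π ((finRotate (n + 1)).symm k)) : Cycle Letter) = tupleWord π := by
  have e1 : List.ofFn π = List.ofFn (fun k : Fin n => π k.castSucc) ++ [π (Fin.last n)] := by
    rw [List.ofFn_succ', List.concat_eq_append]
  have e2 : List.ofFn (fun k => π ((finRotate (n + 1)).symm k)) =
      [π (Fin.last n)] ++ List.ofFn (fun k : Fin n => π k.castSucc) := by
    rw [List.ofFn_succ]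
    have h0 : (finRotate (n + 1)).symm 0 = Fin.last n := by
      rw [Equiv.symm_apply_eq]; simp
    have hs : ∀ k : Fin n, (finRotate (n + 1)).symm k.succ = k.castSucc := fun k => by
      rw [Equiv.symm_apply_eq]; simp
    simp only [h0, hs]
    rfl
  rw [tupleWord, tupleWord, e1, e2, List.flatMap_append, List.flatMap_append]
  exact Cycle.coe_eq_coe.mpr List.isRotated_append

/-- The base point and the simplices `π₀ ∧ … ∧ πₙ` whose word lies in `c`. -/
def wordSimplices (c : Cycle Letter) (n : ℕ) : Set (SmashPower PiTwo (n + 1)) :=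
  {a | a = smash (fun _ => 0) ∨ ∃ π : Fin (n + 1) → PiTwo,
    (∀ k, π k ≠ 0) ∧ a = smash π ∧ (tupleWord π : Cycle Letter) = c}

lemma push_mem_wordSimplices {c : Cycle Letter} {m n : ℕ} (φ : Fin (n + 1) → Fin (m + 1))
    (hφ : ∀ π : Fin (n + 1) → PiTwo, (∀ i, pushTuple φ π i ≠ 0) →
      (tupleWord (pushTuple φ π) : Cycle Letter) = tupleWord π)
    {a : SmashPower PiTwo (n + 1)} (ha : a ∈ wordSimplices c n) :
    push φ a ∈ wordSimplices c m := by
  rcases ha with rfl | ⟨π, _, rfl, hc⟩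
  · exact .inl (smash_eq_of_zero (pushTuple_zero φ ⟨0, rfl⟩) ⟨0, rfl⟩)
  · by_cases h : ∃ i, pushTuple φ π i = 0
    · exact .inl (smash_eq_of_zero h ⟨0, rfl⟩)
    · push Not at h
      exact .inr ⟨_, h, rfl, (hφ π h).trans hc⟩

/-- The simplices `wordSimplices c n` form a simplicial subset. -/
def wordSubcomplex (c : Cycle Letter) : (cyclicBarSSet PiTwo).Subcomplex where
  obj n := wordSimplices c n.unop.len
  map f _ ha := push_mem_wordSimplices _
    (fun π h => tupleWord_dualMap f.unop.toOrderHom π h) ha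

lemma pushTuple_finRotate {n : ℕ} (π : Fin (n + 1) → PiTwo) :
    pushTuple (finRotate (n + 1)) π = fun k => π ((finRotate (n + 1)).symm k) := by
  funext k
  rw [pushTuple, Finset.prod_eq_single_of_mem ((finRotate (n + 1)).symm k) (by simp)]
  intro j hj hne
  simp only [Finset.mem_filter, Finset.mem_univ, true_and] at hj
  exact absurd (by rw [← hj]; simp) hne

/-- The simplices `wordSimplices c n` form a cyclic subset of the cyclic bar construction. -/
def wordCyclicSet (c : Cycle Letter) : CyclicSet where
  sset := (wordSubcomplex c).toSSet
  t n a := ⟨(cyclicBar PiTwo).t n a.1, push_mem_wordSimplices _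
    (fun π _ => by rw [pushTuple_finRotate]; exact tupleWord_rotate π) a.2⟩
  t_iterate n a := by
    refine Subtype.ext (Eq.trans ?_ ((cyclicBar PiTwo).t_iterate n a.1))
    suffices h : ∀ r : ℕ, (((fun a : (wordSubcomplex c).toSSet _⦋n⦌ =>
        (⟨(cyclicBar PiTwo).t n a.1, push_mem_wordSimplices _
          (fun π _ => by rw [pushTuple_finRotate]; exact tupleWord_rotate π) a.2⟩ :
          (wordSubcomplex c).toSSet _⦋n⦌))^[r]) a).1 = ((cyclicBar PiTwo).t n)^[r] a.1 from h _
    intro r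
    induction r generalizing a with
    | zero => rfl
    | succ r ih => exact ih _
  δ_zero_t n a := Subtype.ext ((cyclicBar PiTwo).δ_zero_t n a.1)
  δ_succ_t n i a := Subtype.ext ((cyclicBar PiTwo).δ_succ_t n i a.1)
  σ_zero_t n a := Subtype.ext ((cyclicBar PiTwo).σ_zero_t n a.1)
  σ_succ_t n i a := Subtype.ext ((cyclicBar PiTwo).σ_succ_t n i a.1)

/-- The summand of the cyclic bar construction of `PiTwo` indexed by `c`: the geometric
realization of the cyclic subset `wordCyclicSet c`, with its circle action. -/
abbrev WordSummand (c : Cycle Letter) : Type := (wordCyclicSet c).Realization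

/-- The base point of the summand: the vertex `0`. -/
noncomputable def WordSummand.base (c : Cycle Letter) : WordSummand c :=
  CyclicSet.pt (X := wordCyclicSet c) (n := 0) ⟨smash (fun _ => 0), .inl rfl⟩ stdSimplex.barycenter

/-- The tuple `(π₀, …, πₘ₋₁)` of the letters of a word of length `m ≥ 1` (and the tuple `(1)` for the
empty word). -/
def letterTuple (ω : List Letter) (k : Fin (ω.length - 1 + 1)) : PiTwo :=
  (ω[k.val]?).elim 1 fun l => PiTwo.pow l 0

lemma tupleWord_letterTuple (ω : List Letter) : tupleWord (letterTuple ω) = ω := by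
  rcases ω with _ | ⟨a, L⟩
  · rfl
  · have : List.ofFn (letterTuple (a :: L)) = (a :: L).map fun l => PiTwo.pow l 0 := by
      refine List.ext_getElem (by simp) fun i h1 h2 => ?_
      simp only [List.length_map] at h2
      simp only [List.getElem_ofFn, letterTuple, List.getElem?_eq_getElem h2, List.getElem_map]
      rfl
    rw [tupleWord, this, List.flatMap_map]
    exact List.flatMap_singleton' _

lemma letterTuple_ne_zero (ω : List Letter) (k : Fin (ω.length - 1 + 1)) :
    letterTuple ω k ≠ 0 := by
  rw [letterTuple]
  rcases ω[k.val]? with _ | l <;> intro h <;> cases h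

/-- The `(m-1)`-simplex `π₀ ∧ … ∧ πₘ₋₁` of the letters of the word `ω` of length `m`. -/
def letterSimplex {c : Cycle Letter} (ω : List Letter) (h : (ω : Cycle Letter) = c) :
    (wordCyclicSet c).sset _⦋ω.length - 1⦌ :=
  ⟨smash (letterTuple ω), .inr ⟨_, letterTuple_ne_zero ω, rfl, by rw [tupleWord_letterTuple, h]⟩⟩

end Words

end CyclicSpaces

section RepresentationSphere

/-- The reduced regular representation `ℝ[C_m] - 1` of the cyclic group `C_m = ZMod m`: the vectors
of coordinate sum zero in the regular representation. -/
def reducedRegular (m : ℕ) [NeZero m] : Submodule ℝ (ZMod m → ℝ) where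
  carrier := {v | ∑ j, v j = 0}
  add_mem' {v w} hv hw := by
    simp only [Set.mem_ofPred_eq, Pi.add_apply, Finset.sum_add_distrib] at *
    rw [hv, hw, add_zero]
  zero_mem' := by simp
  smul_mem' a v hv := by
    simp only [Set.mem_ofPred_eq, Pi.smul_apply, smul_eq_mul, ← Finset.mul_sum] at *
    rw [hv, mul_zero]

/-- The action of `k ∈ C_m` on the reduced regular representation; it comes from the map that sends
the basis vector `j` to `j + k`. -/
def regularShift {m : ℕ} [NeZero m] (k : ZMod m) (v : reducedRegular m) : reducedRegular m :=
  ⟨fun j => v.1 (j - k), ((Equiv.subRight k).sum_comp v.1).trans v.2⟩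

/-- The identifications that make `S^V ∧_{C_i} 𝕋₊` out of `S^V × 𝕋`, where `V` is the reduced regular
representation of `C_m` and `S^V` its one-point compactification: all points `(∞, z)` are
identified, and `(k • a, z)` is identified with `(a, k z)` for `k` in the subgroup `C_i` of elements
annihilated by `i`, where `k ∈ C_m` is viewed in `𝕋` as `exp (2πik/m)`. -/
inductive BalancedRel (m i : ℕ) [NeZero m] :
    OnePoint (reducedRegular m) × Circle → OnePoint (reducedRegular m) × Circle → Prop where
  | base (z w : Circle) : BalancedRel m i (OnePoint.infty, z) (OnePoint.infty, w)
  | balance (k : ZMod m) (hk : i • k = 0) (a : OnePoint (reducedRegular m)) (z : Circle) :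
      BalancedRel m i (a.map (regularShift k), z) (a, ZMod.toCircle k * z)

/-- The space `S^(ℝ[C_m] - 1) ∧_{C_i} 𝕋₊`. -/
def InducedSphere (m i : ℕ) [NeZero m] : Type := Quot (BalancedRel m i)

instance (m i : ℕ) [NeZero m] : TopologicalSpace (InducedSphere m i) :=
  inferInstanceAs (TopologicalSpace (Quot (BalancedRel m i)))

namespace InducedSphere

variable {m : ℕ} [NeZero m] {i : ℕ}

/-- The class of `(a, z)`. -/
noncomputable def mk (i : ℕ) (a : OnePoint (reducedRegular m)) (z : Circle) : InducedSphere m i :=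
  Quot.mk _ (a, z)

variable (m i) in
/-- The base point. -/
noncomputable def base : InducedSphere m i := mk i OnePoint.infty 1

/-- The circle group acts by multiplication in the second factor. -/
noncomputable instance : MulAction Circle (InducedSphere m i) where
  smul w := Quot.map (fun p => (p.1, w * p.2)) (by
    rintro _ _ (⟨z, z'⟩ | ⟨k, hk, a, z⟩)
    · exact .base _ _
    · rw [show (w * (ZMod.toCircle k * z)) = ZMod.toCircle k * (w * z) from mul_left_comm _ _ _]
      exact .balance k hk a (w * z))
  one_smul p := by
    induction p using Quot.ind with | _ p =>
    exact congrArg (Quot.mk _) (Prod.ext rfl (one_mul p.2))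
  mul_smul z w p := by
    induction p using Quot.ind with | _ p =>
    exact congrArg (Quot.mk _) (Prod.ext rfl (mul_assoc z w p.2))

end InducedSphere

end RepresentationSphere

/-- A pointed space `(Y, y₀)` with an action of the circle group is equivariantly contractible if
there is an equivariant homotopy, fixing `y₀`, from the identity to the constant map `y₀`. -/
def IsEquivariantlyContractible (Y : Type) [TopologicalSpace Y] [SMul Circle Y] (y₀ : Y) : Prop :=
  ∃ H : (ContinuousMap.id Y).HomotopyRel (ContinuousMap.const Y y₀) {y₀},
    ∀ (t : unitInterval) (z : Circle) (y : Y), H (t, z • y) = z • H (t, y)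

/-! A point of the summand is a configuration of letters on the circle. The entries of a simplex `π₀
∧ … ∧ πₙ` sit at the partial sums of the barycentric coordinates, and each entry places its letters
at its own point. Faces merge entries, degeneracies insert a `1` that carries no letter, and the
configuration collapses to the base point when an `x` meets a `y`. The labelled multiset `divisor`
records this, and the circle acts on it by rotation (`divisor_smul`). Reduced representatives can be
read off from it, so it is injective (`divisor_injective`). Multiplying the monic polynomial with
these roots by the product of all differences between `x`-positions and `y`-positions gives
functions that vary continuously and vanish exactly at collisions. Hence the summand is Hausdorff;
it is also compact, having finitely many non-degenerate simplices, so continuity can be tested on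
divisors.

Fix a representative `ω` of length `m`. A configuration is determined by the `m` cyclic gaps between
successive letters, a point `v` of a simplex, together with the mean position, a point of the
circle. This gives an equivariant surjection `ringPoint`. A point goes to the base point iff some
gap between different neighbouring letters is zero (`ringPoint_eq_base_iff`). Otherwise two points
have the same image iff they differ by a cyclic relabelling that preserves `ω`, and a relabelling by
`d` moves the mean by exactly `d / m` (`ringPoint_shift`, `exists_shift_of_ringPoint_eq`).

If the period is `2`, the letters alternate: the whole boundary of the simplex collapses and the
symmetries are the even shifts, that is `C_i`. The map `softmax` identifies the reduced regular
representation with the open simplex, which yields a continuous bijection from a compact space to a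
Hausdorff space. If the period exceeds `2`, some gap lies between equal letters. Moving all the
length linearly into such gaps, uniformly and hence compatibly with the symmetries, closes every gap
between different letters, and this contracts the summand. -/

section Divisors

open CategoryTheory Simplicial

/-! ### The circle as the quotient of the line by the integers. -/

/-- The point `exp (2πit)` of the circle. -/
noncomputable def circlePt (t : ℝ) : Circle := Circle.exp (2 * Real.pi * t)

lemma circlePt_add (s t : ℝ) : circlePt (s + t) = circlePt s * circlePt t := by
  rw [circlePt, mul_add, Circle.exp_add]; rfl

lemma circlePt_zero : circlePt 0 = 1 := by simp [circlePt]

lemma circlePt_neg (t : ℝ) : circlePt (-t) = (circlePt t)⁻¹ := by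
  rw [circlePt, mul_neg, Circle.exp_neg]; rfl

lemma circlePt_sub (s t : ℝ) : circlePt (s - t) = circlePt s / circlePt t := by
  rw [sub_eq_add_neg, circlePt_add, circlePt_neg, div_eq_mul_inv]

lemma circlePt_eq_iff {s t : ℝ} : circlePt s = circlePt t ↔ ∃ n : ℤ, s = t + n := by
  rw [circlePt, circlePt, Circle.exp_eq_exp]
  have h := Real.pi_pos
  refine exists_congr fun n => ⟨fun h => ?_, fun h => by rw [h]; ring⟩
  have : 2 * Real.pi * (s - (t + n)) = 0 := by linarith
  have := (mul_eq_zero.mp this).resolve_left (by positivity)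
  linarith

lemma circlePt_intCast (n : ℤ) : circlePt n = 1 := by
  rw [← circlePt_zero, circlePt_eq_iff]; exact ⟨n, by simp⟩

lemma circlePt_one : circlePt 1 = 1 := by simpa using circlePt_intCast 1

lemma circlePt_add_one (t : ℝ) : circlePt (t + 1) = circlePt t := by
  rw [circlePt_add, circlePt_one, mul_one]

lemma continuous_circlePt : Continuous circlePt :=
  Circle.exp.continuous.comp (continuous_const.mul continuous_id)

lemma circlePt_surjective : Function.Surjective circlePt := by
  intro z
  refine ⟨Complex.arg z / (2 * Real.pi), ?_⟩
  have := Real.pi_pos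
  rw [circlePt, mul_div_cancel₀ _ (by positivity), Circle.exp_arg]

lemma circlePt_turn (z : Circle) : circlePt (CyclicSet.turn z) = z := by
  have := Real.pi_pos
  conv_rhs => rw [← Circle.exp_arg z]
  rw [← mul_div_cancel₀ (Complex.arg (z : ℂ)) (show 2 * Real.pi ≠ 0 by positivity)]
  change _ = circlePt _
  rw [circlePt_eq_iff]
  refine ⟨-⌊Complex.arg (z : ℂ) / (2 * Real.pi)⌋, ?_⟩
  rw [CyclicSet.turn, Int.fract]
  push_cast; ring

lemma circlePt_injOn {s t : ℝ} (hs : 0 ≤ s) (hs' : s < 1) (ht : 0 ≤ t) (ht' : t < 1)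
    (h : circlePt s = circlePt t) : s = t := by
  obtain ⟨n, rfl⟩ := circlePt_eq_iff.mp h
  have h1 : (-1 : ℝ) < n := by linarith
  have h2 : (n : ℝ) < 1 := by linarith
  norm_cast at h1 h2
  have : n = 0 := by omega
  simp [this]

/-! ### Words of elements and of products in the monoid. -/

namespace PiTwo

lemma word_one : word 1 = [] := rfl

lemma word_eq_nil {a : PiTwo} (h : a ≠ 0) (h' : a.word = []) : a = 1 := by
  rcases a with _ | _ | ⟨l, n⟩
  · exact absurd rfl h
  · rfl
  · simp [word] at h'

/-- An element is a power of one letter, so a single entry never produces a collision. -/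
lemma mem_word_unique {a : PiTwo} {l k : Letter} (hl : l ∈ a.word) (hk : k ∈ a.word) : l = k := by
  rcases a with _ | _ | ⟨j, n⟩
  · simp [word] at hl
  · simp [word] at hl
  · rw [word] at hl hk
    rw [List.eq_of_mem_replicate hl, List.eq_of_mem_replicate hk]

/-- The letter and the exponent are visible in the multiset of letters. Divisors, which forget the
order, therefore still determine the entries. -/
lemma word_perm_injective {a b : PiTwo} (ha : a ≠ 0) (hb : b ≠ 0)
    (h : (a.word : Multiset Letter) = b.word) : a = b := by
  rcases a with _ | _ | ⟨l, m⟩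
  · exact absurd rfl ha
  · rcases b with _ | _ | ⟨k, n⟩
    · exact absurd rfl hb
    · rfl
    · have := congrArg Multiset.card h
      simp [word] at this
  · rcases b with _ | _ | ⟨k, n⟩
    · exact absurd rfl hb
    · simp [word] at h
    · rw [Multiset.coe_eq_coe] at h
      have h1 := h.length_eq
      simp [word] at h1
      subst h1
      have : l ∈ (pow k m).word := h.subset (by simp [word])
      rw [List.eq_of_mem_replicate this]

/-- There are only two letters: factors that both avoid `l` are powers of the other one. -/
lemma mul_ne_zero_of_notMem {a b : PiTwo} (l : Letter) (ha : a ≠ 0) (hb : b ≠ 0) (hla : l ∉ a.word)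
    (hlb : l ∉ b.word) : a * b ≠ 0 := by
  rcases a with _ | _ | ⟨k, m⟩
  · exact absurd rfl ha
  · exact hb
  · rcases b with _ | _ | ⟨j, n⟩
    · exact absurd rfl hb
    · exact ha
    · have e : k = j := by
        simp only [word, List.mem_replicate] at hla hlb
        cases l <;> cases k <;> cases j <;> simp_all
      change mul _ _ ≠ zero
      simp [mul, e]

lemma prod_ne_zero_of_notMem {ι : Type*} (s : Finset ι) (f : ι → PiTwo) (l : Letter)
    (h0 : ∀ i, f i ≠ 0) (hl : ∀ i ∈ s, l ∉ (f i).word) :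
    ∏ i ∈ s, f i ≠ 0 ∧ l ∉ (∏ i ∈ s, f i).word := by
  classical
  induction s using Finset.induction_on with
  | empty =>
    rw [Finset.prod_empty]
    exact ⟨fun h => (by cases h), by simp [word_one]⟩
  | insert i s hi ih =>
    obtain ⟨h1, h2⟩ := ih fun j hj => hl j (Finset.mem_insert_of_mem hj)
    rw [Finset.prod_insert hi]
    have h3 := hl i (Finset.mem_insert_self i s)
    have h4 := mul_ne_zero_of_notMem l (h0 i) h1 h3 h2
    exact ⟨h4, by rw [word_mul h4, List.mem_append]; tauto⟩

lemma coe_word_prod {ι : Type*} (s : Finset ι) (f : ι → PiTwo) (h : ∏ i ∈ s, f i ≠ 0) :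
    ((∏ i ∈ s, f i).word : Multiset Letter) = ∑ i ∈ s, ((f i).word : Multiset Letter) := by
  classical
  induction s using Finset.induction_on with
  | empty => simp [word_one]
  | insert i s hi ih =>
    rw [Finset.prod_insert hi] at h ⊢
    rw [Finset.sum_insert hi, word_mul h, ← ih (right_ne_zero_of_mul h), Multiset.coe_add]

end PiTwo

/-! ### Divisors of letters on the circle. -/

/-- The letters of the entries of a tuple, the letters of the `i`-th entry being placed at `P i`. -/
def tupleDiv {k : ℕ} (π : Fin k → PiTwo) (P : Fin k → Circle) : Multiset (Letter × Circle) :=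
  ∑ i, ((π i).word : Multiset Letter).map fun l => (l, P i)

lemma mem_tupleDiv {k : ℕ} {π : Fin k → PiTwo} {P : Fin k → Circle} {q : Letter × Circle} :
    q ∈ tupleDiv π P ↔ ∃ i, q.1 ∈ (π i).word ∧ P i = q.2 := by
  rw [tupleDiv, Multiset.mem_sum]
  simp only [Finset.mem_univ, true_and, Multiset.mem_map, Multiset.mem_coe]
  refine exists_congr fun i => ⟨?_, ?_⟩
  · rintro ⟨l, hl, rfl⟩; exact ⟨hl, rfl⟩
  · rintro ⟨h, h'⟩; exact ⟨_, h, Prod.ext rfl h'⟩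

/-- Entries that are multiplied together are exactly those placed at a common point, so no letter
moves. Multisets ignore order, hence no monotonicity of `φ` is needed. -/
lemma tupleDiv_pushTuple {k l : ℕ} (φ : Fin k → Fin l) (π : Fin k → PiTwo) (P : Fin l → Circle)
    (h : ∀ i, pushTuple φ π i ≠ 0) : tupleDiv (pushTuple φ π) P = tupleDiv π (P ∘ φ) := by
  rw [tupleDiv, tupleDiv, ← Finset.sum_fiberwise Finset.univ φ]
  refine Finset.sum_congr rfl fun i _ => ?_
  have := PiTwo.coe_word_prod _ _ (h i)
  rw [pushTuple, this, ← Multiset.coe_mapAddMonoidHom, map_sum]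
  refine Finset.sum_congr rfl fun j hj => ?_
  simp only [Finset.mem_filter, Finset.mem_univ, true_and] at hj
  simp [hj]

lemma tupleDiv_map_div {k : ℕ} (π : Fin k → PiTwo) (P : Fin k → Circle) (z : Circle) :
    (tupleDiv π P).map (Prod.map id (· / z)) = tupleDiv π (fun i => P i / z) := by
  rw [tupleDiv, tupleDiv, ← Multiset.coe_mapAddMonoidHom, map_sum]
  refine Finset.sum_congr rfl fun i _ => ?_
  rw [Multiset.coe_mapAddMonoidHom, Multiset.map_map]
  rfl

lemma card_tupleDiv {k : ℕ} (π : Fin k → PiTwo) (P : Fin k → Circle) :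
    (tupleDiv π P).card = (tupleWord π).length := by
  rw [tupleWord_eq, List.length_flatMap, tupleDiv, Multiset.card_sum]
  simp only [Multiset.card_map, Multiset.coe_card]
  rw [← List.sum_toFinset _ (List.nodup_finRange k), List.toFinset_finRange]

/-- Some letter `x` and some letter `y` lie at the same point. -/
def Collides (M : Multiset (Letter × Circle)) : Prop :=
  ∃ s, (Letter.x, s) ∈ M ∧ (Letter.y, s) ∈ M

lemma collides_of_ne {M : Multiset (Letter × Circle)} {l k : Letter} {s : Circle} (h : l ≠ k)
    (hl : (l, s) ∈ M) (hk : (k, s) ∈ M) : Collides M := by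
  cases l <;> cases k
  · exact absurd rfl h
  · exact ⟨s, hl, hk⟩
  · exact ⟨s, hk, hl⟩
  · exact absurd rfl h

lemma collides_map_div {M : Multiset (Letter × Circle)} (z : Circle) :
    Collides (M.map (Prod.map id (· / z))) ↔ Collides M := by
  have key : ∀ (l : Letter) (s : Circle), (l, s) ∈ M.map (Prod.map id (· / z)) ↔ (l, s * z) ∈ M := by
    intro l s
    rw [Multiset.mem_map]
    constructor
    · rintro ⟨⟨a, t⟩, h, e⟩
      simp only [Prod.map, Prod.mk.injEq, id] at e
      rw [← e.1, ← e.2, div_mul_cancel]; exact h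
    · exact fun h => ⟨_, h, by simp⟩
  simp only [Collides, key]
  constructor
  · rintro ⟨s, h⟩; exact ⟨_, h⟩
  · rintro ⟨s, h⟩; exact ⟨s / z, by simpa using h⟩

/-- A product of non-zero entries vanishes only if both letters occur among its factors, and these
factors all sit at one point. This matches the convention in `clean`. -/
lemma collides_of_pushTuple_eq_zero {k l : ℕ} (φ : Fin k → Fin l) {π : Fin k → PiTwo}
    (P : Fin l → Circle) (h0 : ∀ i, π i ≠ 0) (h : ∃ i, pushTuple φ π i = 0) :
    Collides (tupleDiv π (P ∘ φ)) := by
  obtain ⟨i, hi⟩ := h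
  have key : ∀ a : Letter, (a, P i) ∈ tupleDiv π (P ∘ φ) := by
    intro a
    by_contra hn
    refine (PiTwo.prod_ne_zero_of_notMem (Finset.univ.filter fun j => φ j = i) π a h0
      fun j hj ha => hn ?_).1 hi
    simp only [Finset.mem_filter, Finset.mem_univ, true_and] at hj
    exact mem_tupleDiv.mpr ⟨j, ha, by simp [hj]⟩
  exact ⟨P i, key _, key _⟩

open Classical in
/-- The multiset itself, or `0` if it has a collision. -/
noncomputable def clean (M : Multiset (Letter × Circle)) : Multiset (Letter × Circle) :=
  if Collides M then 0 else M

lemma clean_map_div (M : Multiset (Letter × Circle)) (z : Circle) :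
    clean (M.map (Prod.map id (· / z))) = (clean M).map (Prod.map id (· / z)) := by
  rw [clean, clean, collides_map_div]
  split_ifs <;> simp

lemma clean_eq_zero_iff {M : Multiset (Letter × Circle)} (hM : M ≠ 0) :
    clean M = 0 ↔ Collides M := by
  rw [clean]; split_ifs with h <;> simp [h, hM]

open Classical in
/-- The divisor of an element of the smash power, the entries being placed at the points `P`. -/
noncomputable def smashDiv {k : ℕ} (P : Fin k → Circle) :
    SmashPower PiTwo k → Multiset (Letter × Circle) :=
  Quotient.lift (fun π => if ∃ i, π i = 0 then 0 else clean (tupleDiv π P)) (by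
    rintro π ρ (rfl | ⟨h, h'⟩)
    · rfl
    · rw [if_pos h, if_pos h'])

lemma smashDiv_of_zero {k : ℕ} (P : Fin k → Circle) {π : Fin k → PiTwo} (h : ∃ i, π i = 0) :
    smashDiv P (smash π) = 0 := if_pos h

lemma smashDiv_of_ne {k : ℕ} (P : Fin k → Circle) {π : Fin k → PiTwo} (h : ∀ i, π i ≠ 0) :
    smashDiv P (smash π) = clean (tupleDiv π P) := if_neg (by push Not; exact h)

/-- The reason that `divisor` respects the gluing relation: a product either vanishes, and then
there is a collision, or merely collects letters at one point. -/
lemma smashDiv_push {k l : ℕ} (φ : Fin k → Fin l) (P : Fin l → Circle) (a : SmashPower PiTwo k) :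
    smashDiv P (push φ a) = smashDiv (P ∘ φ) a := by
  induction a using Quotient.ind with | _ π =>
  change smashDiv P (smash (pushTuple φ π)) = smashDiv _ (smash π)
  by_cases h : ∃ i, π i = 0
  · rw [smashDiv_of_zero _ h, smashDiv_of_zero _ (pushTuple_zero φ h)]
  · have h1 : ∀ i, π i ≠ 0 := by push Not at h; exact h
    rw [smashDiv_of_ne _ h1]
    by_cases h2 : ∃ i, pushTuple φ π i = 0
    · rw [smashDiv_of_zero _ h2, clean, if_pos (collides_of_pushTuple_eq_zero φ P h1 h2)]
    · have h3 : ∀ i, pushTuple φ π i ≠ 0 := by push Not at h2; exact h2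
      rw [smashDiv_of_ne _ h3, tupleDiv_pushTuple φ π P h3]

lemma smashDiv_map_div {k : ℕ} (P : Fin k → Circle) (a : SmashPower PiTwo k) (z : Circle) :
    smashDiv (fun i => P i / z) a = (smashDiv P a).map (Prod.map id (· / z)) := by
  induction a using Quotient.ind with | _ π =>
  change smashDiv _ (smash π) = (smashDiv _ (smash π)).map _
  by_cases h : ∃ i, π i = 0
  · rw [smashDiv_of_zero _ h, smashDiv_of_zero _ h]; rfl
  · have h1 : ∀ i, π i ≠ 0 := by push Not at h; exact h
    rw [smashDiv_of_ne _ h1, smashDiv_of_ne _ h1, ← clean_map_div, tupleDiv_map_div]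

/-- The position on the circle of the `k`-th entry for the barycentric coordinates `u`. -/
noncomputable def entryPos {n : ℕ} (u : stdSimplex ℝ (Fin (n + 1))) (k : Fin (n + 1)) : Circle :=
  circlePt (partialSum u k)

lemma entryPos_map {m n : ℕ} {f : Fin (m + 1) → Fin (n + 1)} (hf : Monotone f)
    (u : stdSimplex ℝ (Fin (m + 1))) (k : Fin (n + 1)) :
    entryPos (stdSimplex.map f u) k = entryPos u (dualMap f k) := by
  have h1 : partialSum (stdSimplex.map f u) k = partialSum u (belowCount f k) := by
    rw [partialSum_map, partialSum]
    simp only [lt_belowCount_iff hf]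
  rw [entryPos, entryPos, h1, dualMap]
  rcases (belowCount_le f k).lt_or_eq with h | h
  · simp only [Nat.mod_eq_of_lt h]
  -- The label wraps around to `0`; the positions `1` and `0` are the same point of the circle.
  · simp only [h, Nat.mod_self, partialSum_last, partialSum_zero, circlePt_one, circlePt_zero]

/-- The underlying element of the smash power. -/
def toSmash {c : Cycle Letter} {n : ℕ} (x : (wordCyclicSet c).sset _⦋n⦌) :
    SmashPower PiTwo (n + 1) := x.1

lemma toSmash_injective {c : Cycle Letter} {n : ℕ} :
    Function.Injective (toSmash (c := c) (n := n)) := Subtype.val_injective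

lemma toSmash_map {c : Cycle Letter} {m n : ℕ} (f : ⦋m⦌ ⟶ ⦋n⦌) (x : (wordCyclicSet c).sset _⦋n⦌) :
    toSmash ((wordCyclicSet c).sset.map f.op x) = push (dualMap f.toOrderHom) (toSmash x) := rfl

lemma toSmash_σ {c : Cycle Letter} {n : ℕ} (i : Fin (n + 1)) (x : (wordCyclicSet c).sset _⦋n⦌) :
    toSmash ((wordCyclicSet c).sset.σ i x) = push (dualσ i) (toSmash x) := rfl

lemma toSmash_δ {c : Cycle Letter} {n : ℕ} (i : Fin (n + 2)) (x : (wordCyclicSet c).sset _⦋n + 1⦌) :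
    toSmash ((wordCyclicSet c).sset.δ i x) = push (dualδ i) (toSmash x) := rfl

lemma toSmash_iterate_t {c : Cycle Letter} {n : ℕ} (x : (wordCyclicSet c).sset _⦋n⦌) (r : ℕ) :
    toSmash (((wordCyclicSet c).t n)^[r] x) = (push (finRotate (n + 1)))^[r] (toSmash x) := by
  induction r with
  | zero => rfl
  | succ r ih => rw [Function.iterate_succ_apply', Function.iterate_succ_apply', ← ih]; rfl

/-- The divisor of a point of the summand: the letters with their positions on the circle; it is
`0` at the base point. -/
noncomputable def divisor {c : Cycle Letter} : WordSummand c → Multiset (Letter × Circle) :=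
  Quot.lift (fun p => smashDiv (entryPos p.2) (toSmash p.1.2)) (by
    rintro _ _ ⟨m, n, f, x, u, rfl, rfl⟩
    refine (smashDiv_push (dualMap f.toOrderHom) (entryPos u) (toSmash x)).trans ?_
    congr 1
    funext k
    exact (entryPos_map f.toOrderHom.monotone u k).symm)

lemma divisor_pt {c : Cycle Letter} {n : ℕ} (x : (wordCyclicSet c).sset _⦋n⦌)
    (u : stdSimplex ℝ (Fin (n + 1))) :
    divisor (CyclicSet.pt x u) = smashDiv (entryPos u) (toSmash x) := rfl

lemma divisor_base (c : Cycle Letter) : divisor (WordSummand.base c) = 0 :=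
  smashDiv_of_zero _ ⟨0, rfl⟩

/-- The index `l` is where the entry `k` lands when a `1` is inserted after the entry at `cutIndex u
θ` and the tuple is rotated until this `1` comes first. -/
lemma entryPos_cut {n : ℕ} (u : stdSimplex ℝ (Fin (n + 1))) {θ : ℝ} (h0 : 0 ≤ θ) (h1 : θ < 1)
    (k : Fin (n + 1)) (l : Fin (n + 2))
    (hl : l.val = if k.val ≤ (cutIndex u θ).val then k.val + (n + 1) - (cutIndex u θ).val
      else k.val - (cutIndex u θ).val) :
    entryPos (cut u h0 h1) l = entryPos u k / circlePt θ := by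
  have hk := k.2
  have hj := (cutIndex u θ).2
  have hpos : 0 < l.val := by rw [hl]; split_ifs <;> omega
  rw [entryPos, entryPos, partialSum_cut u h0 h1 hpos (by omega), ← circlePt_sub]
  by_cases h : k.val ≤ (cutIndex u θ).val
  · rw [if_pos h] at hl
    -- Entries up to the cut are reached from the new starting point only after passing the old
    -- origin, which adds a full turn.
    rw [← circlePt_add_one (partialSum u k - θ), sub_add_eq_add_sub, ← sum_indicator]
    congr 2
    refine Finset.sum_congr rfl fun q _ => ?_
    have := q.2
    congr 1
    simp only [fin_sub_val, Fin.lt_def]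
    split_ifs <;> first | omega | norm_num
  · rw [if_neg h] at hl
    rw [← add_zero (partialSum u _), ← sum_indicator]
    congr 2
    refine Finset.sum_congr rfl fun q _ => ?_
    have := q.2
    congr 1
    simp only [fin_sub_val, Fin.lt_def]
    split_ifs <;> first | omega | norm_num

/-- The action moves the starting point of the circle to `z`, so positions measured from there are
divided by `z`. -/
lemma divisor_smul {c : Cycle Letter} (z : Circle) (p : WordSummand c) :
    divisor (z • p) = (divisor p).map (Prod.map id (· / z)) := by
  induction p using Quot.ind with | _ p =>
  obtain ⟨⟨n, x⟩, u⟩ := p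
  have h0 : 0 ≤ CyclicSet.turn z := Int.fract_nonneg _
  have h1 : CyclicSet.turn z < 1 := Int.fract_lt_one _
  change divisor (CyclicSet.rotPt x u h0 h1) = (smashDiv (entryPos u) (toSmash x)).map _
  rw [CyclicSet.rotPt, divisor_pt, toSmash_iterate_t, push_finRotate_iterate, smashDiv_push,
    ← smashDiv_map_div, toSmash_σ, smashDiv_push]
  congr 1
  funext k
  conv_rhs => rw [← circlePt_turn z]
  refine entryPos_cut u h0 h1 k _ ?_
  have hk : k.val < n + 1 := k.2
  have hj : (cutIndex u (CyclicSet.turn z)).val < n + 1 := (cutIndex u (CyclicSet.turn z)).2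
  simp only [dualσ_val]
  split_ifs with h
  · rw [Nat.mod_eq_of_lt (by omega)]; omega
  · rw [show k.val + 1 + (n + 1 - (cutIndex u (CyclicSet.turn z)).val) =
      k.val - (cutIndex u (CyclicSet.turn z)).val + (n + 1 + 1) by omega, Nat.add_mod_right,
      Nat.mod_eq_of_lt (by omega)]

end Divisors

/-! ### Reduced representatives and injectivity of the divisor. -/

section Separation

open CategoryTheory Simplicial

lemma partialSum_strictMono {n : ℕ} {u : stdSimplex ℝ (Fin (n + 1))} (hu : ∀ k, 0 < u k) :
    StrictMono fun k : Fin (n + 1) => partialSum u k := by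
  intro k l hkl
  have h1 := partialSum_succ u k
  have h2 : partialSum u (k + 1) ≤ partialSum u l := partialSum_mono u hkl
  have := hu k
  simp only
  linarith

lemma partialSum_nonneg {n : ℕ} (u : stdSimplex ℝ (Fin (n + 1))) (k : ℕ) : 0 ≤ partialSum u k := by
  rw [← partialSum_zero u]; exact partialSum_mono u (Nat.zero_le k)

lemma partialSum_lt_one {n : ℕ} {u : stdSimplex ℝ (Fin (n + 1))} (hu : ∀ k, 0 < u k)
    (k : Fin (n + 1)) : partialSum u k < 1 := by
  have h1 := partialSum_succ u k
  have h2 : partialSum u (k + 1) ≤ partialSum u (n + 1) := partialSum_mono u (by omega)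
  rw [partialSum_last] at h2
  have := hu k
  linarith

lemma entryPos_injective {n : ℕ} {u : stdSimplex ℝ (Fin (n + 1))} (hu : ∀ k, 0 < u k) :
    Function.Injective (entryPos u) := fun _ _ h =>
  (partialSum_strictMono hu).injective (circlePt_injOn (partialSum_nonneg u _)
    (partialSum_lt_one hu _) (partialSum_nonneg u _) (partialSum_lt_one hu _) h)

/-- All entries are non-zero, all coordinates are positive, and only the first entry may be `1`. -/
structure IsReducedTuple {n : ℕ} (π : Fin (n + 1) → PiTwo) (u : stdSimplex ℝ (Fin (n + 1))) : Prop where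
  ne_zero : ∀ k, π k ≠ 0
  pos : ∀ k, 0 < u k
  ne_one : ∀ k : Fin n, π k.succ ≠ 1

/-- Absorbing a unit into its left neighbour and inserting it again changes nothing, so a simplex
with a unit after the first place is degenerate. -/
lemma pushTuple_dualσ_dualδ {n : ℕ} (k : Fin (n + 1)) (π : Fin (n + 2) → PiTwo)
    (h : π k.succ = 1) : pushTuple (dualσ k ∘ dualδ k.castSucc) π = π := by
  have hφ : ∀ j : Fin (n + 2), (dualσ k (dualδ k.castSucc j)).val =
      if j.val = k.val + 1 then k.val else j.val := by
    intro j
    have := j.2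
    have := k.2
    rw [dualσ_val, dualδ_val, Fin.val_castSucc]
    split_ifs <;> omega
  funext i
  rw [pushTuple]
  by_cases hi : i = k.succ
  · subst hi
    rw [h]
    refine Finset.prod_eq_one fun j hj => ?_
    simp only [Finset.mem_filter, Finset.mem_univ, true_and, Function.comp_apply, Fin.ext_iff,
      hφ, Fin.val_succ] at hj
    split_ifs at hj <;> omega
  · refine Finset.prod_eq_single_of_mem i ?_ fun j hj hne => ?_
    · simp only [Finset.mem_filter, Finset.mem_univ, true_and, Function.comp_apply, Fin.ext_iff, hφ]
      split_ifs with h'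
      · exact absurd (Fin.ext h') hi
      · rfl
    · simp only [Finset.mem_filter, Finset.mem_univ, true_and, Function.comp_apply, Fin.ext_iff,
        hφ] at hj
      split_ifs at hj with h'
      · rw [← h]; congr 1; exact Fin.ext h'
      · exact absurd (Fin.ext hj) hne

/-- A simplex with a zero entry is a degeneracy of the vertex `0`, and its cell is squeezed to that
vertex. -/
lemma pt_eq_base {c : Cycle Letter} {n : ℕ} (x : (wordCyclicSet c).sset _⦋n⦌)
    (u : stdSimplex ℝ (Fin (n + 1))) {π : Fin (n + 1) → PiTwo} (hx : toSmash x = smash π)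
    (h : ∃ k, π k = 0) : CyclicSet.pt x u = WordSummand.base c := by
  let x0 : (wordCyclicSet c).sset _⦋0⦌ := ⟨smash (fun _ => 0), .inl rfl⟩
  let f : ⦋n⦌ ⟶ ⦋0⦌ := SimplexCategory.const ⦋n⦌ ⦋0⦌ 0
  have e : x = (wordCyclicSet c).sset.map f.op x0 := by
    refine toSmash_injective ?_
    rw [hx, toSmash_map]
    exact smash_eq_of_zero h (pushTuple_zero _ ⟨0, rfl⟩)
  rw [e, CyclicSet.pt_map, WordSummand.base]
  congr 1
  refine simplex_ext fun c => ?_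
  have key : ∀ v : stdSimplex ℝ (Fin (0 + 1)), ∑ k, v k * c k = c 0 := fun v => by
    have := stdSimplex.sum_eq_one v
    simp at this
    simp
  exact (key _).trans (key _).symm

/-- Induction on the dimension: a vanishing coordinate allows passage to a face, and a unit beyond
the first place allows removal of a degeneracy. A unit in the first place has to stay, because it
marks the origin when no letter lies there. -/
lemma exists_reduced {c : Cycle Letter} (p : WordSummand c) (hp : p ≠ WordSummand.base c) :
    ∃ (n : ℕ) (x : (wordCyclicSet c).sset _⦋n⦌) (u : stdSimplex ℝ (Fin (n + 1)))
      (π : Fin (n + 1) → PiTwo), p = CyclicSet.pt x u ∧ toSmash x = smash π ∧ IsReducedTuple π u := by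
  induction p using Quot.ind with | _ p =>
  obtain ⟨⟨n, x⟩, u⟩ := p
  change CyclicSet.pt x u ≠ _ at hp
  change ∃ (m : ℕ) (y : (wordCyclicSet c).sset _⦋m⦌) (v : stdSimplex ℝ (Fin (m + 1)))
      (π : Fin (m + 1) → PiTwo), CyclicSet.pt x u = CyclicSet.pt y v ∧ toSmash y = smash π ∧
      IsReducedTuple π v
  induction n with
  | zero =>
    obtain ⟨π, hπ⟩ := Quotient.exists_rep (toSmash x)
    refine ⟨0, x, u, π, rfl, hπ.symm, ?_, ?_, fun k => k.elim0⟩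
    · by_contra! h
      exact hp (pt_eq_base x u hπ.symm h)
    · intro k
      have := stdSimplex.sum_eq_one u
      simp at this
      have hk : k = 0 := Fin.ext (by omega)
      simp [hk]
  | succ n ih =>
    by_cases hu : ∃ k, u k = 0
    · obtain ⟨k, hk⟩ := hu
      let v : stdSimplex ℝ (Fin (n + 1)) := ⟨fun l => u (k.succAbove l),
        fun l => stdSimplex.zero_le u _, by
          have := stdSimplex.sum_eq_one u
          rwa [Fin.sum_univ_succAbove _ k, hk, zero_add] at this⟩
      have e : CyclicSet.pt x u = CyclicSet.pt ((wordCyclicSet c).sset.δ k x) v := by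
        refine Eq.trans ?_ (CyclicSet.pt_map (SimplexCategory.δ k) x v).symm
        congr 1
        refine simplex_ext fun c => ?_
        refine Eq.trans ?_ (sum_map (n := n + 2) _ v c).symm
        rw [Fin.sum_univ_succAbove _ k, hk, zero_mul, zero_add]
        rfl
      rw [e] at hp ⊢
      exact ih _ _ hp
    obtain ⟨π, hπ⟩ := Quotient.exists_rep (toSmash x)
    by_cases h1 : ∃ k : Fin (n + 1), π k.succ = 1
    · obtain ⟨k, hk⟩ := h1
      have e : x = (wordCyclicSet c).sset.σ k ((wordCyclicSet c).sset.δ k.castSucc x) := by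
        refine toSmash_injective ?_
        rw [toSmash_σ, toSmash_δ, ← hπ]
        refine Eq.trans ?_ (push_push _ _ _).symm
        change smash π = smash _
        rw [pushTuple_dualσ_dualδ k π hk]
      have e2 : CyclicSet.pt x u = CyclicSet.pt ((wordCyclicSet c).sset.δ k.castSucc x)
          (stdSimplex.map (SimplexCategory.σ k).toOrderHom u) := by
        conv_lhs => rw [e]
        exact CyclicSet.pt_map (SimplexCategory.σ k) _ u
      rw [e2] at hp ⊢
      exact ih _ _ hp
    push Not at hu h1
    refine ⟨_, x, u, π, rfl, hπ.symm, ?_, fun k => lt_of_le_of_ne (stdSimplex.zero_le u k)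
      (hu k).symm, h1⟩
    by_contra! h
    exact hp (pt_eq_base x u hπ.symm h)

namespace IsReducedTuple

variable {n : ℕ} {π : Fin (n + 1) → PiTwo} {u : stdSimplex ℝ (Fin (n + 1))}

lemma not_collides (h : IsReducedTuple π u) : ¬ Collides (tupleDiv π (entryPos u)) := by
  rintro ⟨s, hx, hy⟩
  obtain ⟨i, hi, hi'⟩ := mem_tupleDiv.mp hx
  obtain ⟨j, hj, hj'⟩ := mem_tupleDiv.mp hy
  obtain rfl : i = j := entryPos_injective h.pos (hi'.trans hj'.symm)
  cases PiTwo.mem_word_unique hi hj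

lemma count_tupleDiv (h : IsReducedTuple π u) (k : Fin (n + 1)) (l : Letter) [DecidableEq Circle] :
    (tupleDiv π (entryPos u)).count (l, entryPos u k) = ((π k).word : Multiset Letter).count l := by
  rw [tupleDiv, Multiset.count_sum', Finset.sum_eq_single_of_mem k (Finset.mem_univ k)]
  · exact Multiset.count_map_eq_count' _ _ (fun a b e => (Prod.ext_iff.mp e).1) _
  · intro j _ hj
    rw [Multiset.count_eq_zero, Multiset.mem_map]
    rintro ⟨a, _, e⟩
    exact hj (entryPos_injective h.pos (Prod.ext_iff.mp e).2)

/-- In a reduced tuple each entry after the first carries a letter, and the first sits at `0` with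
or without one. The set of partial sums is thus visible in the divisor. -/
lemma mem_range_iff (h : IsReducedTuple π u) (t : ℝ) :
    t ∈ Set.range (fun k : Fin (n + 1) => partialSum u k) ↔
      t = 0 ∨ (0 ≤ t ∧ t < 1 ∧ ∃ l, (l, circlePt t) ∈ tupleDiv π (entryPos u)) := by
  constructor
  · rintro ⟨k, rfl⟩
    refine Fin.cases ?_ (fun k => ?_) k
    · left; exact partialSum_zero u
    · right
      refine ⟨partialSum_nonneg u _, partialSum_lt_one h.pos _, ?_⟩
      obtain ⟨l, hl⟩ := List.exists_mem_of_ne_nil _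
        (fun e => h.ne_one k (PiTwo.word_eq_nil (h.ne_zero _) e))
      exact ⟨l, mem_tupleDiv.mpr ⟨_, hl, rfl⟩⟩
  · rintro (rfl | ⟨h0, h1, l, hl⟩)
    · exact ⟨0, partialSum_zero u⟩
    · obtain ⟨i, _, hi⟩ := mem_tupleDiv.mp hl
      exact ⟨i, circlePt_injOn (partialSum_nonneg u _) (partialSum_lt_one h.pos _) h0 h1 hi⟩

end IsReducedTuple

/-- The divisor determines the set of partial sums, whose increasing enumeration gives the dimension
and the coordinates. The multiplicities at these points then give the entries. -/
lemma IsReducedTuple.unique {n m : ℕ} {π : Fin (n + 1) → PiTwo} {u : stdSimplex ℝ (Fin (n + 1))}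
    {ρ : Fin (m + 1) → PiTwo} {v : stdSimplex ℝ (Fin (m + 1))} (h : IsReducedTuple π u)
    (h' : IsReducedTuple ρ v) (e : tupleDiv π (entryPos u) = tupleDiv ρ (entryPos v)) :
    (⟨n, π, u⟩ : Σ n : ℕ, (Fin (n + 1) → PiTwo) × stdSimplex ℝ (Fin (n + 1))) = ⟨m, ρ, v⟩ := by
  classical
  have hr : Set.range (fun k : Fin (n + 1) => partialSum u k) =
      Set.range (fun k : Fin (m + 1) => partialSum v k) := by
    ext t
    rw [h.mem_range_iff, h'.mem_range_iff, e]
  have hs := partialSum_strictMono h.pos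
  have hs' := partialSum_strictMono h'.pos
  obtain rfl : n = m := by
    have h1 := Nat.card_range_of_injective hs.injective
    rw [hr, Nat.card_range_of_injective hs'.injective] at h1
    simpa using h1.symm
  -- Strictly increasing enumerations of the same set coincide.
  have hp : ∀ k : Fin (n + 1), partialSum u k = partialSum v k :=
    fun k => congrFun ((hs.range_inj hs').mp hr) k
  have hp' : ∀ k : ℕ, k ≤ n + 1 → partialSum u k = partialSum v k := fun k hk => by
    rcases hk.lt_or_eq with h | rfl
    · exact hp ⟨k, h⟩
    · rw [partialSum_last, partialSum_last]
  have huv : u = v := by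
    refine stdSimplex.ext (funext fun k => ?_)
    have h1 := partialSum_succ u k
    have h2 := partialSum_succ v k
    rw [hp' _ (by omega), hp' _ (by omega)] at h1
    linarith
  subst huv
  have : π = ρ := by
    funext k
    refine PiTwo.word_perm_injective (h.ne_zero k) (h'.ne_zero k) (Multiset.ext.mpr fun l => ?_)
    rw [← h.count_tupleDiv, ← h'.count_tupleDiv, e]
  rw [this]

lemma sum_length_word {k : ℕ} (π : Fin k → PiTwo) :
    ∑ i, (π i).word.length = (tupleWord π).length := by
  rw [← card_tupleDiv π 1, tupleDiv, Multiset.card_sum]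
  simp

lemma exists_tuple {c : Cycle Letter} {n : ℕ} (x : (wordCyclicSet c).sset _⦋n⦌)
    {π : Fin (n + 1) → PiTwo} (hx : toSmash x = smash π) (h0 : ∀ k, π k ≠ 0) :
    (tupleWord π : Cycle Letter) = c := by
  have key : ∀ {ρ : Fin (n + 1) → PiTwo}, smash π = smash ρ → π = ρ := fun {ρ} h => by
    rcases Quotient.exact h with h | ⟨⟨i, hi⟩, _⟩
    · exact h
    · exact absurd hi (h0 i)
  rcases x.2 with h | ⟨ρ, _, h, hc⟩
  · exact absurd (congrFun (key (hx.symm.trans h)) 0) (h0 0)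
  · rw [key (hx.symm.trans h)]; exact hc

lemma length_tupleWord {c : Cycle Letter} {n : ℕ} (x : (wordCyclicSet c).sset _⦋n⦌)
    {π : Fin (n + 1) → PiTwo} (hx : toSmash x = smash π) (h0 : ∀ k, π k ≠ 0) :
    (tupleWord π).length = c.length := by
  rw [← exists_tuple x hx h0]; rfl

lemma tupleDiv_ne_zero {c : Cycle Letter} (hc : c.length ≠ 0) {n : ℕ}
    (x : (wordCyclicSet c).sset _⦋n⦌) {π : Fin (n + 1) → PiTwo} (hx : toSmash x = smash π)
    (h0 : ∀ k, π k ≠ 0) (P : Fin (n + 1) → Circle) : tupleDiv π P ≠ 0 := by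
  intro h
  have := card_tupleDiv π P
  rw [h, length_tupleWord x hx h0] at this
  exact hc this.symm

/-- Points other than the base point have a reduced, collision-free representative with at least one
letter, so only the base point has divisor `0`. For the empty word every divisor is `0`, whence the
assumption on the length. -/
lemma divisor_injective {c : Cycle Letter} (hc : c.length ≠ 0) :
    Function.Injective (divisor (c := c)) := by
  have key : ∀ p : WordSummand c, p ≠ WordSummand.base c → divisor p ≠ 0 := by
    intro p hp
    obtain ⟨n, x, u, π, rfl, hx, hr⟩ := exists_reduced p hp
    rw [divisor_pt, hx, smashDiv_of_ne _ hr.ne_zero, Ne,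
      clean_eq_zero_iff (tupleDiv_ne_zero hc x hx hr.ne_zero _)]
    exact hr.not_collides
  intro p q h
  by_cases hp : p = WordSummand.base c
  · by_contra hq
    rw [hp, divisor_base] at h
    exact key q (fun e => hq (hp.trans e.symm)) h.symm
  · have hq : q ≠ WordSummand.base c := fun e => key p hp (by rw [h, e, divisor_base])
    obtain ⟨n, x, u, π, rfl, hx, hr⟩ := exists_reduced p hp
    obtain ⟨m, y, v, ρ, rfl, hy, hs⟩ := exists_reduced q hq
    rw [divisor_pt, divisor_pt, hx, hy, smashDiv_of_ne _ hr.ne_zero, smashDiv_of_ne _ hs.ne_zero,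
      clean, clean, if_neg hr.not_collides, if_neg hs.not_collides] at h
    have e := hr.unique hs h
    cases e
    rw [toSmash_injective (hx.trans hy.symm)]

lemma divisor_eq_zero_iff {c : Cycle Letter} (hc : c.length ≠ 0) {p : WordSummand c} :
    divisor p = 0 ↔ p = WordSummand.base c := by
  rw [← divisor_base c]; exact (divisor_injective hc).eq_iff

end Separation

/-! ### Encoding divisors by polynomials. -/

section Discriminant

/-- A complex number encoding a letter at a point of the circle. -/
noncomputable def letterCode : Letter × Circle → ℂ
  | (Letter.x, s) => s
  | (Letter.y, s) => 2 * s

/-- The two letters use the circles of radius `1` and `2`, so the norm tells them apart. -/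
lemma letterCode_injective : Function.Injective letterCode := by
  have h2 : ∀ s t : Circle, (s : ℂ) ≠ 2 * t := fun s t h => by
    have := congrArg norm h
    rw [norm_mul, Circle.norm_coe, Circle.norm_coe] at this
    norm_num at this
  rintro ⟨_ | _, s⟩ ⟨_ | _, t⟩ h
  · rw [Circle.ext h]
  · exact absurd h (h2 s t)
  · exact absurd h.symm (h2 t s)
  · rw [Circle.ext (mul_left_cancel₀ two_ne_zero h)]

/-- The factor contributed by a pair of letters to the discriminant. -/
noncomputable def pairFactor : Letter × Circle → Letter × Circle → ℂ
  | (Letter.x, s), (Letter.y, t) => s - t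
  | _, _ => 1

/-- The product of the differences of the positions of the letters `x` and the letters `y`. -/
noncomputable def discriminant (M : Multiset (Letter × Circle)) : ℂ :=
  (M.map fun q => (M.map fun r => pairFactor q r).prod).prod

lemma discriminant_eq_zero_iff {M : Multiset (Letter × Circle)} :
    discriminant M = 0 ↔ Collides M := by
  simp only [discriminant, Multiset.prod_eq_zero_iff, Multiset.mem_map]
  constructor
  · rintro ⟨⟨_ | _, s⟩, hq, ⟨_ | _, t⟩, hr, h⟩
    · exact absurd h one_ne_zero
    · have := Circle.ext (sub_eq_zero.mp h)
      subst this
      exact ⟨s, hq, hr⟩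
    · exact absurd h one_ne_zero
    · exact absurd h one_ne_zero
  · rintro ⟨s, hx, hy⟩
    exact ⟨_, hx, _, hy, sub_self (s : ℂ)⟩

/-- The discriminant times the monic polynomial whose roots encode the multiset, evaluated at `T`;
the value is `0` for the empty multiset. -/
noncomputable def divEval (M : Multiset (Letter × Circle)) (T : ℂ) : ℂ :=
  open Classical in
  if M = 0 then 0 else discriminant M * (M.map fun q => T - letterCode q).prod

/-- The discriminant makes the case distinction in `clean` disappear. The right-hand side is
continuous in the positions, also across collisions. -/
lemma divEval_clean {M : Multiset (Letter × Circle)} (hM : M ≠ 0) (T : ℂ) :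
    divEval (clean M) T = discriminant M * (M.map fun q => T - letterCode q).prod := by
  by_cases h : Collides M
  · rw [clean, if_pos h, divEval, if_pos rfl, discriminant_eq_zero_iff.mpr h, zero_mul]
  · rw [clean, if_neg h, divEval, if_neg hM]

/-- Values at all `T` determine a polynomial. Its leading coefficient is zero exactly for the zero
divisor, and otherwise its roots are the codes of the letters. -/
lemma divEval_clean_injective {M N : Multiset (Letter × Circle)}
    (h : divEval (clean M) = divEval (clean N)) : clean M = clean N := by
  have key : ∀ M : Multiset (Letter × Circle), ∃ d : ℂ, (d = 0 ↔ clean M = 0) ∧ ∀ T,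
      divEval (clean M) T = (Polynomial.C d *
        (((clean M).map letterCode).map fun a => Polynomial.X - Polynomial.C a).prod).eval T := by
    intro M
    by_cases h : clean M = 0
    · exact ⟨0, by simp [h], fun T => by simp [divEval, h]⟩
    · refine ⟨discriminant (clean M), ?_, fun T => ?_⟩
      · rw [discriminant_eq_zero_iff]
        refine iff_of_false ?_ h
        intro h'
        rw [clean] at h h'
        split_ifs at h h' with h''
        · exact h rfl
        · exact h'' h'
      · rw [divEval, if_neg h, Polynomial.eval_mul, Polynomial.eval_C, Polynomial.eval_multiset_prod,
          Multiset.map_map, Multiset.map_map]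
        simp
  obtain ⟨d, hd, hd'⟩ := key M
  obtain ⟨e, he, he'⟩ := key N
  have hp := Polynomial.funext fun T => (hd' T).symm.trans ((congrFun h T).trans (he' T))
  have monic : ∀ N : Multiset ℂ, ((N.map fun a => Polynomial.X - Polynomial.C a).prod).Monic :=
    fun N => Polynomial.monic_multiset_prod_of_monic _ _ fun a _ => Polynomial.monic_X_sub_C a
  have hde : d = e := by
    have := congrArg Polynomial.leadingCoeff hp
    rwa [Polynomial.leadingCoeff_mul, Polynomial.leadingCoeff_mul, (monic _).leadingCoeff,
      (monic _).leadingCoeff, Polynomial.leadingCoeff_C, Polynomial.leadingCoeff_C, mul_one,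
      mul_one] at this
  subst hde
  by_cases h0 : d = 0
  · rw [hd.mp h0, he.mp h0]
  · have := congrArg Polynomial.roots hp
    rw [Polynomial.roots_C_mul _ h0, Polynomial.roots_C_mul _ h0,
      Polynomial.roots_multiset_prod_X_sub_C, Polynomial.roots_multiset_prod_X_sub_C] at this
    exact Multiset.map_injective letterCode_injective this

lemma continuous_map_tupleDiv_prod {Y : Type*} [TopologicalSpace Y] {k : ℕ} (π : Fin k → PiTwo)
    {P : Y → Fin k → Circle} (F : Y → Letter × Circle → ℂ)
    (hF : ∀ l i, Continuous fun y => F y (l, P y i)) :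
    Continuous fun y => ((tupleDiv π (P y)).map (F y)).prod := by
  have : ∀ y, ((tupleDiv π (P y)).map (F y)).prod =
      ∏ i, (((π i).word : Multiset Letter).map fun l => F y (l, P y i)).prod := by
    intro y
    rw [tupleDiv, ← Multiset.coe_mapAddMonoidHom, map_sum, Multiset.prod_sum]
    simp only [Multiset.coe_mapAddMonoidHom, Multiset.map_map]
    rfl
  simp only [this]
  exact continuous_finsetProd _ fun i _ => continuous_multiset_prod _ fun l _ => hF l i

lemma continuous_letterCode (l : Letter) : Continuous fun s : Circle => letterCode (l, s) := by
  cases l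
  · exact continuous_subtype_val
  · exact continuous_const.mul continuous_subtype_val

lemma continuous_pairFactor (l k : Letter) :
    Continuous fun s : Circle × Circle => pairFactor (l, s.1) (k, s.2) := by
  have := (continuous_subtype_val (p := (· ∈ Submonoid.unitSphere ℂ)).comp continuous_fst).sub
    (continuous_subtype_val (p := (· ∈ Submonoid.unitSphere ℂ)).comp (continuous_snd (X := Circle) (Y := Circle)))
  cases l <;> cases k <;> first | exact continuous_const | exact this

lemma finite_word_length_le (m : ℕ) : {a : PiTwo | a.word.length ≤ m}.Finite := by
  refine ((Set.toFinite {PiTwo.zero, PiTwo.one}).union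
    (((Set.finite_Iio m).image (PiTwo.pow Letter.x)).union
    ((Set.finite_Iio m).image (PiTwo.pow Letter.y)))).subset ?_
  rintro (_ | _ | ⟨_ | _, k⟩) h
  · simp
  · simp
  · simp only [Set.mem_ofPred_eq, PiTwo.word, List.length_replicate] at h
    exact .inr (.inl ⟨k, h, rfl⟩)
  · simp only [Set.mem_ofPred_eq, PiTwo.word, List.length_replicate] at h
    exact .inr (.inr ⟨k, h, rfl⟩)

end Discriminant

/-! ### Topology of the summand and continuity of the circle action on cells. -/

section Embedding

open CategoryTheory Simplicial

/-- Only the positions vary with `y`, while the tuple stays fixed. The positions are kept general so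
that rotated simplices are covered as well. -/
lemma continuous_divEval_smashDiv {Y : Type*} [TopologicalSpace Y] {c : Cycle Letter}
    (hc : c.length ≠ 0) {n : ℕ} (x : (wordCyclicSet c).sset _⦋n⦌) {P : Y → Fin (n + 1) → Circle}
    (hP : ∀ i, Continuous fun y => P y i) (T : ℂ) :
    Continuous fun y => divEval (smashDiv (P y) (toSmash x)) T := by
  obtain ⟨π, hπ⟩ := Quotient.exists_rep (toSmash x)
  have hx : toSmash x = smash π := hπ.symm
  by_cases h : ∃ i, π i = 0
  · simp only [hx, smashDiv_of_zero _ h]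
    exact continuous_const
  · have h0 : ∀ i, π i ≠ 0 := by push Not at h; exact h
    simp only [hx, smashDiv_of_ne _ h0, divEval_clean (tupleDiv_ne_zero hc x hx h0 _)]
    refine Continuous.mul ?_ ?_
    · exact continuous_map_tupleDiv_prod π _ fun l i => continuous_map_tupleDiv_prod π _ fun k j =>
        (continuous_pairFactor l k).comp ((hP i).prodMk (hP j))
    · exact continuous_map_tupleDiv_prod π _ fun l i =>
        continuous_const.sub ((continuous_letterCode l).comp (hP i))

lemma continuous_partialSum {n : ℕ} (k : ℕ) :
    Continuous fun u : stdSimplex ℝ (Fin (n + 1)) => partialSum u k := by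
  refine continuous_finsetSum _ fun l _ => ?_
  split_ifs
  · exact (continuous_apply l).comp continuous_subtype_val
  · exact continuous_const

lemma continuous_entryPos {n : ℕ} (k : Fin (n + 1)) :
    Continuous fun u : stdSimplex ℝ (Fin (n + 1)) => entryPos u k :=
  continuous_circlePt.comp (continuous_partialSum _)

variable {c : Cycle Letter}

lemma continuous_divEval_divisor (hc : c.length ≠ 0) :
    Continuous fun p : WordSummand c => divEval (divisor p) := by
  refine continuous_pi fun T => ?_
  refine continuous_coinduced_dom.mpr (continuous_sigma fun p => ?_)
  exact continuous_divEval_smashDiv hc p.2 continuous_entryPos T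

lemma exists_divisor_eq_clean (p : WordSummand c) : ∃ M, divisor p = clean M := by
  induction p using Quot.ind with | _ p =>
  obtain ⟨⟨n, x⟩, u⟩ := p
  obtain ⟨π, hπ⟩ := Quotient.exists_rep (toSmash x)
  change ∃ M, smashDiv (entryPos u) (toSmash x) = _
  rw [← hπ]
  change ∃ M, smashDiv (entryPos u) (smash π) = _
  by_cases h : ∃ i, π i = 0
  · exact ⟨0, by rw [smashDiv_of_zero _ h, clean]; split_ifs <;> rfl⟩
  · exact ⟨_, smashDiv_of_ne _ (by push Not at h; exact h)⟩

lemma divEval_divisor_injective (hc : c.length ≠ 0) :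
    Function.Injective fun p : WordSummand c => divEval (divisor p) := by
  intro p q h
  obtain ⟨M, hM⟩ := exists_divisor_eq_clean p
  obtain ⟨N, hN⟩ := exists_divisor_eq_clean q
  simp only [hM, hN] at h
  exact divisor_injective hc (by rw [hM, hN, divEval_clean_injective h])

lemma t2Space_wordSummand (hc : c.length ≠ 0) : T2Space (WordSummand c) :=
  T2Space.of_injective_continuous (divEval_divisor_injective hc) (continuous_divEval_divisor hc)

lemma finite_simplices (c : Cycle Letter) (n : ℕ) : Finite ((wordCyclicSet c).sset _⦋n⦌) := by
  have hS : (wordSimplices c n).Finite := by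
    refine (((Set.Finite.pi' fun _ : Fin (n + 1) => finite_word_length_le c.length).image smash).insert
      (smash fun _ => 0)).subset ?_
    rintro a (rfl | ⟨π, _, rfl, h⟩)
    · exact .inl rfl
    · refine .inr ⟨π, fun k => ?_, rfl⟩
      have e : c.length = ∑ i, (π i).word.length := by rw [sum_length_word, ← h]; rfl
      change (π k).word.length ≤ c.length
      rw [e]
      exact Finset.single_le_sum (f := fun i => (π i).word.length) (fun _ _ => Nat.zero_le _)
        (Finset.mem_univ k)
  exact hS.to_subtype

/-- In a reduced tuple all entries but the first use up at least one letter, which bounds the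
dimension by the length of the word. Each dimension has finitely many simplices, so finitely many
compact cells cover the space. -/
lemma compactSpace_wordSummand (c : Cycle Letter) : CompactSpace (WordSummand c) := by
  have := finite_simplices c
  have key : (Set.univ : Set (WordSummand c)) = ⋃ n : Fin (c.length + 1),
      ⋃ x : (wordCyclicSet c).sset _⦋n⦌, Set.range (CyclicSet.pt x) := by
    refine (Set.eq_univ_of_forall fun p => ?_).symm
    simp only [Set.mem_iUnion]
    by_cases hp : p = WordSummand.base c
    · exact ⟨0, _, _, hp.symm⟩
    · obtain ⟨n, x, u, π, rfl, hx, hr⟩ := exists_reduced p hp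
      refine ⟨⟨n, ?_⟩, x, u, rfl⟩
      rw [← length_tupleWord x hx hr.ne_zero, ← sum_length_word, Fin.sum_univ_succ]
      have : ∑ _i : Fin n, 1 ≤ ∑ i : Fin n, (π i.succ).word.length :=
        Finset.sum_le_sum fun i _ => Nat.one_le_iff_ne_zero.mpr fun e =>
          hr.ne_one i (PiTwo.word_eq_nil (hr.ne_zero _) (List.eq_nil_of_length_eq_zero e))
      simp at this
      omega
  refine ⟨?_⟩
  rw [key]
  exact isCompact_iUnion fun n => isCompact_iUnion fun x =>
    isCompact_range ((wordCyclicSet c).continuous_pt x)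

lemma isInducing_divEval_divisor (hc : c.length ≠ 0) :
    Topology.IsInducing fun p : WordSummand c => divEval (divisor p) :=
  have := compactSpace_wordSummand c
  ((continuous_divEval_divisor hc).isClosedEmbedding (divEval_divisor_injective hc)).isInducing

/-- The formula for the action involves `cutIndex`, which jumps. Continuity is therefore tested on
divisors, where the action is division of positions. -/
lemma continuous_smul_pt (hc : c.length ≠ 0) {n : ℕ} (x : (wordCyclicSet c).sset _⦋n⦌) :
    Continuous fun q : Circle × stdSimplex ℝ (Fin (n + 1)) => q.1 • CyclicSet.pt x q.2 := by
  refine (isInducing_divEval_divisor hc).continuous_iff.mpr (continuous_pi fun T => ?_)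
  have := continuous_divEval_smashDiv hc x (Y := Circle × stdSimplex ℝ (Fin (n + 1)))
    (P := fun q i => entryPos q.2 i / q.1)
    (fun i => ((continuous_entryPos i).comp continuous_snd).div' continuous_fst) T
  refine this.congr fun q => ?_
  rw [Function.comp_apply, divisor_smul, divisor_pt, smashDiv_map_div]

end Embedding

/-! ### Periodic lifts of cyclically ordered points to the line. -/

section Lifts

/-- Both sides add up `g` over the integers from `d` to `d + m`. -/
lemma sum_range_shift_succ {A : Type*} [AddCommMonoid A] (m : ℕ) (g : ℤ → A) (d : ℤ) :
    ∑ k ∈ Finset.range m, g (k + (d + 1)) + g d = ∑ k ∈ Finset.range m, g (k + d) + g (d + m) := by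
  have h1 := Finset.sum_range_succ (fun k : ℕ => g (k + d)) m
  have h2 := Finset.sum_range_succ' (fun k : ℕ => g (k + d)) m
  rw [h1] at h2
  rw [add_comm d (m : ℤ), h2]
  push_cast
  simp only [zero_add, add_assoc, add_comm (1 : ℤ)]

lemma sum_range_shift {A : Type*} [AddCancelCommMonoid A] (m : ℕ) (g : ℤ → A)
    (hg : ∀ k, g (k + m) = g k) (d : ℤ) :
    ∑ k ∈ Finset.range m, g (k + d) = ∑ k ∈ Finset.range m, g k := by
  have h : ∀ d, ∑ k ∈ Finset.range m, g (k + (d + 1)) = ∑ k ∈ Finset.range m, g (k + d) := fun d =>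
    add_right_cancel ((sum_range_shift_succ m g d).trans (by rw [hg]))
  induction d using Int.induction_on with
  | zero => simp
  | succ d ih => rw [h, ih]
  | pred d ih => rw [← ih, ← h, sub_add_cancel]

lemma sum_zmod_val {A : Type*} [AddCommMonoid A] {m : ℕ} [NeZero m] (f : ℕ → A) :
    ∑ j : ZMod m, f j.val = ∑ k ∈ Finset.range m, f k := by
  obtain _ | m := m
  · exact absurd rfl (NeZero.ne 0)
  · exact Fin.sum_univ_eq_sum_range f (m + 1)

/-- A lift to `ℝ` of a cyclically ordered `m`-tuple of points of `ℝ / ℤ`. -/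
structure IsLift (m : ℕ) (p : ℤ → ℝ) : Prop where
  mono : Monotone p
  add_period : ∀ k, p (k + m) = p k + 1

variable {m : ℕ} {p q : ℤ → ℝ}

namespace IsLift

lemma add_mul_period (hp : IsLift m p) (k n : ℤ) : p (k + n * m) = p k + n := by
  induction n using Int.induction_on with
  | zero => simp
  | succ n ih => rw [add_mul, one_mul, ← add_assoc, hp.add_period, ih]; push_cast; ring
  | pred n ih =>
    have := hp.add_period (k + (-(n : ℤ) - 1) * m)
    rw [show k + (-(n : ℤ) - 1) * m + m = k + -(n : ℤ) * m by ring, ih] at this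
    push_cast at this ⊢
    linarith

lemma shift (hp : IsLift m p) (d : ℤ) : IsLift m fun k => p (k + d) where
  mono _ _ h := hp.mono (by omega)
  add_period k := by rw [← hp.add_period]; congr 1; ring

/-- Shifting the index by `l` lowers the sum of ceilings by `l`, so it suffices to find the sign of
the shifted sum. If `p l < t`, its terms are non-negative and the first is positive; if `t ≤ p l`,
none is positive. The use is that such a sum depends on the points modulo `1` only up to an integer
constant, and not on their order. -/
lemma lt_iff [NeZero m] (hp : IsLift m p) (t : ℝ) (l : ℤ) :
    p l < t ↔ l < ∑ k ∈ Finset.range m, ⌈t - p k⌉ := by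
  have hS : ∀ d : ℤ, ∑ k ∈ Finset.range m, ⌈t - p (k + d)⌉ =
      ∑ k ∈ Finset.range m, ⌈t - p k⌉ - d := by
    have h : ∀ d : ℤ, ∑ k ∈ Finset.range m, ⌈t - p (k + (d + 1))⌉ =
        ∑ k ∈ Finset.range m, ⌈t - p (k + d)⌉ - 1 := fun d => by
      have h1 := sum_range_shift_succ m (fun k : ℤ => ⌈t - p k⌉) d
      simp only [hp.add_period] at h1
      rw [← sub_sub, Int.ceil_sub_one] at h1
      linarith
    intro d
    induction d using Int.induction_on with
    | zero => simp
    | succ d ih => rw [h, ih]; ring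
    | pred d ih =>
      have := h (-(d : ℤ) - 1)
      rw [sub_add_cancel, ih] at this
      linarith
  rw [← sub_pos (b := l), ← hS]
  constructor
  · intro h
    refine Finset.sum_pos' (fun k hk => ?_) ⟨0, Finset.mem_range.mpr (NeZero.pos m), ?_⟩
    · have h1 : p (k + l) ≤ p (l + m) := hp.mono (by have := Finset.mem_range.mp hk; omega)
      rw [hp.add_period] at h1
      have : -1 < ⌈t - p (k + l)⌉ := by rw [Int.lt_ceil]; push_cast; linarith
      omega
    · rw [Int.ceil_pos]; simpa using h
  · intro h
    by_contra hl
    refine absurd h (not_lt.mpr (Finset.sum_nonpos fun k _ => ?_))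
    have : p l ≤ p (k + l) := hp.mono (by omega)
    rw [Int.ceil_le]; push_cast; linarith

end IsLift

/-- The points of a lift on the circle, labelled by the letters `w`. -/
noncomputable def liftDiv (w : ZMod m → Letter) (p : ℤ → ℝ) : Multiset (Letter × Circle) :=
  ∑ k ∈ Finset.range m, {(w ((k : ℤ) : ZMod m), circlePt (p k))}

lemma liftDiv_ne_zero [NeZero m] (w : ZMod m → Letter) (p : ℤ → ℝ) : liftDiv w p ≠ 0 := by
  intro h
  have := congrArg Multiset.card h
  rw [liftDiv, Multiset.card_sum] at this
  simp [NeZero.ne m] at this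

lemma cast_add_mul_period (k n : ℤ) : ((k + n * m : ℤ) : ZMod m) = k := by simp

lemma mem_liftDiv [NeZero m] {w : ZMod m → Letter} (hp : IsLift m p) {l : Letter} {s : Circle} :
    (l, s) ∈ liftDiv w p ↔ ∃ k : ℤ, w k = l ∧ circlePt (p k) = s := by
  simp only [liftDiv, Multiset.mem_sum, Finset.mem_range, Multiset.mem_singleton, Prod.mk.injEq]
  constructor
  · rintro ⟨k, _, rfl, rfl⟩; exact ⟨k, rfl, rfl⟩
  · rintro ⟨k, rfl, rfl⟩
    have hm : (0 : ℤ) < m := by exact_mod_cast NeZero.pos m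
    have h0 := Int.emod_nonneg k hm.ne'
    have h1 := Int.emod_lt_of_pos k hm
    obtain ⟨a, n, ha, rfl⟩ : ∃ (a : ℕ) (n : ℤ), a < m ∧ k = a + n * m := by
      refine ⟨(k % m).toNat, k / m, by omega, ?_⟩
      rw [Int.toNat_of_nonneg h0, mul_comm]; exact (Int.emod_add_mul_ediv k m).symm
    refine ⟨a, ha, by rw [cast_add_mul_period], ?_⟩
    rw [hp.add_mul_period]
    exact circlePt_eq_iff.mpr ⟨n, rfl⟩

lemma liftDiv_shift (w : ZMod m → Letter) (hp : IsLift m p) (d : ℤ) :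
    liftDiv (fun j : ZMod m => w (j + (d : ZMod m))) (fun k => p (k + d)) = liftDiv w p := by
  have := sum_range_shift m (fun k : ℤ =>
    ({(w (k : ZMod m), circlePt (p k))} : Multiset (Letter × Circle)))
    (fun k => by rw [hp.add_period, circlePt_add_one]; simp) d
  rw [liftDiv, liftDiv, ← this]
  simp

/-- By monotonicity all points between two coinciding ones coincide with them, and somewhere between
two different letters the letter changes. -/
lemma collides_liftDiv_iff [NeZero m] {w : ZMod m → Letter} (hp : IsLift m p) :
    Collides (liftDiv w p) ↔ ∃ k : ℤ, w k ≠ w (k + 1) ∧ p k = p (k + 1) := by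
  constructor
  · rintro ⟨s, hx, hy⟩
    obtain ⟨k, hk, hk'⟩ := (mem_liftDiv hp).mp hx
    obtain ⟨l, hl, hl'⟩ := (mem_liftDiv hp).mp hy
    obtain ⟨n, hn⟩ := circlePt_eq_iff.mp (hk'.trans hl'.symm)
    -- Translating one index by whole periods turns equality on the circle into equality of real
    -- numbers.
    rw [← hp.add_mul_period] at hn
    rw [← cast_add_mul_period l n] at hl
    have hne : w k ≠ w ((l + n * m : ℤ) : ZMod m) := by rw [hk, hl]; exact fun h => by cases h
    generalize l + n * m = b at hn hne
    by_contra! hcon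
    have key : ∀ a b : ℤ, a ≤ b → p a = p b → w a = w b := by
      intro a b hab
      induction b, hab using Int.leInduction with
      | base => intro _; rfl
      | succ b hab ih =>
        intro h
        have h1 := hp.mono hab
        have h2 := hp.mono (show b ≤ b + 1 by omega)
        have h3 : p a = p b := by linarith
        rw [ih h3]
        by_contra hw
        exact hcon b (by simpa using hw) (by linarith)
    rcases le_total k b with h | h
    · exact hne (key k b h hn)
    · exact hne (key b k h hn.symm).symm
  · rintro ⟨k, hk, hk'⟩
    refine collides_of_ne hk ((mem_liftDiv hp).mpr ⟨k, rfl, rfl⟩)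
      ((mem_liftDiv hp).mpr ⟨k + 1, by simp, by rw [hk']⟩)

/-- By `IsLift.lt_iff` a lift is recovered from the sums of `⌈t - p k⌉`, and the divisor fixes these
up to an integer independent of `t`. This integer is the shift. -/
lemma exists_shift_of_liftDiv_eq [NeZero m] {w : ZMod m → Letter} (hp : IsLift m p)
    (hq : IsLift m q) (h : liftDiv w p = liftDiv w q) (hc : ¬ Collides (liftDiv w p)) :
    ∃ d : ℤ, (∀ k, q k = p (k + d)) ∧ ∀ j : ZMod m, w (j + d) = w j := by
  have key : ∀ p : ℤ → ℝ, ∃ N : ℤ, ∀ t : ℝ, ∑ k ∈ Finset.range m, ⌈t - p k⌉ =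
      ((liftDiv w p).map fun q => ⌈t - CyclicSet.turn q.2⌉).sum - N := by
    -- The constant `N` collects the integer parts of the `p k` relative to the representatives
    -- `turn` in `[0, 1)`.
    intro p
    have h1 : ∀ k : ℤ, ∃ n : ℤ, p k = CyclicSet.turn (circlePt (p k)) + n := fun k =>
      circlePt_eq_iff.mp (circlePt_turn _).symm
    choose n hn using h1
    refine ⟨∑ k ∈ Finset.range m, n k, fun t => ?_⟩
    rw [liftDiv, ← Multiset.coe_mapAddMonoidHom, map_sum, Multiset.sum_sum, ← Finset.sum_sub_distrib]
    refine Finset.sum_congr rfl fun k _ => ?_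
    simp only [Multiset.coe_mapAddMonoidHom, Multiset.map_singleton, Multiset.sum_singleton]
    conv_lhs => rw [hn k, ← sub_sub, Int.ceil_sub_intCast]
  obtain ⟨N, hN⟩ := key p
  obtain ⟨N', hN'⟩ := key q
  have hs : ∀ k, q k = p (k + (N' - N)) := fun k => by
    refine eq_of_forall_gt_iff fun t => ?_
    rw [hp.lt_iff, hq.lt_iff, hN, hN', h]
    constructor <;> intro <;> linarith
  refine ⟨N' - N, hs, fun j => ?_⟩
  obtain ⟨k, rfl⟩ := ZMod.intCast_surjective j
  -- If the shift changed a letter, two different letters would lie at the same point.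
  by_contra hne
  refine hc (collides_of_ne hne ((mem_liftDiv hp).mpr ⟨k + (N' - N), by push_cast; rfl, rfl⟩) ?_)
  rw [h]
  exact (mem_liftDiv hq).mpr ⟨k, rfl, by rw [hs]⟩

/-! ### Lifts with prescribed gaps and prescribed mean. -/

/-- The function with mean zero on `ZMod m` that jumps up at `0` and descends linearly. -/
noncomputable def sawtooth (x : ZMod m) : ℝ := ((m - 1) / 2 - (x - 1).val) / m

lemma sum_sawtooth [NeZero m] : ∑ x : ZMod m, sawtooth x = 0 := by
  have h1 : ∑ x : ZMod m, ((x - 1).val : ℝ) = ∑ k ∈ Finset.range m, (k : ℝ) := by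
    rw [← sum_zmod_val (m := m) (fun k => (k : ℝ))]
    exact Equiv.sum_comp (Equiv.subRight (1 : ZMod m)) fun x => (x.val : ℝ)
  have h2 : (∑ k ∈ Finset.range m, (k : ℝ)) = m * ((m - 1) / 2) := by
    have := Finset.sum_range_id_mul_two m
    have h3 : ((∑ k ∈ Finset.range m, k : ℕ) : ℝ) * 2 = m * ((m - 1 : ℕ) : ℝ) := by
      exact_mod_cast this
    rw [Nat.cast_sub (NeZero.pos m), Nat.cast_one] at h3
    push_cast at h3
    linarith
  simp only [sawtooth, ← Finset.sum_div, Finset.sum_sub_distrib, h1, h2]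
  simp only [Finset.sum_const, Finset.card_univ, ZMod.card, nsmul_eq_mul]
  ring

lemma sawtooth_add_one [NeZero m] (x : ZMod m) :
    sawtooth (x + 1) = sawtooth x + (if x = 0 then 1 else 0) - 1 / m := by
  have hm : (m : ℝ) ≠ 0 := by exact_mod_cast NeZero.ne m
  obtain ⟨y, rfl⟩ : ∃ y, x = y + 1 := ⟨x - 1, by ring⟩
  rw [sawtooth, sawtooth, add_sub_cancel_right, add_sub_cancel_right]
  by_cases h : y.val + 1 < m
  · have h1 : (y + 1).val = y.val + 1 := by
      rw [← ZMod.val_natCast_of_lt h]; push_cast; rw [ZMod.natCast_zmod_val]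
    have h2 : y + 1 ≠ 0 := fun e => by rw [e, ZMod.val_zero] at h1; omega
    rw [h1, if_neg h2]; push_cast; field_simp; ring
  · have h1 : y.val + 1 = m := by have := y.val_lt; omega
    have h2 : y + 1 = 0 := by
      rw [← ZMod.natCast_zmod_val y, ← Nat.cast_one, ← Nat.cast_add, h1, ZMod.natCast_self]
    have h3 : (y.val : ℝ) = m - 1 := eq_sub_of_add_eq (by exact_mod_cast h1)
    rw [h2, if_pos rfl, ZMod.val_zero, h3]; push_cast; field_simp; ring

/-- The lift whose successive differences are the values of `v`, and whose mean over a period is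
`(m - 1) / (2 m) - τ`. -/
noncomputable def gapLift [NeZero m] (v : ZMod m → ℝ) (τ : ℝ) (k : ℤ) : ℝ :=
  k / m - τ + ∑ j, v j * sawtooth ((k : ZMod m) - j)

variable [NeZero m]

/-- Each `sawtooth` drops by `1 / m` per step. As the gaps sum to one, this cancels the slope of `k
/ m`, and only the jump at `j = k` remains. -/
lemma gapLift_add_one {v : ZMod m → ℝ} (hv : ∑ j, v j = 1) (τ : ℝ) (k : ℤ) :
    gapLift v τ (k + 1) = gapLift v τ k + v k := by
  have h : ∀ j : ZMod m, v j * sawtooth (((k + 1 : ℤ) : ZMod m) - j) =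
      v j * sawtooth ((k : ZMod m) - j) + (if k = j then v j else 0) - v j * (1 / m) := by
    intro j
    rw [show (((k + 1 : ℤ) : ZMod m) - j) = (k - j) + 1 by push_cast; ring, sawtooth_add_one]
    simp only [sub_eq_zero]
    split_ifs <;> ring
  rw [gapLift, gapLift]
  simp only [h, Finset.sum_sub_distrib, Finset.sum_add_distrib, ← Finset.sum_mul, hv]
  simp
  ring

lemma isLift_gapLift {v : ZMod m → ℝ} (hv : v ∈ stdSimplex ℝ (ZMod m)) (τ : ℝ) :
    IsLift m (gapLift v τ) where
  mono := monotone_int_of_le_succ fun k => by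
    rw [gapLift_add_one hv.2]; linarith [hv.1 k]
  add_period k := by
    have hm : (m : ℝ) ≠ 0 := by exact_mod_cast NeZero.ne m
    rw [gapLift, gapLift]
    push_cast
    simp only [ZMod.natCast_self, add_zero]
    field_simp; ring

lemma eq_add_const {p q : ℤ → ℝ} (h : ∀ k, p (k + 1) - p k = q (k + 1) - q k) (k : ℤ) :
    p k = q k + (p 0 - q 0) := by
  induction k using Int.induction_on with
  | zero => ring
  | succ k ih => linarith [h k]
  | pred k ih => have := h (-(k : ℤ) - 1); rw [sub_add_cancel] at this; linarith

/-- Successive differences are periodic, non-negative and add up to one over a period; the remaining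
additive constant is absorbed by `τ`. -/
lemma IsLift.exists_gapLift (hp : IsLift m p) :
    ∃ v ∈ stdSimplex ℝ (ZMod m), ∃ τ, p = gapLift v τ := by
  let v : ZMod m → ℝ := fun j => p (j.val + 1) - p j.val
  have hv : ∀ k : ℤ, v k = p (k + 1) - p k := by
    intro k
    have e : k = ((k : ZMod m).val : ℤ) + k / m * m := by
      rw [ZMod.val_intCast, mul_comm]; exact (Int.emod_add_mul_ediv k m).symm
    conv_rhs => rw [e]
    rw [add_right_comm, hp.add_mul_period, hp.add_mul_period]
    ring
  have hsum : ∑ j, v j = 1 := by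
    rw [sum_zmod_val (fun k => p (k + 1) - p k)]
    have := Finset.sum_range_sub (fun k : ℕ => p k) m
    push_cast at this
    rw [this]
    have := hp.add_period 0
    rw [zero_add] at this
    rw [this]; ring
  refine ⟨v, ⟨fun j => sub_nonneg.mpr (hp.mono (by omega)), hsum⟩, gapLift v 0 0 - p 0, ?_⟩
  funext k
  rw [eq_add_const (p := p) (q := gapLift v 0) (fun k => by
    rw [gapLift_add_one hsum, ← hv]; ring) k]
  simp only [gapLift]
  ring

/-- The reason for normalizing by the mean and not by the first letter: relabelling by `d` changes
the parameter by `d / m`, whatever the gaps are. -/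
lemma gapLift_shift (v : ZMod m → ℝ) (τ : ℝ) (d k : ℤ) :
    gapLift (fun j : ZMod m => v (j + (d : ZMod m))) (τ - d / m) k = gapLift v τ (k + d) := by
  rw [gapLift, gapLift]
  have := Equiv.sum_comp (Equiv.addRight (d : ZMod m))
    (fun j => v j * sawtooth (((k + d : ℤ) : ZMod m) - j))
  rw [← this]
  push_cast
  simp only [Equiv.coe_addRight, add_sub_add_right_eq_sub]
  ring

end Lifts

/-! ### The parametrization of the summand by gaps and mean position. -/

section Theta

variable {m : ℕ} [NeZero m]

lemma sum_singleton_eq_map {ι α : Type*} (s : Finset ι) (f : ι → α) :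
    ∑ i ∈ s, ({f i} : Multiset α) = s.val.map f := by
  rw [← Multiset.sum_map_singleton (s.val.map f), Multiset.map_map]; rfl

/-- A periodic family of points of the circle that is listed in increasing order in `[0, 1)` has a
lift. -/
lemma exists_isLift_of_list {L : List (Letter × ℝ)} (hm : L.length = m)
    (hs : L.Pairwise fun a b => a.2 ≤ b.2) (h0 : ∀ a ∈ L, 0 ≤ a.2) (h1 : ∀ a ∈ L, a.2 ≤ 1) :
    ∃ q : ℤ → ℝ, IsLift m q ∧
      liftDiv (fun j : ZMod m => (L[j.val]'(hm ▸ j.val_lt)).1) q =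
        ((L : Multiset (Letter × ℝ)).map fun a => (a.1, circlePt a.2)) := by
  have hm0 := NeZero.pos m
  let a : ZMod m → Letter × ℝ := fun j => L[j.val]'(hm ▸ j.val_lt)
  -- The remainder of `k` modulo `m` selects the point of the list, and the quotient counts full
  -- turns.
  let q : ℤ → ℝ := fun k => (a k).2 + (k / m : ℤ)
  have hval : ∀ (r : ℕ) (n : ℤ) (hr : r < m), q (r + n * m) = (L[r]'(hm ▸ hr)).2 + n := by
    intro r n hr
    simp only [q, a]
    have e1 : (((r + n * m : ℤ) : ZMod m)).val = r := by
      rw [cast_add_mul_period, Int.cast_natCast, ZMod.val_natCast_of_lt hr]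
    have e2 : ((r : ℤ) + n * m) / m = n := by
      rw [Int.add_mul_ediv_right _ _ (by omega), Int.ediv_eq_zero_of_lt (by omega) (by omega),
        zero_add]
    simp only [e1, e2]
  have hrep : ∀ k : ℤ, ∃ (r : ℕ) (n : ℤ), r < m ∧ k = r + n * m := fun k => by
    have hm' : (0 : ℤ) < m := by exact_mod_cast hm0
    have h0 := Int.emod_nonneg k hm'.ne'
    have h1 := Int.emod_lt_of_pos k hm'
    refine ⟨(k % m).toNat, k / m, by omega, ?_⟩
    rw [Int.toNat_of_nonneg h0, mul_comm]; exact (Int.emod_add_mul_ediv k m).symm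
  refine ⟨q, ⟨monotone_int_of_le_succ fun k => ?_, fun k => ?_⟩, ?_⟩
  · obtain ⟨r, n, hr, rfl⟩ := hrep k
    rw [hval r n hr]
    by_cases h : r + 1 < m
    · rw [show (r : ℤ) + n * m + 1 = ((r + 1 : ℕ) : ℤ) + n * m by push_cast; ring, hval _ n h]
      have := List.pairwise_iff_getElem.mp hs r (r + 1) (by omega) (by omega) (by omega)
      linarith
    · rw [show (r : ℤ) + n * m + 1 = ((0 : ℕ) : ℤ) + (n + 1) * m by
        have : r + 1 = m := by omega
        rw [← this]; push_cast; ring, hval 0 (n + 1) hm0]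
      have e1 := h1 _ (List.getElem_mem (l := L) (n := r) (by omega))
      have e2 := h0 _ (List.getElem_mem (l := L) (n := 0) (by omega))
      push_cast
      linarith
  · obtain ⟨r, n, hr, rfl⟩ := hrep k
    rw [show (r : ℤ) + n * m + m = r + (n + 1) * m by ring, hval r n hr, hval r (n + 1) hr]
    push_cast; ring
  · have e : L = List.ofFn fun i : Fin m => L[i.val]'(hm ▸ i.2) := by
      refine List.ext_getElem (by simp [hm]) fun i h1 h2 => by simp
    have hg : ∀ i : Fin m, (((fun j : ZMod m => (L[j.val]'(hm ▸ j.val_lt)).1)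
        (((i : ℕ) : ℤ) : ZMod m)), circlePt (q ((i : ℕ) : ℤ))) =
        ((L[i.val]'(hm ▸ i.2)).1, circlePt (L[i.val]'(hm ▸ i.2)).2) := by
      intro i
      have h1 := hval i 0 i.2
      simp only [zero_mul, add_zero, Int.cast_zero] at h1
      have h2 : ((((i : ℕ) : ℤ) : ZMod m)).val = i := by
        rw [Int.cast_natCast, ZMod.val_natCast_of_lt i.2]
      simp only [h1, h2]
    rw [liftDiv, Finset.sum_range (fun k : ℕ => ({((fun j : ZMod m =>
      (L[j.val]'(hm ▸ j.val_lt)).1) (((k : ℕ) : ℤ) : ZMod m), circlePt (q (k : ℤ)))} :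
        Multiset (Letter × Circle)))]
    conv_rhs => rw [e]
    simp only [hg, Multiset.map_coe, List.map_ofFn]
    rw [sum_singleton_eq_map, Fin.univ_val_map]
    rfl

/-- The letters of a word of length `m`, indexed by `ZMod m`. -/
def cyclicLetter {ω : List Letter} (hm : ω.length = m) (j : ZMod m) : Letter :=
  ω[j.val]'(hm ▸ j.val_lt)

/-- The point of the simplex with coordinates `v 0, …, v (m - 1)`. -/
noncomputable def gapSimplex {N : ℕ} (hN : N + 1 = m) (v : stdSimplex ℝ (ZMod m)) :
    stdSimplex ℝ (Fin (N + 1)) :=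
  ⟨fun k => v ((k.val : ℕ) : ZMod m), fun _ => stdSimplex.zero_le v _, by
    rw [Fin.sum_univ_eq_sum_range (fun k : ℕ => v (k : ZMod m)) (N + 1), hN,
      ← sum_zmod_val (m := m) (fun k : ℕ => v (k : ZMod m))]
    simp⟩

lemma gapSimplex_apply {N : ℕ} (hN : N + 1 = m) (v : stdSimplex ℝ (ZMod m)) (k : Fin (N + 1)) :
    gapSimplex hN v k = v ((k.val : ℕ) : ZMod m) := rfl

lemma continuous_stdSimplex_apply {ι : Type*} [Fintype ι] (j : ι) :
    Continuous fun v : stdSimplex ℝ ι => v j := (continuous_apply j).comp continuous_subtype_val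

lemma continuous_gapSimplex {N : ℕ} (hN : N + 1 = m) : Continuous (gapSimplex hN) :=
  Continuous.subtype_mk (continuous_pi fun _ => continuous_stdSimplex_apply _) _

lemma isLift_gapLift_simplex (v : stdSimplex ℝ (ZMod m)) (τ : ℝ) : IsLift m (gapLift v τ) :=
  isLift_gapLift v.2 τ

lemma partialSum_gapSimplex {N : ℕ} (hN : N + 1 = m) (v : stdSimplex ℝ (ZMod m)) (τ : ℝ) (k : ℕ)
    (hk : k ≤ N + 1) : partialSum (gapSimplex hN v) k = gapLift v τ k - gapLift v τ 0 := by
  induction k with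
  | zero => rw [partialSum_zero]; simp
  | succ k ih =>
    have h := partialSum_succ (gapSimplex hN v) ⟨k, by omega⟩
    rw [gapSimplex_apply] at h
    simp only at h
    have h2 := gapLift_add_one (stdSimplex.sum_eq_one v) τ k
    rw [ih (by omega)] at h
    push_cast at h2 ⊢
    rw [h2, h]; ring

variable {c : Cycle Letter} {ω : List Letter}

/-- The point of the summand with the letters of `ω` placed on the circle at successive distances
`v 0, …, v (m - 1)`, where `z` determines the mean position. -/
noncomputable def ringPoint (hω : (ω : Cycle Letter) = c) (hm : ω.length = m)
    (q : stdSimplex ℝ (ZMod m) × Circle) : WordSummand c :=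
  -- The simplex has its first letter at `0`, whereas `gapLift` at index `0` and `τ = 0` equals this
  -- sum. The quotient corrects the difference.
  (q.2 / circlePt (∑ j, q.1 j * sawtooth (-j))) •
    CyclicSet.pt (letterSimplex ω hω)
      (gapSimplex (by rw [hm]; exact Nat.succ_pred_eq_of_pos (NeZero.pos m)) q.1)

lemma cycle_length (hω : (ω : Cycle Letter) = c) (hm : ω.length = m) : c.length ≠ 0 := by
  rw [← hω]
  change ω.length ≠ 0
  rw [hm]; exact NeZero.ne m

lemma continuous_ringPoint (hω : (ω : Cycle Letter) = c) (hm : ω.length = m) :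
    Continuous (ringPoint (c := c) hω hm) := by
  have h : Continuous fun q : stdSimplex ℝ (ZMod m) × Circle => ∑ j, q.1 j * sawtooth (-j) :=
    continuous_finsetSum _ fun j _ =>
      ((continuous_stdSimplex_apply j).comp continuous_fst).mul continuous_const
  have h1 : Continuous fun q : stdSimplex ℝ (ZMod m) × Circle =>
      q.2 / circlePt (∑ j, q.1 j * sawtooth (-j)) :=
    continuous_snd.div' (continuous_circlePt.comp h)
  have h2 : Continuous fun q : stdSimplex ℝ (ZMod m) × Circle =>
      gapSimplex (N := ω.length - 1)
        (by rw [hm]; exact Nat.succ_pred_eq_of_pos (NeZero.pos m)) q.1 :=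
    (continuous_gapSimplex _).comp continuous_fst
  have h3 := (continuous_smul_pt (cycle_length hω hm) (letterSimplex ω hω)).comp (h1.prodMk h2)
  exact h3.congr fun q => by rw [ringPoint]; rfl

lemma smul_ringPoint (hω : (ω : Cycle Letter) = c) (hm : ω.length = m) (x : Circle)
    (v : stdSimplex ℝ (ZMod m)) (z : Circle) :
    x • ringPoint hω hm (v, z) = ringPoint hω hm (v, x * z) := by
  rw [ringPoint, ringPoint, smul_smul, mul_div_assoc]

/-- Translates statements about `ringPoint` into statements about lifts. The action divides
positions, which accounts for the sign of `τ` in `gapLift`. -/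
lemma divisor_ringPoint (hω : (ω : Cycle Letter) = c) (hm : ω.length = m)
    (v : stdSimplex ℝ (ZMod m)) (τ : ℝ) : divisor (ringPoint hω hm (v, circlePt τ)) =
      clean (liftDiv (cyclicLetter hm) (gapLift v τ)) := by
  have hN : ω.length - 1 + 1 = m := by rw [hm]; exact Nat.succ_pred_eq_of_pos (NeZero.pos m)
  rw [ringPoint, divisor_smul, divisor_pt]
  have hx : toSmash (letterSimplex ω hω) = smash (letterTuple ω) := rfl
  rw [hx, smashDiv_of_ne _ (letterTuple_ne_zero ω), ← clean_map_div, tupleDiv_map_div]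
  congr 1
  have h0 : ∀ i : Fin (ω.length - 1 + 1), entryPos (gapSimplex hN v) i /
      (circlePt τ / circlePt (∑ j, v j * sawtooth (-j))) = circlePt (gapLift v τ (i : ℕ)) := by
    intro i
    rw [entryPos, partialSum_gapSimplex hN v τ i (by omega), ← circlePt_sub, ← circlePt_sub]
    congr 1
    have : gapLift v τ 0 = -τ + ∑ j, v j * sawtooth (-j) := by simp [gapLift]
    rw [this]; ring
  have h1 : ∀ i : Fin (ω.length - 1 + 1), ((letterTuple ω i).word : Multiset Letter) =
      {cyclicLetter hm (((i : ℕ) : ℤ) : ZMod m)} := by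
    intro i
    have hi : i.val < m := hN ▸ i.2
    have e : (((i : ℕ) : ℤ) : ZMod m).val = i := by
      rw [Int.cast_natCast, ZMod.val_natCast_of_lt hi]
    rw [letterTuple, List.getElem?_eq_getElem (hm ▸ hi)]
    simp only [cyclicLetter, e]
    rfl
  have h2 : ∀ i : Fin (ω.length - 1 + 1), ((letterTuple ω i).word : Multiset Letter).map
      (fun l => (l, entryPos (gapSimplex hN v) i /
      (circlePt τ / circlePt (∑ j, v j * sawtooth (-j))))) =
      {(cyclicLetter hm (((i : ℕ) : ℤ) : ZMod m), circlePt (gapLift v τ (i : ℕ)))} := by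
    intro i
    rw [h1, h0, Multiset.map_singleton]
  rw [liftDiv, tupleDiv]
  refine (Finset.sum_congr rfl fun i _ => h2 i).trans ?_
  rw [Fin.sum_univ_eq_sum_range (fun i : ℕ => ({(cyclicLetter hm ((i : ℤ) : ZMod m),
    circlePt (gapLift v τ (i : ℕ)))} : Multiset (Letter × Circle))), hN]

/-- Reading the letters entry by entry lists them in increasing position. The word obtained is a
rotation of `ω`, so a shift of the index of the resulting lift restores the labels of `ω`. -/
lemma exists_liftDiv_eq_of_reduced (hω : (ω : Cycle Letter) = c) (hm : ω.length = m) {n : ℕ}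
    (x : (wordCyclicSet c).sset.obj (Opposite.op (SimplexCategory.mk n)))
    {π : Fin (n + 1) → PiTwo} {u : stdSimplex ℝ (Fin (n + 1))} (hx : toSmash x = smash π)
    (hr : IsReducedTuple π u) :
    ∃ p, IsLift m p ∧ liftDiv (cyclicLetter hm) p = tupleDiv π (entryPos u) := by
  let L : List (Letter × ℝ) := (List.finRange (n + 1)).flatMap fun k =>
    (π k).word.map fun l => (l, partialSum u k)
  have hL1 : L.map Prod.fst = tupleWord π := by
    rw [tupleWord_eq, List.map_flatMap]
    simp [Function.comp_def]
  have hmem : ∀ a ∈ L, ∃ k : Fin (n + 1), partialSum u k = a.2 := by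
    intro a ha
    simp only [L, List.mem_flatMap, List.mem_map] at ha
    obtain ⟨k, _, l, _, rfl⟩ := ha
    exact ⟨k, rfl⟩
  have hlen : L.length = m := by
    rw [← List.length_map (f := Prod.fst), hL1, length_tupleWord x hx hr.ne_zero, ← hω]; exact hm
  have hs : L.Pairwise fun a b => a.2 ≤ b.2 := by
    refine List.pairwise_flatMap.mpr ⟨fun k _ => ?_, ?_⟩
    · refine List.pairwise_map.mpr (List.pairwise_iff_getElem.mpr fun _ _ _ _ _ => le_rfl)
    · refine (List.pairwise_le_finRange (n + 1)).imp fun {a b} hab => ?_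
      simp only [List.mem_map]
      rintro _ ⟨_, _, rfl⟩ _ ⟨_, _, rfl⟩
      exact partialSum_mono u hab
  obtain ⟨q, hq, hq'⟩ := exists_isLift_of_list hlen hs
    (fun a ha => by obtain ⟨k, hk⟩ := hmem a ha; rw [← hk]; exact partialSum_nonneg u k)
    (fun a ha => by obtain ⟨k, hk⟩ := hmem a ha; rw [← hk]; exact (partialSum_lt_one hr.pos k).le)
  have hdiv : ((L : Multiset (Letter × ℝ)).map fun a => (a.1, circlePt a.2)) =
      tupleDiv π (entryPos u) := by
    rw [tupleDiv]
    simp only [L, Multiset.map_coe, List.map_flatMap, List.map_map]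
    rw [← Multiset.coe_bind]
    rfl
  have hrot : (tupleWord π).IsRotated ω :=
    Cycle.coe_eq_coe.mp ((exists_tuple x hx hr.ne_zero).trans hω.symm)
  obtain ⟨r, hr'⟩ := hrot
  refine ⟨fun k => q (k + r), by simpa using hq.shift r, ?_⟩
  rw [← hdiv, ← hq', ← liftDiv_shift _ hq r]
  congr 1
  funext j
  subst hr'
  simp only [cyclicLetter, List.getElem_rotate, ← hL1, List.getElem_map, List.length_map, hlen]
  congr 2
  rw [Int.cast_natCast, ZMod.val_add, ZMod.val_natCast, Nat.add_mod_mod]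

/-- The base point means a collision, and for a lift a collision occurs between neighbours, where it
means a closed gap. -/
lemma ringPoint_eq_base_iff (hω : (ω : Cycle Letter) = c) (hm : ω.length = m)
    (q : stdSimplex ℝ (ZMod m) × Circle) : ringPoint hω hm q = WordSummand.base c ↔
      ∃ j, cyclicLetter hm j ≠ cyclicLetter hm (j + 1) ∧ q.1 j = 0 := by
  obtain ⟨v, z⟩ := q
  obtain ⟨τ, rfl⟩ := circlePt_surjective z
  rw [← divisor_eq_zero_iff (cycle_length hω hm), divisor_ringPoint,
    clean_eq_zero_iff (liftDiv_ne_zero _ _), collides_liftDiv_iff (isLift_gapLift_simplex v τ)]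
  simp only [gapLift_add_one (stdSimplex.sum_eq_one v), left_eq_add]
  constructor
  · rintro ⟨k, h⟩; exact ⟨k, h⟩
  · rintro ⟨j, h⟩
    obtain ⟨k, rfl⟩ := ZMod.intCast_surjective j
    exact ⟨k, h⟩

lemma ringPoint_surjective (hω : (ω : Cycle Letter) = c) (hm : ω.length = m)
    (hne : ∃ j, cyclicLetter hm j ≠ cyclicLetter hm (j + 1)) :
    Function.Surjective (ringPoint (c := c) hω hm) := by
  intro p
  by_cases hp : p = WordSummand.base c
  · obtain ⟨j, hj⟩ := hne
    -- All the length goes into the gap `j + 1`. It differs from `j` since the letters differ, so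
    -- the gap at the change of letter `j` is closed.
    refine ⟨(⟨_, single_mem_stdSimplex ℝ (j + 1)⟩, 1), ?_⟩
    rw [hp, ringPoint_eq_base_iff]
    refine ⟨j, hj, Pi.single_eq_of_ne (fun e => hj ?_) _⟩
    rw [← e]
  · obtain ⟨n, x, u, π, rfl, hx, hr⟩ := exists_reduced p hp
    obtain ⟨p, hp, hp'⟩ := exists_liftDiv_eq_of_reduced hω hm x hx hr
    obtain ⟨v, hv, τ, rfl⟩ := hp.exists_gapLift
    refine ⟨(⟨v, hv⟩, circlePt τ), divisor_injective (cycle_length hω hm) ?_⟩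
    rw [divisor_ringPoint, divisor_pt, hx, smashDiv_of_ne _ hr.ne_zero, ← hp']
    rfl

/-- A relabelling that preserves the word does not change the configuration. With the next lemma
this describes the fibres away from the base point. -/
lemma ringPoint_shift (hω : (ω : Cycle Letter) = c) (hm : ω.length = m) {d : ℤ}
    (hd : ∀ j, cyclicLetter hm (j + d) = cyclicLetter hm j) {v v' : stdSimplex ℝ (ZMod m)}
    (hv : ∀ j, v' j = v (j + d)) (z : Circle) :
    ringPoint hω hm (v', z) = ringPoint hω hm (v, circlePt (d / m) * z) := by
  obtain ⟨τ, rfl⟩ := circlePt_surjective z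
  refine divisor_injective (cycle_length hω hm) ?_
  rw [← circlePt_add, divisor_ringPoint, divisor_ringPoint]
  have h := gapLift_shift v (d / m + τ) d
  rw [add_sub_cancel_left] at h
  have hv' : (v' : ZMod m → ℝ) = fun j => v (j + d) := funext hv
  have h3 : (gapLift v' τ) = fun k => gapLift v (d / m + τ) (k + d) := by
    funext k; rw [hv', ← h]
  rw [h3, ← liftDiv_shift (cyclicLetter hm) (isLift_gapLift_simplex v _) d]
  simp only [hd]

lemma exists_shift_of_ringPoint_eq (hω : (ω : Cycle Letter) = c) (hm : ω.length = m)
    {v v' : stdSimplex ℝ (ZMod m)} {z z' : Circle}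
    (h : ringPoint hω hm (v, z) = ringPoint hω hm (v', z'))
    (hb : ringPoint hω hm (v, z) ≠ WordSummand.base c) :
    ∃ d : ℤ, (∀ j, cyclicLetter hm (j + d) = cyclicLetter hm j) ∧ (∀ j, v' j = v (j + d)) ∧
      z = circlePt (d / m) * z' := by
  obtain ⟨τ, rfl⟩ := circlePt_surjective z
  obtain ⟨τ', rfl⟩ := circlePt_surjective z'
  have hv := stdSimplex.sum_eq_one v
  have hv' := stdSimplex.sum_eq_one v'
  have hb' := hb
  rw [h, Ne, ← divisor_eq_zero_iff (cycle_length hω hm), divisor_ringPoint,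
    clean_eq_zero_iff (liftDiv_ne_zero _ _)] at hb'
  rw [Ne, ← divisor_eq_zero_iff (cycle_length hω hm), divisor_ringPoint,
    clean_eq_zero_iff (liftDiv_ne_zero _ _)] at hb
  have h1 := congrArg divisor h
  rw [divisor_ringPoint, divisor_ringPoint, clean, clean, if_neg hb, if_neg hb'] at h1
  obtain ⟨d, hd, hd'⟩ := exists_shift_of_liftDiv_eq (isLift_gapLift_simplex v τ)
    (isLift_gapLift_simplex v' τ') h1 hb
  have hvd : ∀ j, v' j = v (j + d) := by
    intro j
    obtain ⟨k, rfl⟩ := ZMod.intCast_surjective j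
    have h2 := gapLift_add_one hv' τ' k
    have h3 := gapLift_add_one hv τ (k + d)
    have h4 := hd (k + 1)
    rw [add_right_comm] at h4
    have h5 := hd k
    rw [Int.cast_add] at h3
    change gapLift v' τ' (k + 1) = _ at h4
    change gapLift v' τ' k = _ at h5
    linarith
  refine ⟨d, hd', hvd, ?_⟩
  -- Both lifts now have the gaps `v'`; comparing them at index `0` yields `τ = d / m + τ'`.
  have h6 := gapLift_shift v τ d 0
  have h7 : (fun j : ZMod m => v (j + (d : ZMod m))) = v' := funext fun j => (hvd j).symm
  rw [h7, ← hd 0] at h6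
  simp only [gapLift] at h6
  rw [← circlePt_add]
  congr 1
  linarith

/-- For equal gaps the correction in `ringPoint` is the mean of `sawtooth`, which is zero. -/
lemma ringPoint_barycenter (hω : (ω : Cycle Letter) = c) (hm : ω.length = m) :
    ringPoint hω hm (stdSimplex.barycenter, 1) =
      CyclicSet.pt (letterSimplex ω hω) stdSimplex.barycenter := by
  have h1 : ∑ j : ZMod m, (stdSimplex.barycenter : stdSimplex ℝ (ZMod m)) j * sawtooth (-j) = 0 := by
    have h : ∀ j : ZMod m, (stdSimplex.barycenter : stdSimplex ℝ (ZMod m)) j =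
      (Fintype.card (ZMod m) : ℝ)⁻¹ := fun j => stdSimplex.barycenter_apply j
    simp only [h, ← Finset.mul_sum]
    have := Equiv.sum_comp (Equiv.neg (ZMod m)) sawtooth
    simp only [Equiv.neg_apply] at this
    rw [this, sum_sawtooth, mul_zero]
  rw [ringPoint]
  simp only [h1, circlePt_zero, div_one, one_smul]
  congr 1
  refine stdSimplex.ext (funext fun k => ?_)
  rw [gapSimplex_apply]
  refine (stdSimplex.barycenter_apply _).trans (Eq.trans ?_ (stdSimplex.barycenter_apply _).symm)
  rw [ZMod.card, Fintype.card_fin, ← hm, Nat.sub_add_cancel (by rw [hm]; exact NeZero.pos m)]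

end Theta

/-! ### The period of a word and its adjacent letters. -/

section Period

variable {m : ℕ} [NeZero m] {c : Cycle Letter} {ω : List Letter}

/-- If rotation by `d` fixes the word, the rotations by `0, …, d - 1` exhaust the orbit. -/
lemma wordPeriod_le_of_rotate (hω : (ω : Cycle Letter) = c) {d : ℕ} (hd : 0 < d)
    (h : ω.rotate d = ω) : wordPeriod c ≤ d := by
  have hsub : {ω' : List Letter | (ω' : Cycle Letter) = c} ⊆
      ((Finset.range d).image fun r => ω.rotate r : Finset (List Letter)) := by
    intro ω' h'
    obtain ⟨n, rfl⟩ : ω.IsRotated ω' := Cycle.coe_eq_coe.mp (hω.trans (Eq.symm h'))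
    rw [Finset.mem_coe, Finset.mem_image]
    refine ⟨n % d, Finset.mem_range.mpr (Nat.mod_lt _ hd), ?_⟩
    have hmul : ∀ k, ω.rotate (d * k) = ω := by
      intro k
      induction k with
      | zero => simp
      | succ k ih => rw [Nat.mul_succ, ← List.rotate_rotate, ih, h]
    conv_rhs => rw [← Nat.div_add_mod n d, ← List.rotate_rotate, hmul]
  calc wordPeriod c ≤ ((Finset.range d).image fun r => ω.rotate r).card := by
        rw [← Set.ncard_coe_finset]; exact Set.ncard_le_ncard hsub (Finset.finite_toSet _)
    _ ≤ d := Finset.card_image_le.trans (Finset.card_range d).le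

lemma rotate_eq_iff (hm : ω.length = m) (d : ℕ) :
    ω.rotate d = ω ↔ ∀ j, cyclicLetter hm (j + d) = cyclicLetter hm j := by
  have key : ∀ j : ZMod m, cyclicLetter hm (j + d) =
      (ω.rotate d)[j.val]'(by rw [List.length_rotate, hm]; exact j.val_lt) := by
    intro j
    simp only [cyclicLetter, List.getElem_rotate, hm]
    congr 1
    rw [ZMod.val_add, ZMod.val_natCast, Nat.add_mod_mod]
  constructor
  · intro h j
    rw [key]
    simp only [h, cyclicLetter]
  · intro h
    refine List.ext_getElem (List.length_rotate ω d) fun k h1 h2 => ?_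
    have hk : ((k : ZMod m)).val = k := ZMod.val_natCast_of_lt (hm ▸ h2)
    have := (key k).symm.trans (h k)
    simp only [cyclicLetter, hk] at this
    exact this

lemma exists_ne_of_two_le (hω : (ω : Cycle Letter) = c) (hm : ω.length = m)
    (hc : 2 ≤ wordPeriod c) : ∃ j, cyclicLetter hm j ≠ cyclicLetter hm (j + 1) := by
  by_contra! h
  have := wordPeriod_le_of_rotate hω one_pos ((rotate_eq_iff hm 1).mpr fun j => by
    rw [Nat.cast_one]; exact (h j).symm)
  omega

lemma letter_eq_of_ne_of_ne {a b c : Letter} (h : a ≠ b) (h' : b ≠ c) : c = a := by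
  cases a <;> cases b <;> cases c <;> simp_all

/-- With two letters, a word without equal cyclic neighbours alternates and is fixed by rotation by
two. -/
lemma exists_eq_of_two_lt (hω : (ω : Cycle Letter) = c) (hm : ω.length = m)
    (hc : 2 < wordPeriod c) : ∃ j, cyclicLetter hm j = cyclicLetter hm (j + 1) := by
  by_contra! h
  have := wordPeriod_le_of_rotate hω two_pos ((rotate_eq_iff hm 2).mpr fun j => by
    refine letter_eq_of_ne_of_ne (h j) ?_
    have := h (j + 1)
    rwa [add_assoc, one_add_one_eq_two] at this)
  omega

/-- An orbit of two words forces rotation by two to fix `ω`. One equal pair of neighbours would then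
spread along the word and make it constant, contradicting that rotation by one moves it. -/
lemma ne_of_period_eq_two (hω : (ω : Cycle Letter) = c) (hm : ω.length = m)
    (hc : wordPeriod c = 2) (j : ZMod m) : cyclicLetter hm j ≠ cyclicLetter hm (j + 1) := by
  have h1 : ω.rotate 1 ≠ ω := fun h => by
    have := wordPeriod_le_of_rotate hω one_pos h
    omega
  have h2 : ω.rotate 2 = ω := by
    by_contra h2
    have h3 : ω.rotate 2 ≠ ω.rotate 1 := fun h => by
      rw [show 2 = 1 + 1 from rfl, ← List.rotate_rotate] at h
      exact h1 (List.rotate_injective 1 h)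
    -- The value of `Set.ncard` at an infinite set is `0`, so a non-zero period gives finiteness.
    have hfin : {ω' : List Letter | (ω' : Cycle Letter) = c}.Finite :=
      Set.finite_of_ncard_ne_zero (by change wordPeriod c ≠ 0; omega)
    have hrot : ∀ n, ((ω.rotate n : List Letter) : Cycle Letter) = c := fun n =>
      (Cycle.coe_eq_coe.mpr ⟨n, rfl⟩ : (ω : Cycle Letter) = (ω.rotate n : List Letter)).symm.trans hω
    have hsub : (({ω, ω.rotate 1, ω.rotate 2} : Finset (List Letter)) : Set (List Letter)) ⊆
        {ω' : List Letter | (ω' : Cycle Letter) = c} := by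
      intro ω' h
      simp only [Finset.coe_insert, Finset.coe_singleton, Set.mem_insert_iff,
        Set.mem_singleton_iff] at h
      rcases h with rfl | rfl | rfl
      · exact hω
      · exact hrot 1
      · exact hrot 2
    have := Set.ncard_le_ncard hsub hfin
    rw [Set.ncard_coe_finset, Finset.card_eq_three.mpr
      ⟨ω, ω.rotate 1, ω.rotate 2, h1.symm, Ne.symm h2, h3.symm, rfl⟩] at this
    change 3 ≤ wordPeriod c at this
    omega
  intro hj
  refine h1 ((rotate_eq_iff hm 1).mpr ?_)
  have h3 := (rotate_eq_iff hm 2).mp h2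
  have key : ∀ n : ℕ, cyclicLetter hm (j + n) = cyclicLetter hm j ∧
      cyclicLetter hm (j + (n + 1 : ℕ)) = cyclicLetter hm j := by
    intro n
    induction n with
    | zero => simpa using hj.symm
    | succ n ih =>
      refine ⟨ih.2, ?_⟩
      rw [← ih.1, ← h3 (j + n)]
      push_cast
      congr 1; ring
  have hall : ∀ k : ZMod m, cyclicLetter hm k = cyclicLetter hm j := fun k => by
    have := (key (k - j).val).1
    rwa [ZMod.natCast_zmod_val, add_sub_cancel] at this
  exact fun k => (hall _).trans (hall k).symm

end Period

/-! ### Contraction when two neighbouring letters agree. -/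

section Contraction

variable {m : ℕ} [NeZero m] {c : Cycle Letter} {ω : List Letter}

/-- The point `(1 - t) v + t v₀` of the simplex. -/
noncomputable def mixSimplex (v₀ : stdSimplex ℝ (ZMod m)) (t : unitInterval)
    (v : stdSimplex ℝ (ZMod m)) : stdSimplex ℝ (ZMod m) :=
  ⟨fun j => (1 - t) * v j + t * v₀ j, fun j => add_nonneg
    (mul_nonneg (sub_nonneg.mpr t.2.2) (stdSimplex.zero_le v j))
    (mul_nonneg t.2.1 (stdSimplex.zero_le v₀ j)), by
    rw [Finset.sum_add_distrib, ← Finset.mul_sum, ← Finset.mul_sum, stdSimplex.sum_eq_one,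
      stdSimplex.sum_eq_one]; ring⟩

lemma mixSimplex_apply (v₀ : stdSimplex ℝ (ZMod m)) (t : unitInterval)
    (v : stdSimplex ℝ (ZMod m)) (j : ZMod m) :
    mixSimplex v₀ t v j = (1 - t) * v j + t * v₀ j := rfl

lemma continuous_mixSimplex (v₀ : stdSimplex ℝ (ZMod m)) :
    Continuous fun q : unitInterval × stdSimplex ℝ (ZMod m) => mixSimplex v₀ q.1 q.2 := by
  refine Continuous.subtype_mk (continuous_pi fun j => ?_) _
  have h1 : Continuous fun q : unitInterval × stdSimplex ℝ (ZMod m) => (q.1 : ℝ) :=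
    continuous_subtype_val.comp continuous_fst
  exact ((continuous_const.sub h1).mul ((continuous_stdSimplex_apply j).comp continuous_snd)).add
    (h1.mul continuous_const)

/-- The barycentre of the face of the gaps between equal letters. -/
lemma exists_uniform_simplex (w : ZMod m → Letter) (h : ∃ j, w j = w (j + 1)) :
    ∃ v₀ : stdSimplex ℝ (ZMod m), (∀ j, w j ≠ w (j + 1) → v₀ j = 0) ∧
      ∀ d, (∀ j, w (j + d) = w j) → ∀ j, v₀ (j + d) = v₀ j := by
  classical
  let A : Finset (ZMod m) := Finset.univ.filter fun j => w j = w (j + 1)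
  have hA : (A.card : ℝ) ≠ 0 := by
    obtain ⟨j, hj⟩ := h
    exact_mod_cast (Finset.card_pos.mpr ⟨j, by simp [A, hj]⟩).ne'
  refine ⟨⟨fun j => if w j = w (j + 1) then (A.card : ℝ)⁻¹ else 0, fun j => ?_, ?_⟩,
    fun j hj => if_neg hj, fun d hd j => ?_⟩
  · simp only; split_ifs <;> positivity
  · rw [← Finset.sum_filter, Finset.sum_const, nsmul_eq_mul]
    exact mul_inv_cancel₀ hA
  · change (if w (j + d) = w (j + d + 1) then (A.card : ℝ)⁻¹ else 0) =
      if w j = w (j + 1) then (A.card : ℝ)⁻¹ else 0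
    rw [add_right_comm, hd, hd]

/-- A continuous surjection from a compact to a Hausdorff space is a quotient map, and so is its
product with the compact interval. -/
lemma exists_homotopy_lift {A B Z : Type*} [TopologicalSpace A] [TopologicalSpace B]
    [TopologicalSpace Z] [CompactSpace A] [T2Space B] {θ : A → B} (hθ : Continuous θ)
    (hsurj : Function.Surjective θ) {G : unitInterval × A → Z} (hG : Continuous G)
    (h : ∀ t a a', θ a = θ a' → G (t, a) = G (t, a')) :
    ∃ H : C(unitInterval × B, Z), ∀ t a, H (t, θ a) = G (t, a) := by
  let Q : C(unitInterval × A, unitInterval × B) := ⟨Prod.map id θ, continuous_id.prodMap hθ⟩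
  have hQ : Topology.IsQuotientMap Q :=
    Q.continuous.isClosedMap.isQuotientMap Q.continuous (Function.surjective_id.prodMap hsurj)
  let g : C(unitInterval × A, Z) := ⟨G, hG⟩
  have hfib : Function.FactorsThrough g Q := by
    rintro ⟨t, a⟩ ⟨t', a'⟩ e
    obtain ⟨rfl, e⟩ := Prod.ext_iff.mp e
    exact h t a a' e
  exact ⟨hQ.lift g hfib, fun t a => DFunLike.congr_fun (hQ.lift_comp g hfib) (t, a)⟩

/-- The gaps move linearly to `v₀`, which is supported on gaps between equal letters, and the mean
position is kept, whence equivariance. Closed gaps between different letters stay closed, so the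
base point is fixed; invariance of `v₀` under the symmetries of the word makes the homotopy descend.
-/
lemma isEquivariantlyContractible_of_exists_eq (hω : (ω : Cycle Letter) = c) (hm : ω.length = m)
    (hne : ∃ j, cyclicLetter hm j ≠ cyclicLetter hm (j + 1))
    (heq : ∃ j, cyclicLetter hm j = cyclicLetter hm (j + 1)) :
    IsEquivariantlyContractible (WordSummand c) (WordSummand.base c) := by
  obtain ⟨v₀, hv₀, hv₀'⟩ := exists_uniform_simplex (cyclicLetter hm) heq
  have hc := cycle_length hω hm
  have := t2Space_wordSummand hc
  have hsurj := ringPoint_surjective hω hm hne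
  have hGc : Continuous fun q : unitInterval × (stdSimplex ℝ (ZMod m) × Circle) =>
      (mixSimplex v₀ q.1 q.2.1, q.2.2) :=
    ((continuous_mixSimplex v₀).comp
      (continuous_fst.prodMk (continuous_fst.comp continuous_snd))).prodMk
      (continuous_snd.comp continuous_snd)
  let G : unitInterval × (stdSimplex ℝ (ZMod m) × Circle) → WordSummand c :=
    fun q => ringPoint hω hm (mixSimplex v₀ q.1 q.2.1, q.2.2)
  have hG : Continuous G := ((continuous_ringPoint hω hm).comp hGc).congr fun _ => rfl
  have hbase : ∀ t v z, ringPoint hω hm (v, z) = WordSummand.base c →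
      G (t, v, z) = WordSummand.base c := by
    intro t v z h
    obtain ⟨j, hj, hj'⟩ := (ringPoint_eq_base_iff hω hm _).mp h
    refine (ringPoint_eq_base_iff hω hm _).mpr ⟨j, hj, ?_⟩
    simp only at hj' ⊢
    rw [mixSimplex_apply, hj', hv₀ j hj]; ring
  have hfib : ∀ t q q', ringPoint hω hm q = ringPoint hω hm q' → G (t, q) = G (t, q') := by
    rintro t ⟨v, z⟩ ⟨v', z'⟩ h
    by_cases hb : ringPoint hω hm (v, z) = WordSummand.base c
    · exact (hbase t v z hb).trans (hbase t v' z' (h.symm.trans hb)).symm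
    · obtain ⟨d, hd, hv, rfl⟩ := exists_shift_of_ringPoint_eq hω hm h hb
      refine (ringPoint_shift hω hm hd (fun j => ?_) z').symm
      change mixSimplex v₀ t v' j = mixSimplex v₀ t v (j + d)
      rw [mixSimplex_apply, mixSimplex_apply, hv, hv₀' _ hd]
  obtain ⟨H, hlift⟩ := exists_homotopy_lift (continuous_ringPoint hω hm) hsurj hG hfib
  refine ⟨⟨⟨H, fun p => ?_, fun p => ?_⟩, fun t p hp => ?_⟩, fun t z p => ?_⟩
  · obtain ⟨⟨v, z⟩, rfl⟩ := hsurj p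
    refine (hlift _ _).trans (congrArg (fun v => ringPoint hω hm (v, z)) ?_)
    refine stdSimplex.ext (funext fun j => ?_)
    change (1 - (0 : ℝ)) * v j + 0 * v₀ j = v j
    ring
  · obtain ⟨⟨v, z⟩, rfl⟩ := hsurj p
    -- At time one the gaps are `v₀`, which vanishes at any change of letter; one such change exists
    -- by `hne`.
    refine (hlift _ _).trans ((ringPoint_eq_base_iff hω hm _).mpr ?_)
    obtain ⟨j, hj⟩ := hne
    refine ⟨j, hj, ?_⟩
    change (1 - (1 : ℝ)) * v j + 1 * v₀ j = 0
    rw [hv₀ j hj]; ring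
  · obtain ⟨⟨v, z⟩, rfl⟩ := hsurj p
    have hp' : ringPoint hω hm (v, z) = WordSummand.base c := hp
    exact ((hlift _ _).trans (hbase t v z hp')).trans hp'.symm
  · obtain ⟨⟨v, w⟩, rfl⟩ := hsurj p
    rw [smul_ringPoint]
    refine (hlift _ _).trans (Eq.trans ?_ (congrArg (z • ·) (hlift t (v, w))).symm)
    exact (smul_ringPoint hω hm z _ w).symm

end Contraction

/-! ### The reduced regular representation as an open simplex. -/

section Softmax

variable {m : ℕ} [NeZero m]

/-- The point of the open simplex with coordinates proportional to `exp (a (-j))`. -/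
noncomputable def softmax (a : reducedRegular m) : stdSimplex ℝ (ZMod m) :=
  ⟨fun j => Real.exp (a.1 (-j)) / ∑ k, Real.exp (a.1 k), fun j => by positivity, by
    have := Equiv.sum_comp (Equiv.neg (ZMod m)) fun k => Real.exp (a.1 k)
    simp only [Equiv.neg_apply] at this
    rw [← Finset.sum_div, this]
    exact div_self (Finset.sum_pos (fun _ _ => Real.exp_pos _) ⟨0, Finset.mem_univ 0⟩).ne'⟩

lemma sum_exp_pos (a : ZMod m → ℝ) : 0 < ∑ k, Real.exp (a k) :=
  Finset.sum_pos (fun _ _ => Real.exp_pos _) ⟨0, Finset.mem_univ 0⟩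

lemma softmax_apply (a : reducedRegular m) (j : ZMod m) :
    softmax a j = Real.exp (a.1 (-j)) / ∑ k, Real.exp (a.1 k) := rfl

lemma softmax_pos (a : reducedRegular m) (j : ZMod m) : 0 < softmax a j :=
  div_pos (Real.exp_pos _) (sum_exp_pos _)

lemma continuous_softmax : Continuous (softmax (m := m)) := by
  have h : ∀ k : ZMod m, Continuous fun a : reducedRegular m => Real.exp (a.1 k) := fun k =>
    Real.continuous_exp.comp ((continuous_apply k).comp continuous_subtype_val)
  exact Continuous.subtype_mk (continuous_pi fun j => (h _).div
    (continuous_finsetSum _ fun k _ => h k) fun a => (sum_exp_pos a.1).ne') _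

/-- The inverse of `softmax` on the open simplex. -/
noncomputable def logmean (v : stdSimplex ℝ (ZMod m)) : reducedRegular m :=
  ⟨fun j => Real.log (v (-j)) - (∑ k, Real.log (v k)) / m, by
    change ∑ j, (Real.log (v (-j)) - (∑ k, Real.log (v k)) / m) = 0
    have hm : (m : ℝ) ≠ 0 := by exact_mod_cast NeZero.ne m
    have := Equiv.sum_comp (Equiv.neg (ZMod m)) fun k => Real.log (v k)
    simp only [Equiv.neg_apply] at this
    rw [Finset.sum_sub_distrib, this, Finset.sum_const, Finset.card_univ, ZMod.card, nsmul_eq_mul,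
      mul_div_cancel₀ _ hm, sub_self]⟩

/-- Taking logarithms leaves `a` up to a common constant, and subtracting the mean removes it
because the coordinates of `a` add up to zero. -/
lemma logmean_softmax (a : reducedRegular m) : logmean (softmax a) = a := by
  have hm : (m : ℝ) ≠ 0 := by exact_mod_cast NeZero.ne m
  have hl : ∀ j, Real.log (softmax a j) = a.1 (-j) - Real.log (∑ k, Real.exp (a.1 k)) := fun j => by
    rw [softmax_apply, Real.log_div (Real.exp_pos _).ne' (sum_exp_pos _).ne', Real.log_exp]
  have hs : ∑ j : ZMod m, a.1 (-j) = 0 := by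
    have := Equiv.sum_comp (Equiv.neg (ZMod m)) a.1
    simp only [Equiv.neg_apply] at this
    rw [this]; exact a.2
  refine Subtype.ext (funext fun j => ?_)
  change Real.log (softmax a (-j)) - (∑ k, Real.log (softmax a k)) / m = a.1 j
  simp only [hl, Finset.sum_sub_distrib, hs, Finset.sum_const, Finset.card_univ, ZMod.card,
    nsmul_eq_mul, neg_neg]
  field_simp
  ring

lemma softmax_logmean {v : stdSimplex ℝ (ZMod m)} (hv : ∀ j, 0 < v j) :
    softmax (logmean v) = v := by
  have he : ∀ j, Real.exp ((logmean v).1 j) = v (-j) / Real.exp ((∑ k, Real.log (v k)) / m) :=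
    fun j => by
      change Real.exp (Real.log (v (-j)) - (∑ k, Real.log (v k)) / m) = _
      rw [Real.exp_sub, Real.exp_log (hv _)]
  have hs : ∑ j : ZMod m, v (-j) = 1 := by
    have := Equiv.sum_comp (Equiv.neg (ZMod m)) v
    simp only [Equiv.neg_apply] at this
    rw [this, stdSimplex.sum_eq_one]
  refine stdSimplex.ext (funext fun j => ?_)
  rw [softmax_apply]
  simp only [he, ← Finset.sum_div, hs, neg_neg]
  have := Real.exp_pos ((∑ k, Real.log (v k)) / m)
  field_simp

lemma continuousOn_logmean :
    ContinuousOn (logmean (m := m)) {v | ∀ j, 0 < v j} := by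
  have h : ∀ k : ZMod m, ContinuousOn (fun v : stdSimplex ℝ (ZMod m) => Real.log (v k))
      {v | ∀ j, 0 < v j} := fun k =>
    (continuous_stdSimplex_apply k).continuousOn.log fun v hv => (hv k).ne'
  refine Topology.IsInducing.subtypeVal.continuousOn_iff.mpr (continuousOn_pi.mpr fun j => ?_)
  exact (h (-j)).sub ((continuousOn_finsetSum _ fun k _ => h k).div_const _)

/-- The sign in `softmax` is chosen for this: `regularShift k` becomes the shift of gaps by `+k`, so
that `ringPoint_shift` turns it into multiplication by `k` and not by its inverse. -/
lemma softmax_regularShift (k : ZMod m) (a : reducedRegular m) (j : ZMod m) :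
    softmax (regularShift k a) j = softmax a (j + k) := by
  have h : ∀ j, (regularShift k a).1 j = a.1 (j - k) := fun _ => rfl
  rw [softmax_apply, softmax_apply]
  simp only [h]
  have := Equiv.sum_comp (Equiv.subRight k) fun j => Real.exp (a.1 j)
  simp only [Equiv.subRight_apply] at this
  rw [this, neg_add']

lemma softmax_zero : softmax (0 : reducedRegular m) = stdSimplex.barycenter := by
  refine stdSimplex.ext (funext fun j => ?_)
  rw [softmax_apply]
  refine Eq.trans ?_ (stdSimplex.barycenter_apply _).symm
  simp

end Softmax

/-! ### The homeomorphism for alternating words. -/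

section Sphere

variable {m i : ℕ} [NeZero m] {c : Cycle Letter} {ω : List Letter}

lemma cyclicLetter_add_two_mul {hm : ω.length = m}
    (halt : ∀ j, cyclicLetter hm j ≠ cyclicLetter hm (j + 1)) (l : ℤ) (j : ZMod m) :
    cyclicLetter hm (j + (2 * l : ℤ)) = cyclicLetter hm j := by
  have h2 : ∀ j, cyclicLetter hm (j + 2) = cyclicLetter hm j := fun j => by
    refine letter_eq_of_ne_of_ne (halt j) ?_
    have := halt (j + 1)
    rwa [add_assoc, one_add_one_eq_two] at this
  induction l using Int.induction_on with
  | zero => simp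
  | succ l ih =>
    have := h2 (j + (2 * (l : ℤ) : ℤ))
    rw [ih] at this
    rw [← this]; push_cast; congr 1; ring
  | pred l ih => rw [← ih, ← h2 (j + (2 * (-(l : ℤ) - 1) : ℤ))]; push_cast; congr 1; ring

/-- The symmetries of an alternating word are the even shifts, and for `m = 2 * i` these are the
elements annihilated by `i`. -/
lemma cyclicLetter_periodic_iff {hm : ω.length = m} (hmi : m = 2 * i)
    (halt : ∀ j, cyclicLetter hm j ≠ cyclicLetter hm (j + 1)) (d : ℤ) :
    (∀ j, cyclicLetter hm (j + d) = cyclicLetter hm j) ↔ i • (d : ZMod m) = 0 := by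
  have hi : (i : ℤ) ≠ 0 := by
    have := NeZero.ne m
    omega
  have h1 : i • (d : ZMod m) = 0 ↔ (2 : ℤ) ∣ d := by
    rw [nsmul_eq_mul, ← Int.cast_natCast, ← Int.cast_mul, ZMod.intCast_zmod_eq_zero_iff_dvd, hmi]
    push_cast
    rw [mul_comm (2 : ℤ)]
    exact mul_dvd_mul_iff_left hi
  rw [h1]
  constructor
  · intro h
    by_contra hd
    obtain ⟨l, rfl⟩ : ∃ l, d = 2 * l + 1 := ⟨d / 2, by omega⟩
    have h2 := h 0
    rw [show ((2 * l + 1 : ℤ) : ZMod m) = 1 + (2 * l : ℤ) by push_cast; ring, ← add_assoc,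
      cyclicLetter_add_two_mul halt] at h2
    exact halt 0 h2.symm
  · rintro ⟨l, rfl⟩ j
    exact cyclicLetter_add_two_mul halt l j

lemma toCircle_intCast_eq (d : ℤ) : ZMod.toCircle (d : ZMod m) = circlePt (d / m) := by
  refine Circle.ext ?_
  rw [ZMod.toCircle_intCast, circlePt, Circle.coe_exp]
  congr 1
  push_cast
  ring

/-- The map from the product of the representation sphere and the circle to the summand. -/
noncomputable def sphereMap (hω : (ω : Cycle Letter) = c) (hm : ω.length = m) :
    OnePoint (reducedRegular m) × Circle → WordSummand c
  | (none, _) => WordSummand.base c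
  | (some a, z) => ringPoint hω hm (softmax a, z)

lemma sphereMap_coe (hω : (ω : Cycle Letter) = c) (hm : ω.length = m) (a : reducedRegular m)
    (z : Circle) : sphereMap hω hm ((a : OnePoint (reducedRegular m)), z) =
      ringPoint hω hm (softmax a, z) := rfl

lemma smul_base (hc : c.length ≠ 0) (z : Circle) :
    z • WordSummand.base c = WordSummand.base c :=
  divisor_injective hc (by rw [divisor_smul, divisor_base, Multiset.map_zero])

lemma smul_sphereMap (hω : (ω : Cycle Letter) = c) (hm : ω.length = m) (z w : Circle)
    (a : OnePoint (reducedRegular m)) :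
    z • sphereMap hω hm (a, w) = sphereMap hω hm (a, z * w) := by
  induction a using OnePoint.rec with
  | infty => exact smul_base (cycle_length hω hm) z
  | coe a => exact smul_ringPoint hω hm z _ w

/-- Only continuity at infinity needs an argument. The preimage of the complement of a neighbourhood
of the base point is compact and avoids the boundary of the simplex, so it corresponds to a compact
set in the representation. -/
lemma continuous_sphereMap (hω : (ω : Cycle Letter) = c) (hm : ω.length = m)
    (halt : ∀ j, cyclicLetter hm j ≠ cyclicLetter hm (j + 1)) :
    Continuous (sphereMap (c := c) hω hm) := by
  have := t2Space_wordSummand (cycle_length hω hm)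
  have hcont := continuous_ringPoint hω hm
  refine continuous_iff_continuousAt.mpr ?_
  rintro ⟨a, z⟩
  induction a using OnePoint.rec with
  | coe a =>
    have he : Topology.IsOpenEmbedding
        (Prod.map ((↑) : reducedRegular m → OnePoint (reducedRegular m)) (id : Circle → Circle)) :=
      OnePoint.isOpenEmbedding_coe.prodMap Topology.IsOpenEmbedding.id
    refine (he.continuousAt_iff (x := (a, z))).mp ?_
    exact (hcont.comp (continuous_softmax.prodMap continuous_id)).continuousAt
  | infty =>
    intro U hU
    rw [Filter.mem_map]
    obtain ⟨U', hU'U, hU'o, hU'b⟩ := mem_nhds_iff.mp hU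
    -- The gap vectors for which some mean position gives a configuration outside `U'`.
    let K : Set (stdSimplex ℝ (ZMod m)) := Prod.fst '' ((ringPoint hω hm) ⁻¹' U'ᶜ)
    have hK : IsCompact K :=
      ((hU'o.isClosed_compl.preimage hcont).isCompact).image continuous_fst
    have hKpos : K ⊆ {v | ∀ j, 0 < v j} := by
      rintro _ ⟨⟨v, w⟩, hv, rfl⟩ j
      refine lt_of_le_of_ne (stdSimplex.zero_le v j) fun h => hv ?_
      have : ringPoint hω hm (v, w) = WordSummand.base c :=
        (ringPoint_eq_base_iff hω hm _).mpr ⟨j, halt j, h.symm⟩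
      change ringPoint hω hm (v, w) ∈ U'
      rw [this]; exact hU'b
    have hC : IsCompact (logmean '' K) := hK.image_of_continuousOn (continuousOn_logmean.mono hKpos)
    have hO : IsOpen (((↑) '' (logmean '' K) : Set (OnePoint (reducedRegular m)))ᶜ) :=
      OnePoint.isOpen_compl_image_coe.mpr ⟨hC.isClosed, hC⟩
    refine Filter.mem_of_superset (prod_mem_nhds (hO.mem_nhds (by simp)) Filter.univ_mem) ?_
    rintro ⟨b, w⟩ ⟨hb, _⟩
    refine hU'U ?_
    induction b using OnePoint.rec with
    | infty => exact hU'b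
    | coe b =>
      by_contra hn
      exact hb ⟨b, ⟨softmax b, ⟨(softmax b, w), hn, rfl⟩, logmean_softmax b⟩, rfl⟩

lemma sphereMap_balanced (hω : (ω : Cycle Letter) = c) (hm : ω.length = m) (hmi : m = 2 * i)
    (halt : ∀ j, cyclicLetter hm j ≠ cyclicLetter hm (j + 1))
    {p q : OnePoint (reducedRegular m) × Circle} (h : BalancedRel m i p q) :
    sphereMap hω hm p = sphereMap hω hm q := by
  rcases h with ⟨z, w⟩ | ⟨k, hk, a, z⟩
  · rfl
  · induction a using OnePoint.rec with
    | infty => rfl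
    | coe a =>
      obtain ⟨d, rfl⟩ := ZMod.intCast_surjective k
      rw [toCircle_intCast_eq, OnePoint.map_some, sphereMap_coe, sphereMap_coe]
      exact ringPoint_shift hω hm ((cyclicLetter_periodic_iff hmi halt d).mpr hk)
        (softmax_regularShift _ a) z

lemma ringPoint_softmax_ne_base (hω : (ω : Cycle Letter) = c) (hm : ω.length = m)
    (a : reducedRegular m) (z : Circle) :
    ringPoint hω hm (softmax a, z) ≠ WordSummand.base c := fun h => by
  obtain ⟨j, _, hj⟩ := (ringPoint_eq_base_iff hω hm _).mp h
  exact (softmax_pos a j).ne' hj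

/-- Away from the base point the fibres are orbits of the symmetries of the word, which are exactly
the identifications by `C_i`. -/
lemma mk_eq_of_sphereMap_eq (hω : (ω : Cycle Letter) = c) (hm : ω.length = m) (hmi : m = 2 * i)
    (halt : ∀ j, cyclicLetter hm j ≠ cyclicLetter hm (j + 1))
    {a b : OnePoint (reducedRegular m)} {z w : Circle}
    (h : sphereMap hω hm (a, z) = sphereMap hω hm (b, w)) :
    InducedSphere.mk i a z = InducedSphere.mk i b w := by
  induction a using OnePoint.rec with
  | infty =>
    induction b using OnePoint.rec with
    | infty => exact Quot.sound (.base z w)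
    | coe b => exact absurd h.symm (ringPoint_softmax_ne_base hω hm b w)
  | coe a =>
    induction b using OnePoint.rec with
    | infty => exact absurd h (ringPoint_softmax_ne_base hω hm a z)
    | coe b =>
      obtain ⟨d, hd, hv, rfl⟩ :=
        exists_shift_of_ringPoint_eq hω hm h (ringPoint_softmax_ne_base hω hm a z)
      have hb : b = regularShift d a := by
        rw [← logmean_softmax b, ← logmean_softmax (regularShift d a)]
        congr 1
        refine stdSimplex.ext (funext fun j => ?_)
        rw [hv, softmax_regularShift]
      have hrel : BalancedRel m i ((a : OnePoint (reducedRegular m)).map (regularShift d), w)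
          ((a : OnePoint (reducedRegular m)), ZMod.toCircle (d : ZMod m) * w) :=
        BalancedRel.balance (d : ZMod m) ((cyclicLetter_periodic_iff hmi halt d).mp hd)
          (a : OnePoint (reducedRegular m)) w
      rw [hb, ← toCircle_intCast_eq]
      exact (Quot.sound hrel).symm

lemma sphereMap_surjective (hω : (ω : Cycle Letter) = c) (hm : ω.length = m)
    (halt : ∀ j, cyclicLetter hm j ≠ cyclicLetter hm (j + 1)) :
    Function.Surjective (sphereMap (c := c) hω hm) := by
  intro p
  by_cases hp : p = WordSummand.base c
  · exact ⟨(OnePoint.infty, 1), hp.symm⟩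
  · obtain ⟨⟨v, z⟩, rfl⟩ := ringPoint_surjective hω hm ⟨0, halt 0⟩ p
    refine ⟨((logmean v : reducedRegular m), z), ?_⟩
    rw [sphereMap_coe, softmax_logmean]
    intro j
    refine lt_of_le_of_ne (stdSimplex.zero_le v j) fun h => hp ?_
    exact (ringPoint_eq_base_iff hω hm _).mpr ⟨j, halt j, h.symm⟩

/-- The balanced relation is exactly the fibre relation of `sphereMap`, so the induced map is a
continuous bijection from a compact space to a Hausdorff space. The origin has equal gaps, which
gives the barycentre. -/
lemma exists_homeomorph_of_alternating (hω : (ω : Cycle Letter) = c) (hm : ω.length = m)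
    (hmi : m = 2 * i) (halt : ∀ j, cyclicLetter hm j ≠ cyclicLetter hm (j + 1)) :
    ∃ e : InducedSphere m i ≃ₜ WordSummand c,
      (∀ (z : Circle) (p : InducedSphere m i), e (z • p) = z • e p) ∧
      e (InducedSphere.base m i) = WordSummand.base c ∧
      e (InducedSphere.mk i ((0 : reducedRegular m) : OnePoint _) 1) =
        CyclicSet.pt (letterSimplex ω hω) stdSimplex.barycenter := by
  have := t2Space_wordSummand (cycle_length hω hm)
  have : CompactSpace (InducedSphere m i) := inferInstanceAs (CompactSpace (Quot (BalancedRel m i)))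
  let f : InducedSphere m i → WordSummand c :=
    Quot.lift (sphereMap hω hm) fun _ _ h => sphereMap_balanced hω hm hmi halt h
  have hf : Continuous f := continuous_quot_lift _ (continuous_sphereMap hω hm halt)
  have hbij : Function.Bijective f := by
    constructor
    · intro p q h
      induction p using Quot.ind with | _ p =>
      induction q using Quot.ind with | _ q =>
      exact mk_eq_of_sphereMap_eq hω hm hmi halt h
    · intro p
      obtain ⟨q, hq⟩ := sphereMap_surjective hω hm halt p
      exact ⟨Quot.mk _ q, hq⟩
  refine ⟨Continuous.homeoOfEquivCompactToT2 (f := Equiv.ofBijective f hbij) hf, fun z p => ?_,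
    rfl, ?_⟩
  · induction p using Quot.ind with | _ p =>
    exact (smul_sphereMap hω hm z p.2 p.1).symm
  · refine Eq.trans ?_ (ringPoint_barycenter hω hm)
    rw [← softmax_zero]
    rfl

end Sphere

theorem lemma1p3 (c : Cycle Letter) (hc : 2 ≤ wordPeriod c) :
    (wordPeriod c = 2 → ∀ (i : ℕ) [NeZero i], c.length = 2 * i →
      ∀ (ω : List Letter) (hω : (ω : Cycle Letter) = c),
        ∃ e : InducedSphere (2 * i) i ≃ₜ WordSummand c,
          (∀ (z : Circle) (p : InducedSphere (2 * i) i), e (z • p) = z • e p) ∧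
          e (InducedSphere.base (2 * i) i) = WordSummand.base c ∧
          e (InducedSphere.mk i ((0 : reducedRegular (2 * i)) : OnePoint _) 1) =
            CyclicSet.pt (letterSimplex ω hω) stdSimplex.barycenter) ∧
    (2 < wordPeriod c → IsEquivariantlyContractible (WordSummand c) (WordSummand.base c)) := by
  constructor
  · intro h2 i _ hi ω hω
    have hm : ω.length = 2 * i := by rw [← hi, ← hω]; rfl
    exact exists_homeomorph_of_alternating hω hm rfl (ne_of_period_eq_two hω hm h2)
  · intro h2
    obtain ⟨ω, hω⟩ : ∃ ω : List Letter, (ω : Cycle Letter) = c := Quotient.exists_rep c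
    -- The empty word is fixed by every rotation, so its period is at most one.
    have : NeZero ω.length := ⟨fun h => by
      have h0 := List.eq_nil_of_length_eq_zero h
      have := wordPeriod_le_of_rotate hω one_pos (by rw [h0]; rfl)
      omega⟩
    exact isEquivariantlyContractible_of_exists_eq hω rfl (exists_ne_of_two_le hω rfl hc)
      (exists_eq_of_two_lt hω rfl h2)
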